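/- **Setting.** Let $d\ge 2$ and let $M$ be one of $\mathbb R^d$, the unit sphere $\mathbb S^d$, the hyperbolic space $\mathbb H^d$, of curvature $\kappa=0,1,-1$. Put $(\mathrm{cs}\,r,\mathrm{sn}\,r)=(1,r)$, $(\cos r,\sin r)$, $(\cosh r,\sinh r)$ respectively. Realize $M$ in $\mathbb R^d\times\mathbb R\ni q=(y,s)$ as $\{s=1\}$, $\{|y|^2+s^2=1\}$, $\{s^2-|y|^2=1,\ s>0\}$, with the metric induced by $\langle y,y'\rangle+\kappa ss'$; velocities are written $v=(w,\sigma)$. The tangent bundle $TM$ carries the symplectic form of $T^*M$, transported by the Legendre transformation. Let $Z_1=(0,1)$ be a center of mass $m_1>0$, and $Z_2=(\mathrm{sn}(2h)\,u,\mathrm{cs}(2h))$ a center of mass $m_2\in\mathbb R$ at distance $2h>0$ from $Z_1$ in the direction of a unit vector $u\in\mathbb R^d$ (with $h<\pi/2$ on the sphere). With $V_i(q)=-m_i\,\mathrm{cs}(\theta_i)/\mathrm{sn}(\theta_i)$, $\theta_i=\mathrm{dist}(q,Z_i)$, let $$E_{Kep}=\tfrac12|v|^2+V_1(q),\qquad D=\mathrm{cs}(2h)\,C^2-\mathrm{sn}(2h)\,A_1,$$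 $$C^2=|y|^2|w|^2-\langle y,w\rangle^2,\quad A=\langle w,p\rangle y-\langle y,p\rangle w-m_1\frac{y}{|y|},\quad p=sw-\sigma y,\quad A_1=\langle A,u\rangle .$$ (In $\mathbb R^d$ this is $D=C^2-2hA_1$ with $C$ the angular momentum and $A$ the Laplace–Runge–Lenz vector.) Let $\mathcal R\subset TM$ be the set of states whose orbit under the Kepler problem $E_{Kep}$ does not pass through $Z_2$ (on the sphere: nor through $-Z_2$) and which satisfy: $E_{Kep}<0$ and $C\ne0$ if $M=\mathbb R^d$; the Kepler orbit is non-singular (complete, avoiding $\pm Z_1$) if $M=\mathbb S^d$; the Kepler orbit is non-singular and closed if $M=\mathbb H^d$. The *partially-averaged two-center system* is the Hamiltonian system on $\mathcal R$ with Hamiltonian $$E_a=E_{Kep}+\langle V_2\rangle,$$ where $\langle V_2\rangle$ at a state is the time average of $V_2$ over the closed Kepler orbit of that state. *Confocal family.* In homogeneous coordinates at the midpoint of $Z_1,Z_2$, namely $z=\mathrm{cs}(h)\langle y,u\rangle-\mathrm{sn}(h)s$, $\tilde s=\mathrm{cs}(h)s+\kappa\,\mathrm{sn}(h)\langle y,u\rangle$,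 $\rho^2=|y|^2-\langle y,u\rangle^2$, the members are the quadrics of revolution about the axis $Z_1Z_2$ with foci $Z_1,Z_2$, $$\frac{\rho^2}{l-\mathrm{sn}^2h}+\frac{\mathrm{cs}^2(h)\,z^2}{l}=\tilde s^{\,2},\qquad l\in\mathbb R\setminus\{0,\mathrm{sn}^2h\},$$ and their degenerations $z=0$, $\tilde s=0$ (non-empty only on the sphere) and, if $d=2$, the axis through $Z_1$ and $Z_2$. *Billiard.* Let the wall be a finite union of (relatively) open subsets of members of this one family. A billiard trajectory on $[t_0,t_1]$ follows the Hamiltonian flow of $E_a$ in $\mathcal R$, except at finitely many times, at which its position is on a piece of the wall and its velocity coordinate $v\in T_qM$ is reflected elastically, $v\mapsto v-2\frac{\langle v,n\rangle}{\langle n,n\rangle}n$ with $n\neq0$ normal to that piece at $q$; the states before and after the reflection lie in $\mathcal R$. A function is conserved if it is constant along every billiard trajectory. **Theorem.** $\mathcal R$ is open in $TM$ and $E_a$ is smooth on $\mathcal R$. Both $E_{Kep}$ and $D$ are conserved quantities of the billiard. The billiard is integrable: there are $d$ smooth conserved functions on $\mathcal R$, two of which are $E_{Kep}$ and $D$, that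 pairwise Poisson-commute on $\mathcal R$ and whose differentials are linearly independent on a dense subset of $\mathcal R$. (For $d=2$ these are just $E_{Kep}$ and $D$.) -/

import Mathlib

open Set Filter Topology
open scoped ContDiff

noncomputable section

namespace KeplerBilliard

/-! ### The three space forms -/

/-- The three geometries: the flat space, the unit sphere, the hyperbolic space. -/
inductive Geometry where
  | euclidean
  | spherical
  | hyperbolic

/-- The curvature of the geometry. -/
def Geometry.curv : Geometry → ℝ
  | .euclidean => 0
  | .spherical => 1
  | .hyperbolic => -1

/-- `1`, `cos`, `cosh` in the flat, spherical and hyperbolic case. -/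
def Geometry.cs : Geometry → ℝ → ℝ
  | .euclidean => fun _ => 1
  | .spherical => Real.cos
  | .hyperbolic => Real.cosh

/-- `r`, `sin r`, `sinh r` in the flat, spherical and hyperbolic case. -/
def Geometry.sn : Geometry → ℝ → ℝ
  | .euclidean => fun r => r
  | .spherical => Real.sin
  | .hyperbolic => Real.sinh

/-- The ambient linear space `ℝᵈ × ℝ` of the space forms. -/
abbrev Ambient (d : ℕ) : Type := EuclideanSpace ℝ (Fin d) × ℝ

/-- Pairs (position, velocity) of ambient vectors. -/
abbrev State (d : ℕ) : Type := Ambient d × Ambient d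

variable {d : ℕ}

/-- The ambient bilinear form `⟨y, y'⟩ + κ s s'`: the Euclidean product for the sphere, the
Lorentz product for the hyperbolic space, the product of the first factor in the flat case. -/
def form (G : Geometry) (a b : Ambient d) : ℝ :=
  inner ℝ a.1 b.1 + G.curv * (a.2 * b.2)

/-- The configuration space: the affine hyperplane `ℝᵈ × {1}`, the unit sphere
`‖y‖² + s² = 1`, or the sheet `s > 0` of the hyperboloid `s² - ‖y‖² = 1`. -/
def space (G : Geometry) (d : ℕ) : Set (Ambient d) :=
  {q | q.2 ^ 2 + G.curv * ‖q.1‖ ^ 2 = 1 ∧ (G ≠ .spherical → 0 < q.2)}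

/-- The tangent space of `space G d` at `q`; its Riemannian metric is the restriction of
`form G`. -/
def tangent (G : Geometry) (q : Ambient d) : Set (Ambient d) :=
  {v | q.2 * v.2 + G.curv * inner ℝ q.1 v.1 = 0}

/-- The tangent bundle of `space G d`. -/
def tangentBundle (G : Geometry) (d : ℕ) : Set (State d) :=
  {p | p.1 ∈ space G d ∧ p.2 ∈ tangent G p.1}

/-- The tangent space of the tangent bundle at `p = (q, v)`. -/
def phaseTangent (G : Geometry) (p : State d) : Set (State d) :=
  {Y | p.1.2 * Y.1.2 + G.curv * inner ℝ p.1.1 Y.1.1 = 0 ∧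
    Y.1.2 * p.2.2 + p.1.2 * Y.2.2
      + G.curv * (inner ℝ Y.1.1 p.2.1 + inner ℝ p.1.1 Y.2.1) = 0}

/-- The Riemannian distance on `space G d`. -/
def distance (G : Geometry) (q z : Ambient d) : ℝ :=
  match G with
  | .euclidean => ‖q.1 - z.1‖
  | .spherical => Real.arccos (form .spherical q z)
  | .hyperbolic => Real.arcosh (-form .hyperbolic q z)

/-! ### Hamiltonian dynamics on the tangent bundle -/

/-- The symplectic form `dq ∧ dv` on the tangent bundle, transported from the cotangent bundle
by the Legendre transformation `v ↦ ⟨v, ·⟩`: minus the differential of the Liouville form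
`⟨v, dq⟩`, evaluated on tangent vectors of the tangent bundle. -/
def symp (G : Geometry) (X Y : State d) : ℝ :=
  form G X.1 Y.2 - form G X.2 Y.1

/-- `X` is the Hamiltonian vector at `p` of the function `F` on the tangent bundle. (In
particular `F` is differentiable at `p` along the tangent bundle.) -/
def IsHamiltonianVector (G : Geometry) (F : State d → ℝ) (p X : State d) : Prop :=
  X ∈ phaseTangent G p ∧
    ∃ L : State d →L[ℝ] ℝ, HasFDerivWithinAt F L (tangentBundle G d) p ∧
      ∀ Y ∈ phaseTangent G p, symp G X Y = L Y

/-- The Poisson bracket of `F₁` and `F₂` exists and vanishes at `p`. -/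
def PoissonCommuteAt (G : Geometry) (F₁ F₂ : State d → ℝ) (p : State d) : Prop :=
  ∃ X₁ X₂, IsHamiltonianVector G F₁ p X₁ ∧ IsHamiltonianVector G F₂ p X₂ ∧ symp G X₁ X₂ = 0

/-- The differentials of the functions `F i` on the tangent bundle are linearly independent
at `p` (expressed through their Hamiltonian vectors, the symplectic form being
nondegenerate). -/
def IndependentAt {ι : Type} (G : Geometry) (F : ι → State d → ℝ) (p : State d) : Prop :=
  ∃ X : ι → State d, (∀ i, IsHamiltonianVector G (F i) p (X i)) ∧ LinearIndependent ℝ X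

/-- `F` is a smooth function on the subset `R` of the tangent bundle, which is an embedded
submanifold of `State d`. -/
def SmoothOnPhase (G : Geometry) (F : State d → ℝ) (R : Set (State d)) : Prop :=
  ∀ p ∈ R, ∃ U ∈ 𝓝 p, ∃ F' : State d → ℝ,
    ContDiffOn ℝ ∞ F' U ∧ ∀ x ∈ U ∩ tangentBundle G d, F x = F' x

/-! ### The two-center problem -/

/-- Data of a two-center problem: the geometry, the direction of the axis through the centers
(a unit vector), half of the distance between the centers, and the masses of the centers. -/
structure TwoCenter (d : ℕ) where
  geom : Geometry
  axis : EuclideanSpace ℝ (Fin d)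
  halfDist : ℝ
  mass₁ : ℝ
  mass₂ : ℝ

namespace TwoCenter

variable (P : TwoCenter d)

/-- The first center (the Kepler center) is the base point of the space form. -/
def center₁ (_P : TwoCenter d) : Ambient d := (0, 1)

/-- The second center is the point at distance `2 * halfDist` from the first center in the
direction of the axis. -/
def center₂ : Ambient d :=
  (P.geom.sn (2 * P.halfDist) • P.axis, P.geom.cs (2 * P.halfDist))

/-- The potential at `q` of a center `z` of mass `m`: `-m / r`, `-m cot θ`, `-m coth θ`. -/
def potential (m : ℝ) (z q : Ambient d) : ℝ :=
  -(m * (P.geom.cs (distance P.geom q z) / P.geom.sn (distance P.geom q z)))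

/-- The Keplerian energy `E_Kep` with respect to the first center. -/
def keplerEnergy (p : State d) : ℝ :=
  form P.geom p.2 p.2 / 2 + P.potential P.mass₁ P.center₁ p.1

/-- The squared norm `C²` of the angular momentum about the first center. -/
def angMomSq (_P : TwoCenter d) (p : State d) : ℝ :=
  ‖p.1.1‖ ^ 2 * ‖p.2.1‖ ^ 2 - inner ℝ p.1.1 p.2.1 ^ 2

/-- The Laplace-Runge-Lenz vector `⟨w, ẋ⟩ y - ⟨y, ẋ⟩ w - m₁ y / ‖y‖` of the Kepler problem at
the first center, where `q = (y, s)`, `v = (w, σ)`. Here `ẋ = s w - σ y` is the velocity of the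
central projection `x = y / s` of `q`, up to a change of time, and the vector is the usual
Laplace-Runge-Lenz vector `‖ẋ‖² x - ⟨x, ẋ⟩ ẋ - m₁ x / ‖x‖` if `s > 0`, so in particular in
the flat case, where `x = y` and `ẋ = w`. -/
def lrl (p : State d) : EuclideanSpace ℝ (Fin d) :=
  let y := p.1.1
  let w := p.2.1
  let x' := p.1.2 • p.2.1 - p.2.2 • p.1.1
  (inner ℝ w x' : ℝ) • y - (inner ℝ y x' : ℝ) • w - (P.mass₁ / ‖y‖) • y

/-- The function `D`. In the flat case it is `C² - 2 h A₁`, with `h` half of the distance of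
the centers and `A₁` the component of the Laplace-Runge-Lenz vector in the direction of the
second center; in the curved cases it is `cs(2h) C² - sn(2h) A₁`. -/
def D (p : State d) : ℝ :=
  P.geom.cs (2 * P.halfDist) * P.angMomSq p
    - P.geom.sn (2 * P.halfDist) * inner ℝ (P.lrl p) P.axis

/-- `γ` is a complete, non-singular solution of the Kepler problem of the first center. (In the
spherical case also the antipode of the center is a singularity.) -/
def IsKeplerOrbit (γ : ℝ → State d) : Prop :=
  ∀ t, γ t ∈ tangentBundle P.geom d ∧ (γ t).1 ≠ P.center₁ ∧ (γ t).1 ≠ -P.center₁ ∧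
    ∃ X, IsHamiltonianVector P.geom P.keplerEnergy (γ t) X ∧ HasDerivAt γ X t

/-- The condition that selects the non-singular closed Kepler orbits: negative energy and
non-zero angular momentum in the flat case; non-singular orbits on the sphere; closed
non-singular orbits in the hyperbolic space. -/
def HasRegularOrbit (p : State d) : Prop :=
  match P.geom with
  | .euclidean => P.keplerEnergy p < 0 ∧ P.angMomSq p ≠ 0
  | .spherical => ∃ γ, P.IsKeplerOrbit γ ∧ γ 0 = p
  | .hyperbolic => ∃ γ, P.IsKeplerOrbit γ ∧ γ 0 = p ∧ ∃ T, 0 < T ∧ Function.Periodic γ T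

/-- The Kepler orbit of `p` passes through the second center (on the sphere: or through its
antipode; in the other cases the antipode is not a point of the space). -/
def HitsSecondCenter (p : State d) : Prop :=
  ∃ γ, P.IsKeplerOrbit γ ∧ γ 0 = p ∧ ∃ t, (γ t).1 = P.center₂ ∨ (γ t).1 = -P.center₂

/-- The averaging region. -/
def region : Set (State d) :=
  {p | p ∈ tangentBundle P.geom d ∧ P.HasRegularOrbit p ∧ ¬ P.HitsSecondCenter p}

open Classical in
/-- The average of a function `V` of the position over the closed Kepler orbit of `p`, with
respect to time. (The solution `γ` is unique, and the value is the same for all periods.) -/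
def keplerAverage (V : Ambient d → ℝ) (p : State d) : ℝ :=
  if h : ∃ c : (ℝ → State d) × ℝ,
      P.IsKeplerOrbit c.1 ∧ c.1 0 = p ∧ 0 < c.2 ∧ Function.Periodic c.1 c.2 then
    (h.choose.2)⁻¹ * ∫ t in (0 : ℝ)..h.choose.2, V (h.choose.1 t).1
  else 0

/-- The Hamiltonian of the partially-averaged system: the Keplerian energy plus the average of
the potential of the second center over the closed Kepler orbits of the first. -/
def averagedEnergy (p : State d) : ℝ :=
  P.keplerEnergy p + P.keplerAverage (P.potential P.mass₂ P.center₂) p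

/-! ### The confocal family and the billiards -/

/-- Homogeneous coordinates adapted to the midpoint of the two centers: the coordinate along
the midpoint. -/
def midCoord (q : Ambient d) : ℝ :=
  P.geom.cs P.halfDist * q.2
    + P.geom.curv * (P.geom.sn P.halfDist * inner ℝ q.1 P.axis)

/-- Homogeneous coordinates adapted to the midpoint of the two centers: the coordinate along
the axis. -/
def axisCoord (q : Ambient d) : ℝ :=
  P.geom.cs P.halfDist * inner ℝ q.1 P.axis - P.geom.sn P.halfDist * q.2

/-- The squared distance `ρ²` from the axis of the component `y` of `q = (y, s)`. -/
def rhoSq (q : Ambient d) : ℝ := ‖q.1‖ ^ 2 - inner ℝ q.1 P.axis ^ 2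

/-- With `(ρ, z, s)` the homogeneous coordinates at the midpoint and `c = cs h`, `b = sn h`:
the equation `ρ² / (l - b²) + c² z² / l = s²`, multiplied by `l (l - b²)`. In the flat case
(`s = 1`, `c = 1`, `b = h`) these are the quadrics of revolution `ρ² / (l - h²) + z² / l = 1`
with foci `z = ± h`. In the central projection from the midpoint, the centers are at
`z / s = ± a` with `a = b / c`, and these are the quadrics with these foci for the norm
`‖(x, z)‖² = ‖x‖² + z² / (1 + κ a²)`, `1 + κ a² = 1 / c²`; the homogeneous equation is
the analytic extension to the whole space. -/
def quadricEq (l : ℝ) (q : Ambient d) : ℝ :=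
  l * P.rhoSq q + P.geom.cs P.halfDist ^ 2 * (l - P.geom.sn P.halfDist ^ 2) * P.axisCoord q ^ 2
    - l * (l - P.geom.sn P.halfDist ^ 2) * P.midCoord q ^ 2

/-- `f = 0` is the equation of a member of the confocal family with foci at the two centers:
a quadric of revolution, or one of the degenerate members, which are the bisector of the
centers (`l = 0`), on the sphere the equator with respect to the midpoint (`l = ∞`; empty in
the other cases), and in dimension two the axis (`l = b²`). -/
def IsConfocal (f : Ambient d → ℝ) : Prop :=
  (∃ l : ℝ, l ≠ 0 ∧ l ≠ P.geom.sn P.halfDist ^ 2 ∧ f = P.quadricEq l) ∨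
  f = P.axisCoord ∨
  f = P.midCoord ∨
  (d = 2 ∧ ∃ e : EuclideanSpace ℝ (Fin d), e ≠ 0 ∧ inner ℝ e P.axis = 0 ∧
    f = fun q => inner ℝ q.1 e)

/-- An open subset of a member of the confocal family. -/
structure WallPiece where
  eqn : Ambient d → ℝ
  confocal : P.IsConfocal eqn
  dom : Set (Ambient d)
  isOpen_dom : IsOpen dom

variable {P} in
/-- The points of a piece of the wall. -/
def WallPiece.carrier (B : P.WallPiece) : Set (Ambient d) :=
  {q | q ∈ space P.geom d ∧ q ∈ B.dom ∧ B.eqn q = 0}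

variable {P} in
/-- `v'` is the velocity after an elastic reflection at `q` in the wall piece `B` with incoming
velocity `v`: the reflection in the tangent hyperplane of `B`, whose normal is the Riemannian
gradient `n ≠ 0` of the defining function. -/
def WallPiece.Reflects (B : P.WallPiece) (q v v' : Ambient d) : Prop :=
  q ∈ B.carrier ∧ ∃ n ∈ tangent P.geom q, n ≠ 0 ∧
    (∃ L : Ambient d →L[ℝ] ℝ, HasFDerivWithinAt B.eqn L (space P.geom d) q ∧
      ∀ a ∈ tangent P.geom q, form P.geom n a = L a) ∧
    v' = v - (2 * form P.geom v n / form P.geom n n) • n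

/-- `γ` is, on `[t₀, t₁]`, a trajectory of the billiard with the partially-averaged system as
underlying system and the union of the finitely many pieces `B i` as reflection wall. `T` is the
finite set of times at which the particle is at the wall. At these times the velocity may
jump, and `γ` takes the outgoing value. -/
structure IsBilliardTrajectory {n : ℕ} (B : Fin n → P.WallPiece) (γ : ℝ → State d)
    (t₀ t₁ : ℝ) (T : Finset ℝ) : Prop where
  mem_region : ∀ t ∈ Icc t₀ t₁, γ t ∈ P.region
  off_wall : ∀ t ∈ Icc t₀ t₁, t ∉ T → ∀ i, (γ t).1 ∉ (B i).carrier
  flow : ∀ t ∈ Icc t₀ t₁, t ∉ T → ∃ X, IsHamiltonianVector P.geom P.averagedEnergy (γ t) X ∧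
    HasDerivWithinAt γ X (Icc t₀ t₁) t
  on_wall : ∀ t ∈ Icc t₀ t₁, t ∈ T → ∃ i, (γ t).1 ∈ (B i).carrier
  right_cont : ∀ t ∈ Icc t₀ t₁, t ∈ T → ContinuousWithinAt γ (Icc t t₁) t
  reflect : ∀ t ∈ Ioc t₀ t₁, t ∈ T → ∃ v i, ((γ t).1, v) ∈ P.region ∧
    Tendsto γ (𝓝[Ico t₀ t] t) (𝓝 ((γ t).1, v)) ∧ (B i).Reflects (γ t).1 v (γ t).2

/-- `F` is a conserved quantity of the billiard system. -/
def IsConserved {n : ℕ} (B : Fin n → P.WallPiece) (F : State d → ℝ) : Prop :=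
  ∀ (γ : ℝ → State d) (t₀ t₁ : ℝ) (T : Finset ℝ), P.IsBilliardTrajectory B γ t₀ t₁ T →
    ∀ s ∈ Icc t₀ t₁, ∀ t ∈ Icc t₀ t₁, F (γ s) = F (γ t)

/-- The partially-averaged system is a smooth Hamiltonian system on an open subset of the
tangent bundle. -/
def IsSmoothSystem : Prop :=
  (∃ O : Set (State d), IsOpen O ∧ P.region = O ∩ tangentBundle P.geom d) ∧
    SmoothOnPhase P.geom P.averagedEnergy P.region

/-- Integrability of the billiard, witnessed by `F`: the `F i`, as many as the dimension of the
configuration space, are smooth conserved quantities, are in involution, and are independent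
on a dense subset of the phase space. -/
def IsIntegrableWith {n : ℕ} (B : Fin n → P.WallPiece) (F : Fin d → State d → ℝ) : Prop :=
  (∀ i, SmoothOnPhase P.geom (F i) P.region) ∧
  (∀ i, P.IsConserved B (F i)) ∧
  (∀ i j, ∀ p ∈ P.region, PoissonCommuteAt P.geom (F i) (F j) p) ∧
  P.region ⊆ closure {p | p ∈ P.region ∧ IndependentAt P.geom F p}

end TwoCenter

end KeplerBilliard

end

noncomputable section

namespace KeplerBilliard

variable {d : ℕ}

attribute [local fun_prop] ContDiffAt.inner ContDiff.inner Continuous.inner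

/-! ### Trigonometry and elementary geometry of the space forms -/

/-! The reason for commutation is the separability of the unaveraged two-center problem. Its second
integral is `D` plus a function of the position, a constant multiple of `conjFun`. Since `D`
Poisson-commutes with the Keplerian energy, and two functions of the position commute, the bracket
of the second potential with `D` is a total time derivative along Kepler orbits. Its integral over a
closed orbit therefore vanishes. The flow of `D` permutes the Kepler orbits, so the average of the
second potential is invariant under it. The average is trivially invariant under the Kepler flow
and, the axis being fixed, under rotations about the axis.

To make this rigorous, and to see that the averaged energy is smooth, orbits are described by
elements relative to the axis. In all three geometries the quotient `u = s / ‖y‖` satisfies `u'' + u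
= k` in the orbital angle. A closed orbit becomes an explicit curve over `[0, 2π]`, and the average
becomes the quotient `orbitAverage` of two integrals over this fixed interval, smooth in the
elements by `contDiffOn_parametric`. The region turns into open conditions on the elements
(`mem_region_iff`), for which closed orbits are constructed explicitly (`exists_periodic_orbit`) and
radial ones excluded. The total derivative argument is carried out by `fderiv_integral_weight` and
`fderiv_integral_weightedPot`: numerator and denominator of the average have the same logarithmic
derivative along the flow of `D`, whence `fderiv_orbitAverage`.

At a wall the Keplerian energy survives because the speed does. `D` is quadratic in the velocity,
and the conormals of confocal quadrics are eigenvectors of the quadratic part (`IsConfocal.eigen`).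
A reflection along an eigenvector preserves the quadratic form, so `D_reflect` applies.

For `d ≥ 3` the remaining integrals are squared angular momenta in an increasing chain of subspaces
orthogonal to the axis; they commute because the subspaces are nested and survive reflections
because the walls are rotationally symmetric. Independence is reduced to finitely many minors, each
of which is made nonzero by an arbitrarily small perturbation (`region_subset_closure`). -/

theorem Geometry.curv_pow_three (G : Geometry) : G.curv ^ 3 = G.curv := by
  cases G <;> norm_num [Geometry.curv]

theorem Geometry.cs_sq_add (G : Geometry) (h : ℝ) : G.cs h ^ 2 + G.curv * G.sn h ^ 2 = 1 := by
  cases G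
  · simp [Geometry.cs, Geometry.sn, Geometry.curv]
  · simp [Geometry.cs, Geometry.sn, Geometry.curv]
  · have := Real.cosh_sq h
    simp only [Geometry.cs, Geometry.sn, Geometry.curv]
    linarith

theorem Geometry.cs_two_mul (G : Geometry) (h : ℝ) :
    G.cs (2 * h) = G.cs h ^ 2 - G.curv * G.sn h ^ 2 := by
  cases G
  · simp [Geometry.cs, Geometry.sn, Geometry.curv]
  · simp [Geometry.cs, Geometry.sn, Geometry.curv, Real.cos_two_mul']
  · simp [Geometry.cs, Geometry.sn, Geometry.curv, Real.cosh_two_mul]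

theorem Geometry.sn_two_mul (G : Geometry) (h : ℝ) :
    G.sn (2 * h) = 2 * G.sn h * G.cs h := by
  cases G
  · simp [Geometry.cs, Geometry.sn]
  · simp [Geometry.cs, Geometry.sn, Real.sin_two_mul]
  · simp [Geometry.cs, Geometry.sn, Real.sinh_two_mul]

theorem Geometry.cs_zero (G : Geometry) : G.cs 0 = 1 := by
  cases G <;> simp [Geometry.cs]

theorem Geometry.sn_zero (G : Geometry) : G.sn 0 = 0 := by
  cases G <;> simp [Geometry.sn]

theorem space_sq {G : Geometry} {q : Ambient d} (hq : q ∈ space G d) :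
    q.2 ^ 2 + G.curv * ‖q.1‖ ^ 2 = 1 := hq.1

theorem snd_eq_one_of_mem_space {q : Ambient d} (hq : q ∈ space .euclidean d) : q.2 = 1 := by
  have h1 := hq.1
  have h2 := hq.2 (by simp)
  simp only [Geometry.curv, zero_mul, add_zero] at h1
  nlinarith

theorem snd_eq_zero_of_mem_tangent {q v : Ambient d} (hq : q ∈ space .euclidean d)
    (hv : v ∈ tangent .euclidean q) : v.2 = 0 := by
  have h1 := snd_eq_one_of_mem_space hq
  simpa [tangent, Geometry.curv, h1] using hv

/-- In all geometries `(1 - κ²)` annihilates the last coordinate of a tangent vector. -/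
theorem curv_sq_mul_snd {G : Geometry} {q v : Ambient d} (hq : q ∈ space G d)
    (hv : v ∈ tangent G q) : G.curv ^ 2 * v.2 = v.2 := by
  cases G
  · simp [snd_eq_zero_of_mem_tangent hq hv]
  · simp [Geometry.curv]
  · simp [Geometry.curv]

/-- Only the hyperbolic case needs an argument: tangency gives `s σ = ⟨y, w⟩`, and Cauchy-Schwarz
together with `‖y‖² = s² - 1` makes the Lorentz form definite on the tangent space. In the flat case
the degenerate direction is not tangent. -/
theorem eq_zero_of_form_self {G : Geometry} {q v : Ambient d} (hq : q ∈ space G d)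
    (hv : v ∈ tangent G q) (h : form G v v = 0) : v = 0 := by
  obtain ⟨y, s⟩ := q
  obtain ⟨w, σ⟩ := v
  simp only [form, real_inner_self_eq_norm_sq] at h
  cases G
  · have h2 := snd_eq_zero_of_mem_tangent hq hv
    simp only [Geometry.curv] at h h2
    have : ‖w‖ = 0 := by nlinarith
    simp_all
  · simp only [Geometry.curv] at h
    have h1 : ‖w‖ ^ 2 = 0 := by nlinarith [sq_nonneg ‖w‖, sq_nonneg σ]
    have h2 : σ ^ 2 = 0 := by nlinarith [sq_nonneg ‖w‖, sq_nonneg σ]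
    simp_all
  · have hq1 := hq.1
    have hq2 := hq.2 (by simp)
    simp only [tangent, Geometry.curv, mem_ofPred_eq] at h hq1 hq2 hv
    have hc := abs_le.1 (abs_real_inner_le_norm y w)
    have e1 : s * σ = inner ℝ y w := by linarith
    have e2 : (s * σ) ^ 2 ≤ (‖y‖ * ‖w‖) ^ 2 := by
      rw [e1]
      exact sq_le_sq' hc.1 hc.2
    have e3 : ‖w‖ ^ 2 = σ ^ 2 := by linarith
    have e4 : σ ^ 2 = 0 := by
      have h5 : (s * σ) ^ 2 ≤ (s ^ 2 - 1) * σ ^ 2 := by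
        calc (s * σ) ^ 2 ≤ (‖y‖ * ‖w‖) ^ 2 := e2
          _ = (s ^ 2 - 1) * σ ^ 2 := by rw [mul_pow, e3]; congr 1; linarith
      nlinarith [sq_nonneg σ]
    have e5 : ‖w‖ ^ 2 = 0 := by rw [e3, e4]
    exact Prod.ext (norm_eq_zero.1 (pow_eq_zero_iff two_ne_zero |>.1 e5))
      (pow_eq_zero_iff two_ne_zero |>.1 e4)

theorem form_comm (G : Geometry) (a b : Ambient d) : form G a b = form G b a := by
  simp only [form, real_inner_comm]; ring

theorem form_sub_left (G : Geometry) (a b c : Ambient d) :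
    form G (a - b) c = form G a c - form G b c := by
  simp only [form, Prod.fst_sub, Prod.snd_sub, inner_sub_left]; ring

theorem form_smul_left (G : Geometry) (r : ℝ) (a c : Ambient d) :
    form G (r • a) c = r * form G a c := by
  simp only [form, Prod.smul_fst, Prod.smul_snd, inner_smul_left, smul_eq_mul]
  simp; ring

theorem symp_swap (G : Geometry) (X Y : State d) : symp G X Y = -symp G Y X := by
  simp only [symp, form_comm G X.1, form_comm G X.2]; ring

/-- The symplectic form is nondegenerate. -/
theorem eq_of_symp_eq {G : Geometry} {p X X' : State d} (hp : p ∈ tangentBundle G d)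
    (hX : X ∈ phaseTangent G p) (hX' : X' ∈ phaseTangent G p)
    (h : ∀ Y ∈ phaseTangent G p, symp G X Y = symp G X' Y) : X = X' := by
  have hd1 : X.1 - X'.1 ∈ tangent G p.1 := by
    have h1 := hX.1
    have h2 := hX'.1
    simp only [tangent, mem_ofPred_eq, Prod.fst_sub, Prod.snd_sub, inner_sub_right]
    linarith
  have e1 : X.1 = X'.1 := by
    have hY : ((0, X.1 - X'.1) : State d) ∈ phaseTangent G p := by
      refine ⟨by simp, ?_⟩
      have := hd1
      simp only [tangent, mem_ofPred_eq] at this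
      simpa using this
    have h1 := h _ hY
    simp only [symp] at h1
    have h2 : form G X.2 (0 : Ambient d) = 0 := by simp [form]
    have h3 : form G X'.2 (0 : Ambient d) = 0 := by simp [form]
    have h4 : form G (X.1 - X'.1) (X.1 - X'.1) = 0 := by
      rw [form_sub_left]; linarith
    exact sub_eq_zero.1 (eq_zero_of_form_self hp.1 hd1 h4)
  have hd2 : X.2 - X'.2 ∈ tangent G p.1 := by
    have h1 := hX.2
    have h2 := hX'.2
    rw [e1] at h1
    simp only [tangent, mem_ofPred_eq, Prod.fst_sub, Prod.snd_sub, inner_sub_right]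
    linarith
  have e2 : X.2 = X'.2 := by
    -- The base components agree by `e1`, so the second component of the test vector cancels in the
    -- comparison. It serves only to make the vector tangent: its coefficient is `-(σ Z₂ + κ ⟨Z₁,
    -- w⟩)` for the difference `Z`.
    have hY : ((X.2 - X'.2, (-(form G (X.2 - X'.2) p.2) * G.curv + (G.curv ^ 2 - 1) * p.2.2
        * (X.2 - X'.2).2) • p.1) : State d) ∈ phaseTangent G p := by
      refine ⟨hd2, ?_⟩
      have h1 := space_sq hp.1
      have h3 := G.curv_pow_three
      have h4 := curv_sq_mul_snd hp.1 hp.2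
      have h5 := curv_sq_mul_snd hp.1 hd2
      generalize X.2 - X'.2 = Z at *
      simp only [form, Prod.smul_fst, Prod.smul_snd, smul_eq_mul, inner_smul_right,
        real_inner_self_eq_norm_sq]
      linear_combination (-(G.curv * (inner ℝ Z.1 p.2.1 + G.curv * (Z.2 * p.2.2)))
        + (G.curv ^ 2 - 1) * p.2.2 * Z.2) * h1
    have h1 := h _ hY
    simp only [symp] at h1
    rw [e1] at h1
    have h4 : form G (X.2 - X'.2) (X.2 - X'.2) = 0 := by
      rw [form_sub_left]; linarith
    exact sub_eq_zero.1 (eq_zero_of_form_self hp.1 hd2 h4)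
  exact Prod.ext e1 e2

/-! ### Curves in the tangent bundle and differentials along it -/

/-- Every vector of the phase tangent space is the velocity of a curve in the tangent bundle. -/
theorem exists_curve {G : Geometry} {p Y : State d} (hp : p ∈ tangentBundle G d)
    (hY : Y ∈ phaseTangent G p) :
    ∃ c : ℝ → State d, c 0 = p ∧ HasDerivAt c Y 0 ∧ ∀ᶠ ε in 𝓝 0, c ε ∈ tangentBundle G d := by
  obtain ⟨⟨y, s⟩, ⟨w, σ⟩⟩ := p
  obtain ⟨⟨y', s'⟩, ⟨w', σ'⟩⟩ := Y
  obtain ⟨⟨h1, h2⟩, h3⟩ := hp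
  obtain ⟨h4, h5⟩ := hY
  simp only [tangent, mem_ofPred_eq] at h1 h2 h3 h4 h5
  -- Tangency kills the first-order terms, so along the straight line through `p` the two
  -- constraints fail by exactly `ε² ν` and `ε² τ`. Rescaling the position and subtracting a
  -- multiple of it from the velocity repairs this without changing the derivative at `0`.
  set ν : ℝ := s' ^ 2 + G.curv * ‖y'‖ ^ 2 with hν
  set τ : ℝ := s' * σ' + G.curv * inner ℝ y' w' with hτ
  have hN : ∀ ε : ℝ, (s + ε * s') ^ 2 + G.curv * ‖y + ε • y'‖ ^ 2 = 1 + ε ^ 2 * ν := by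
    intro ε
    rw [hν, norm_add_sq_real, norm_smul, inner_smul_right, mul_pow, Real.norm_eq_abs, sq_abs]
    linear_combination h1 + 2 * ε * h4
  have hT : ∀ ε : ℝ, (s + ε * s') * (σ + ε * σ') + G.curv * inner ℝ (y + ε • y') (w + ε • w')
      = ε ^ 2 * τ := by
    intro ε
    rw [hτ]
    simp only [inner_add_left, inner_add_right, inner_smul_left, inner_smul_right]
    simp only [conj_trivial]
    linear_combination h3 + ε * h5
  set q : ℝ → Ambient d := fun ε => (y + ε • y', s + ε * s') with hq
  have hqd : HasDerivAt q (y', s') 0 := by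
    have e1 : HasDerivAt (fun ε : ℝ => y + ε • y') ((1 : ℝ) • y') 0 :=
      ((hasDerivAt_id (0 : ℝ)).smul_const y').const_add y
    have e2 : HasDerivAt (fun ε : ℝ => s + ε * s') (1 * s') 0 :=
      ((hasDerivAt_id (0 : ℝ)).mul_const s').const_add s
    simpa using e1.prodMk e2
  set v : ℝ → Ambient d := fun ε => (w + ε • w', σ + ε * σ') with hv
  have hvd : HasDerivAt v (w', σ') 0 := by
    have e1 : HasDerivAt (fun ε : ℝ => w + ε • w') ((1 : ℝ) • w') 0 :=
      ((hasDerivAt_id (0 : ℝ)).smul_const w').const_add w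
    have e2 : HasDerivAt (fun ε : ℝ => σ + ε * σ') (1 * σ') 0 :=
      ((hasDerivAt_id (0 : ℝ)).mul_const σ').const_add σ
    simpa using e1.prodMk e2
  have hNd : HasDerivAt (fun ε : ℝ => 1 + ε ^ 2 * ν) 0 0 := by
    have := ((hasDerivAt_pow 2 (0 : ℝ)).mul_const ν).const_add 1
    simpa using this
  have hsd : HasDerivAt (fun ε : ℝ => (√(1 + ε ^ 2 * ν))⁻¹) 0 0 := by
    exact ((hNd.sqrt (by simp)).inv (by simp)).congr_deriv (by simp)
  have htd : HasDerivAt (fun ε : ℝ => ε ^ 2 * (τ * (1 + ε ^ 2 * ν)⁻¹)) 0 0 := by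
    exact ((hasDerivAt_pow 2 (0 : ℝ)).mul ((hNd.inv (by simp)).const_mul τ)).congr_deriv
      (by simp)
  refine ⟨fun ε => ((√(1 + ε ^ 2 * ν))⁻¹ • q ε,
    v ε - (ε ^ 2 * (τ * (1 + ε ^ 2 * ν)⁻¹)) • q ε), ?_, ?_, ?_⟩
  · simp [hq, hv]
  · have e1 := hsd.smul hqd
    have e2 := hvd.sub (htd.smul hqd)
    simpa using e1.prodMk e2
  · have c1 : ∀ᶠ ε in 𝓝 (0 : ℝ), 0 < 1 + ε ^ 2 * ν := by
      have := hNd.continuousAt.eventually_const_lt (show (0 : ℝ) < 1 + 0 ^ 2 * ν by simp)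
      exact this
    have c2 : ∀ᶠ ε in 𝓝 (0 : ℝ), (G ≠ .spherical → 0 < s + ε * s') := by
      by_cases hG : G = .spherical
      · simp [hG]
      · have : ContinuousAt (fun ε : ℝ => s + ε * s') 0 := by fun_prop
        have := this.eventually_const_lt (show (0 : ℝ) < s + 0 * s' by simpa using h2 hG)
        filter_upwards [this] with ε hε _ using hε
    filter_upwards [c1, c2] with ε hε hε2
    have hsq : √(1 + ε ^ 2 * ν) ^ 2 = 1 + ε ^ 2 * ν := Real.sq_sqrt hε.le
    have hsp : 0 < √(1 + ε ^ 2 * ν) := Real.sqrt_pos.2 hε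
    refine ⟨⟨?_, ?_⟩, ?_⟩
    · simp only [hq, Prod.smul_fst, Prod.smul_snd, smul_eq_mul, norm_smul, mul_pow,
        Real.norm_eq_abs, sq_abs, inv_pow, hsq]
      field_simp
      linear_combination hN ε
    · intro hG
      have := hε2 hG
      simp only [hq, Prod.smul_snd, smul_eq_mul]
      positivity
    · simp only [tangent, mem_ofPred_eq, hq, hv, Prod.smul_fst, Prod.smul_snd, smul_eq_mul,
        Prod.fst_sub, Prod.snd_sub, inner_sub_right, inner_smul_left, inner_smul_right,
        real_inner_self_eq_norm_sq, conj_trivial]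
      have e1 := hN ε
      have e2 := hT ε
      generalize (√(1 + ε ^ 2 * ν))⁻¹ = a at *
      have e3 : (1 + ε ^ 2 * ν)⁻¹ * (1 + ε ^ 2 * ν) = 1 := inv_mul_cancel₀ hε.ne'
      generalize (1 + ε ^ 2 * ν)⁻¹ = b at *
      linear_combination a * e2 - a * ε ^ 2 * τ * b * e1 - a * ε ^ 2 * τ * e3

/-- Two functions that agree on the tangent bundle have the same differential along it. -/
theorem hasFDerivWithinAt_unique {G : Geometry} {p Y : State d} {F F' : State d → ℝ}
    {L L' : State d →L[ℝ] ℝ} (hp : p ∈ tangentBundle G d) (hY : Y ∈ phaseTangent G p)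
    (hF : HasFDerivWithinAt F L (tangentBundle G d) p)
    (hF' : HasFDerivWithinAt F' L' (tangentBundle G d) p)
    (h : F =ᶠ[𝓝[tangentBundle G d] p] F') : L Y = L' Y := by
  obtain ⟨c, hc0, hc, hcm⟩ := exists_curve hp hY
  have hF2 : HasFDerivWithinAt F L' (tangentBundle G d) p :=
    hF'.congr_of_eventuallyEq h (h.self_of_nhdsWithin hp)
  have key : ∀ K : State d →L[ℝ] ℝ, HasFDerivWithinAt F K (tangentBundle G d) p →
      HasDerivAt (F ∘ c) (K Y) 0 := by
    intro K hK
    have h1 : HasDerivWithinAt (F ∘ c) (K Y) {ε | c ε ∈ tangentBundle G d} 0 := by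
      refine HasFDerivWithinAt.comp_hasDerivWithinAt (t := tangentBundle G d) 0 ?_
        hc.hasDerivWithinAt (fun ε hε => hε)
      rwa [hc0]
    exact h1.hasDerivAt hcm
  exact (key L hF).unique (key L' hF2)

/-- A Hamiltonian vector comes with some unknown differential; this permits computing with the
differential of any convenient extension instead, as is needed for the averaged energy. -/
theorem IsHamiltonianVector.apply_eq {G : Geometry} {F : State d → ℝ} {p X Y : State d}
    {L : State d →L[ℝ] ℝ} (hp : p ∈ tangentBundle G d) (hX : IsHamiltonianVector G F p X)
    (hL : HasFDerivWithinAt F L (tangentBundle G d) p) (hY : Y ∈ phaseTangent G p) :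
    symp G X Y = L Y := by
  obtain ⟨-, L', hL', h⟩ := hX
  rw [h Y hY]
  exact hasFDerivWithinAt_unique hp hY hL' hL EventuallyEq.rfl

theorem IsHamiltonianVector.unique {G : Geometry} {F : State d → ℝ} {p X X' : State d}
    (hp : p ∈ tangentBundle G d) (hX : IsHamiltonianVector G F p X)
    (hX' : IsHamiltonianVector G F p X') : X = X' := by
  refine eq_of_symp_eq hp hX.1 hX'.1 fun Y hY => ?_
  obtain ⟨-, L', hL', h⟩ := hX'
  rw [h Y hY]
  exact hX.apply_eq hp hL' hY

theorem fderiv_apply_of_line {E : Type*} [NormedAddCommGroup E] [NormedSpace ℝ E] {F : E → ℝ}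
    {p Y : E} {δ : ℝ} (hF : DifferentiableAt ℝ F p)
    (h : HasDerivAt (fun ε : ℝ => F (p + ε • Y)) δ 0) : fderiv ℝ F p Y = δ := by
  have hl : HasDerivAt (fun ε : ℝ => p + ε • Y) Y 0 := by
    simpa using ((hasDerivAt_id (0 : ℝ)).smul_const Y).const_add p
  have h1 : HasFDerivAt F (fderiv ℝ F p) (p + (0 : ℝ) • Y) := by simpa using hF.hasFDerivAt
  exact (h1.comp_hasDerivAt (0 : ℝ) hl).unique h

/-- A vector field is Hamiltonian if it satisfies the defining equation with the directional
derivatives of an extension of the Hamiltonian. -/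
theorem isHamiltonianVector_of_extension {G : Geometry} {F F' : State d → ℝ} {p X : State d}
    (hp : p ∈ tangentBundle G d) (hX : X ∈ phaseTangent G p)
    (hF : ∀ x ∈ tangentBundle G d, F x = F' x) (hd : DifferentiableAt ℝ F' p)
    (h : ∀ Y ∈ phaseTangent G p,
      HasDerivAt (fun ε : ℝ => F' (p + ε • Y)) (symp G X Y) 0) :
    IsHamiltonianVector G F p X := by
  refine ⟨hX, fderiv ℝ F' p, ?_, fun Y hY => (fderiv_apply_of_line hd (h Y hY)).symm⟩
  exact hd.hasFDerivAt.hasFDerivWithinAt.congr hF (hF p hp)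

/-! ### The potentials in homogeneous coordinates -/

theorem rho_sq_nonneg {a y : EuclideanSpace ℝ (Fin d)} (ha : ‖a‖ = 1) :
    0 ≤ ‖y‖ ^ 2 - inner ℝ y a ^ 2 := by
  have := abs_real_inner_le_norm y a
  rw [ha, mul_one] at this
  have := sq_le_sq' (abs_le.1 this).1 (abs_le.1 this).2
  linarith

/-- The quotient `cs / sn` of the distance to a point of the axis, in homogeneous coordinates. -/
theorem cs_div_sn_distance {G : Geometry} {a : EuclideanSpace ℝ (Fin d)} (ha : ‖a‖ = 1) (τ : ℝ)
    {q : Ambient d} (hq : q ∈ space G d) :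
    G.cs (distance G q (G.sn τ • a, G.cs τ)) / G.sn (distance G q (G.sn τ • a, G.cs τ)) =
      (G.cs τ * q.2 + G.curv * (G.sn τ * inner ℝ q.1 a)) /
        √(‖q.1‖ ^ 2 - inner ℝ q.1 a ^ 2 + (G.cs τ * inner ℝ q.1 a - G.sn τ * q.2) ^ 2) := by
  obtain ⟨y, s⟩ := q
  have hρ := rho_sq_nonneg (y := y) ha
  have h1 := hq.1
  have h0 := G.cs_sq_add τ
  have hs1 : G = .euclidean → s = 1 := by
    rintro rfl
    exact snd_eq_one_of_mem_space hq
  have h2 := hq.2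
  simp only at h1 h2 ⊢
  obtain ⟨α, hα⟩ : ∃ α : ℝ, α = inner ℝ y a := ⟨_, rfl⟩
  rw [← hα] at hρ ⊢
  -- The homogeneous coordinates relative to the point of the axis satisfy `cs² + κ sn² = 1`. In the
  -- curved cases it therefore suffices to recognize the first of them as the `cs` of the distance;
  -- the root is then its `sn`.
  have key : (G.cs τ * s + G.curv * (G.sn τ * α)) ^ 2
      + G.curv * (‖y‖ ^ 2 - α ^ 2 + (G.cs τ * α - G.sn τ * s) ^ 2) = 1 := by
    linear_combination h1 + (s ^ 2 + G.curv * α ^ 2) * h0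
  have hnn : 0 ≤ ‖y‖ ^ 2 - α ^ 2 + (G.cs τ * α - G.sn τ * s) ^ 2 := by positivity
  cases G
  · simp only [Geometry.cs, Geometry.sn, distance, Geometry.curv] at *
    have : ‖y - τ • a‖ = √(‖y‖ ^ 2 - α ^ 2 + (1 * α - τ * s) ^ 2) := by
      rw [← Real.sqrt_sq (norm_nonneg (y - τ • a)), norm_sub_sq_real, norm_smul,
        inner_smul_right, mul_pow, ha, Real.norm_eq_abs, sq_abs, hs1 trivial, hα]
      congr 1; ring
    rw [this, hs1 trivial]; simp
  · simp only [Geometry.cs, Geometry.sn, distance, Geometry.curv] at *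
    have e : form .spherical (y, s) (Real.sin τ • a, Real.cos τ)
        = Real.cos τ * s + 1 * (Real.sin τ * α) := by
      simp only [form, inner_smul_right, Geometry.curv, hα]; ring
    rw [e, Real.sin_arccos, Real.cos_arccos]
    · congr 2; linarith
    · nlinarith
    · nlinarith
  · simp only [Geometry.cs, Geometry.sn, distance, Geometry.curv] at *
    have e : -form .hyperbolic (y, s) (Real.sinh τ • a, Real.cosh τ)
        = Real.cosh τ * s + -1 * (Real.sinh τ * α) := by
      simp only [form, inner_smul_right, Geometry.curv, hα]; ring
    have h3 := h2 (by simp)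
    have hge : 1 ≤ Real.cosh τ * s + -1 * (Real.sinh τ * α) := by
      have hpos : 0 < Real.cosh τ * s + -1 * (Real.sinh τ * α) := by
        have c1 := Real.cosh_pos τ
        have c2 : |Real.sinh τ * α| < |Real.cosh τ * s| := by
          apply sq_lt_sq.1
          have c3 : α ^ 2 < s ^ 2 := by nlinarith
          nlinarith [sq_nonneg (Real.sinh τ), sq_nonneg s]
        rw [abs_of_pos (by positivity : 0 < Real.cosh τ * s)] at c2
        linarith [le_abs_self (Real.sinh τ * α)]
      nlinarith
    rw [e, Real.sinh_arcosh hge, Real.cosh_arcosh hge]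
    congr 2; linarith

theorem hasDerivAt_norm {y : ℝ → EuclideanSpace ℝ (Fin d)} {y' : EuclideanSpace ℝ (Fin d)} {t : ℝ}
    (hy : HasDerivAt y y' t) (h : y t ≠ 0) :
    HasDerivAt (fun t => ‖y t‖) (inner ℝ (y t) y' / ‖y t‖) t := by
  have h1 := (hy.norm_sq).sqrt (by simpa using h)
  simp only [Real.sqrt_sq (norm_nonneg _)] at h1
  exact h1.congr_deriv (by ring)

theorem norm_sq_eq (y : EuclideanSpace ℝ (Fin d)) : ‖y‖ ^ 2 = inner ℝ y y :=
  (real_inner_self_eq_norm_sq y).symm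

/-- Allows identities that carry a spurious factor `κ²` to be proved for all geometries at once: the
factor is `1` in the curved cases, and the coordinates vanish in the flat one. -/
theorem curv_sq_mul_phaseTangent {G : Geometry} {p Y : State d} (hp : p ∈ tangentBundle G d)
    (hY : Y ∈ phaseTangent G p) :
    G.curv ^ 2 * Y.1.2 = Y.1.2 ∧ G.curv ^ 2 * Y.2.2 = Y.2.2 := by
  have h1 : G.curv ^ 2 * Y.1.2 = Y.1.2 := curv_sq_mul_snd hp.1 hY.1
  refine ⟨h1, ?_⟩
  cases G
  · have h2 := snd_eq_one_of_mem_space hp.1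
    have h3 := snd_eq_zero_of_mem_tangent hp.1 hp.2
    have h4 := hY.2
    simp only [Geometry.curv, h2, h3] at h4 ⊢
    linarith
  · simp [Geometry.curv]
  · simp [Geometry.curv]

/-! ### Partial angular momenta and their Hamiltonian vector fields -/

/-- The squared norm of the part of the angular momentum in the range of a projection `π`. -/
def angMomOn (π : EuclideanSpace ℝ (Fin d) →L[ℝ] EuclideanSpace ℝ (Fin d)) (p : State d) : ℝ :=
  inner ℝ (π p.1.1) (π p.1.1) * inner ℝ (π p.2.1) (π p.2.1) - inner ℝ (π p.1.1) (π p.2.1) ^ 2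

/-- The directional derivative of `angMomOn`. -/
def angMomOnDeriv (π : EuclideanSpace ℝ (Fin d) →L[ℝ] EuclideanSpace ℝ (Fin d))
    (p Y : State d) : ℝ :=
  2 * (inner ℝ (π p.1.1) (π Y.1.1) * inner ℝ (π p.2.1) (π p.2.1)
    + inner ℝ (π p.1.1) (π p.1.1) * inner ℝ (π p.2.1) (π Y.2.1)
    - inner ℝ (π p.1.1) (π p.2.1) * (inner ℝ (π Y.1.1) (π p.2.1) + inner ℝ (π p.1.1) (π Y.2.1)))

/-- The Hamiltonian vector field of `angMomOn`. -/
def hamAngMomOn (π : EuclideanSpace ℝ (Fin d) →L[ℝ] EuclideanSpace ℝ (Fin d)) (p : State d) :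
    State d :=
  (((2 * inner ℝ (π p.1.1) (π p.1.1)) • π p.2.1 - (2 * inner ℝ (π p.1.1) (π p.2.1)) • π p.1.1, 0),
   ((2 * inner ℝ (π p.1.1) (π p.2.1)) • π p.2.1 - (2 * inner ℝ (π p.2.1) (π p.2.1)) • π p.1.1, 0))

/-- `π` is an orthogonal projection. -/
structure IsProj (π : EuclideanSpace ℝ (Fin d) →L[ℝ] EuclideanSpace ℝ (Fin d)) : Prop where
  symm : ∀ x y, inner ℝ (π x) y = inner ℝ x (π y)
  idem : ∀ x, π (π x) = π x

theorem IsProj.inner_comm {π : EuclideanSpace ℝ (Fin d) →L[ℝ] EuclideanSpace ℝ (Fin d)}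
    (h : IsProj π) (x y : EuclideanSpace ℝ (Fin d)) : inner ℝ y (π x) = inner ℝ x (π y) := by
  rw [real_inner_comm, h.symm]

theorem isProj_id : IsProj (ContinuousLinearMap.id ℝ (EuclideanSpace ℝ (Fin d))) :=
  ⟨fun _ _ => rfl, fun _ => rfl⟩

section AngMom

variable {π : EuclideanSpace ℝ (Fin d) →L[ℝ] EuclideanSpace ℝ (Fin d)}

theorem contDiff_angMomOn : ContDiff ℝ ∞ (angMomOn π) := by
  unfold angMomOn
  fun_prop

theorem hasDerivAt_angMomOn {c : ℝ → State d} {Y : State d} {t : ℝ} (h : HasDerivAt c Y t) :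
    HasDerivAt (fun t => angMomOn π (c t)) (angMomOnDeriv π (c t) Y) t := by
  have hy : HasDerivAt (fun t => π (c t).1.1) (π Y.1.1) t :=
    π.hasFDerivAt.comp_hasDerivAt t h.fst.fst
  have hw : HasDerivAt (fun t => π (c t).2.1) (π Y.2.1) t :=
    π.hasFDerivAt.comp_hasDerivAt t h.snd.fst
  have := ((hy.inner ℝ hy).mul (hw.inner ℝ hw)).sub ((hy.inner ℝ hw).pow 2)
  refine this.congr_deriv ?_
  simp only [angMomOnDeriv, real_inner_comm (π (c t).1.1) (π Y.1.1),
    real_inner_comm (π (c t).2.1) (π Y.2.1)]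
  push_cast
  ring

theorem symp_hamAngMomOn (hπ : IsProj π) (G : Geometry) (p Y : State d) :
    symp G (hamAngMomOn π p) Y = angMomOnDeriv π p Y := by
  simp only [symp, form, hamAngMomOn, angMomOnDeriv, inner_sub_left, inner_smul_left,
    conj_trivial, hπ.symm, hπ.idem, hπ.inner_comm p.2.1 Y.1.1]
  ring

theorem hamAngMomOn_mem (hπ : IsProj π) (G : Geometry) (p : State d) :
    hamAngMomOn π p ∈ phaseTangent G p := by
  constructor
  · simp only [hamAngMomOn, inner_sub_right, inner_smul_right, hπ.symm, hπ.idem]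
    ring
  · simp only [hamAngMomOn, inner_sub_right, inner_smul_right, hπ.symm, hπ.idem, inner_sub_left,
      inner_smul_left, conj_trivial]
    ring

theorem hasDerivAt_line (p Y : State d) : HasDerivAt (fun ε : ℝ => p + ε • Y) Y 0 := by
  simpa using ((hasDerivAt_id (0 : ℝ)).smul_const Y).const_add p

theorem isHamiltonianVector_angMomOn (hπ : IsProj π) {G : Geometry} {p : State d}
    (hp : p ∈ tangentBundle G d) : IsHamiltonianVector G (angMomOn π) p (hamAngMomOn π p) := by
  refine isHamiltonianVector_of_extension hp (hamAngMomOn_mem hπ G p) (fun _ _ => rfl)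
    (contDiff_angMomOn.contDiffAt.differentiableAt (by simp)) fun Y _ => ?_
  rw [symp_hamAngMomOn hπ]
  simpa using hasDerivAt_angMomOn (π := π) (hasDerivAt_line p Y)

/-- The angular momenta of nested projections commute. -/
theorem symp_hamAngMomOn_hamAngMomOn
    {π' : EuclideanSpace ℝ (Fin d) →L[ℝ] EuclideanSpace ℝ (Fin d)} (hπ : IsProj π)
    (hπ' : ∀ x, π (π' x) = π x) (G : Geometry) (p : State d) :
    symp G (hamAngMomOn π p) (hamAngMomOn π' p) = 0 := by
  rw [symp_hamAngMomOn hπ]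
  simp only [angMomOnDeriv, hamAngMomOn, map_sub, map_smul, hπ', inner_sub_left, inner_sub_right,
    inner_smul_left, inner_smul_right, conj_trivial, real_inner_comm (π p.1.1) (π p.2.1)]
  ring

end AngMom

namespace TwoCenter

variable (P : TwoCenter d)

theorem angMomSq_eq (p : State d) : P.angMomSq p = angMomOn (ContinuousLinearMap.id ℝ _) p := by
  simp only [angMomSq, angMomOn, norm_sq_eq, ContinuousLinearMap.id_apply]

/-! ### The Keplerian energy -/

/-- A smooth extension of the Keplerian energy. -/
def keplerExt (p : State d) : ℝ :=
  form P.geom p.2 p.2 / 2 - P.mass₁ * (p.1.2 / ‖p.1.1‖)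

/-- The Hamiltonian vector field of the Kepler problem. -/
def hamKepler (p : State d) : State d :=
  (p.2, (-(P.geom.curv * form P.geom p.2 p.2) - P.mass₁ * p.1.2 / ‖p.1.1‖ ^ 3) • p.1.1,
    -(P.geom.curv * form P.geom p.2 p.2) * p.1.2 + P.mass₁ * P.geom.curv / ‖p.1.1‖)

theorem potential_center₁ (haxis : ‖P.axis‖ = 1) (m : ℝ) {q : Ambient d}
    (hq : q ∈ space P.geom d) : P.potential m P.center₁ q = -(m * (q.2 / ‖q.1‖)) := by
  have h := cs_div_sn_distance haxis 0 hq
  simp only [P.geom.sn_zero, P.geom.cs_zero, zero_smul] at h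
  rw [potential, center₁, h]
  congr 3
  · ring
  · rw [← Real.sqrt_sq (norm_nonneg q.1), Real.sq_sqrt (sq_nonneg _)]; congr 1; ring

theorem potential_center₂ (haxis : ‖P.axis‖ = 1) (m : ℝ) {q : Ambient d}
    (hq : q ∈ space P.geom d) : P.potential m P.center₂ q =
      -(m * ((P.geom.cs (2 * P.halfDist) * q.2
        + P.geom.curv * (P.geom.sn (2 * P.halfDist) * inner ℝ q.1 P.axis)) /
        √(‖q.1‖ ^ 2 - inner ℝ q.1 P.axis ^ 2 + (P.geom.cs (2 * P.halfDist) * inner ℝ q.1 P.axis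
          - P.geom.sn (2 * P.halfDist) * q.2) ^ 2))) := by
  rw [potential, center₂, cs_div_sn_distance haxis _ hq]

theorem keplerEnergy_eq (haxis : ‖P.axis‖ = 1) {p : State d}
    (hp : p ∈ tangentBundle P.geom d) : P.keplerEnergy p = P.keplerExt p := by
  rw [keplerEnergy, P.potential_center₁ haxis _ hp.1, keplerExt]; ring

theorem contDiffAt_keplerExt {p : State d} (hy : p.1.1 ≠ 0) : ContDiffAt ℝ ∞ P.keplerExt p := by
  have h1 : ContDiffAt ℝ ∞ (fun p : State d => ‖p.1.1‖) p :=
    ContDiffAt.norm ℝ (by fun_prop) hy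
  have h2 : ‖p.1.1‖ ≠ 0 := norm_ne_zero_iff.2 hy
  unfold keplerExt form
  fun_prop (disch := assumption)

/-- The directional derivative of `keplerExt`. -/
def keplerDeriv (p Y : State d) : ℝ :=
  form P.geom p.2 Y.2 - P.mass₁ * (Y.1.2 / ‖p.1.1‖
    - p.1.2 * inner ℝ p.1.1 Y.1.1 / ‖p.1.1‖ ^ 3)

theorem hasDerivAt_keplerExt {c : ℝ → State d} {Y : State d} {t : ℝ} (h : HasDerivAt c Y t)
    (hy : (c t).1.1 ≠ 0) :
    HasDerivAt (fun t => P.keplerExt (c t)) (P.keplerDeriv (c t) Y) t := by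
  have h2 : ‖(c t).1.1‖ ≠ 0 := norm_ne_zero_iff.2 hy
  have hw : HasDerivAt (fun t => (c t).2.1) Y.2.1 t := h.snd.fst
  have hσ : HasDerivAt (fun t => (c t).2.2) Y.2.2 t := h.snd.snd
  have hs : HasDerivAt (fun t => (c t).1.2) Y.1.2 t := h.fst.snd
  have hr := hasDerivAt_norm (h.fst.fst : HasDerivAt (fun t => (c t).1.1) Y.1.1 t) hy
  have := (((hw.inner ℝ hw).add ((hσ.mul hσ).const_mul P.geom.curv)).div_const 2).sub
    ((hs.div hr h2).const_mul P.mass₁)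
  refine this.congr_deriv ?_
  simp only [keplerDeriv, form, real_inner_comm (c t).2.1 Y.2.1]
  field_simp
  ring

theorem symp_hamKepler {p Y : State d} (hp : p ∈ tangentBundle P.geom d) (hy : p.1.1 ≠ 0)
    (hY : Y ∈ phaseTangent P.geom p) : symp P.geom (P.hamKepler p) Y = P.keplerDeriv p Y := by
  have h2 : ‖p.1.1‖ ≠ 0 := norm_ne_zero_iff.2 hy
  have h3 := (curv_sq_mul_phaseTangent hp hY).1
  have h4 := hY.1
  simp only [symp, hamKepler, keplerDeriv, form, inner_smul_left, conj_trivial]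
  have e : P.mass₁ * P.geom.curv / ‖p.1.1‖ * P.geom.curv * Y.1.2 = P.mass₁ / ‖p.1.1‖ * Y.1.2 := by
    linear_combination P.mass₁ / ‖p.1.1‖ * h3
  linear_combination -e
    + (inner ℝ p.2.1 p.2.1 + P.geom.curv * (p.2.2 * p.2.2)) * P.geom.curv ^ 2 * h4
    - (inner ℝ p.2.1 p.2.1 + P.geom.curv * (p.2.2 * p.2.2)) * inner ℝ p.1.1 Y.1.1
      * P.geom.curv_pow_three

theorem hamKepler_mem {p : State d} (hp : p ∈ tangentBundle P.geom d) (hy : p.1.1 ≠ 0) :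
    P.hamKepler p ∈ phaseTangent P.geom p := by
  have h2 : ‖p.1.1‖ ≠ 0 := norm_ne_zero_iff.2 hy
  refine ⟨hp.2, ?_⟩
  have h1 := space_sq hp.1
  have h3 := curv_sq_mul_snd hp.1 hp.2
  simp only [hamKepler, form, inner_smul_right, ← norm_sq_eq]
  have e : P.mass₁ * p.1.2 / ‖p.1.1‖ ^ 3 * ‖p.1.1‖ ^ 2 = P.mass₁ * p.1.2 / ‖p.1.1‖ := by
    field_simp
  linear_combination - P.geom.curv * e
    - (P.geom.curv * (‖p.2.1‖ ^ 2 + P.geom.curv * (p.2.2 * p.2.2))) * h1 - p.2.2 * h3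

theorem isHamiltonianVector_kepler (haxis : ‖P.axis‖ = 1) {p : State d}
    (hp : p ∈ tangentBundle P.geom d) (hy : p.1.1 ≠ 0) :
    IsHamiltonianVector P.geom P.keplerEnergy p (P.hamKepler p) := by
  refine isHamiltonianVector_of_extension hp (P.hamKepler_mem hp hy)
    (fun _ hx => P.keplerEnergy_eq haxis hx)
    ((P.contDiffAt_keplerExt hy).differentiableAt (by simp)) fun Y hY => ?_
  rw [P.symp_hamKepler hp hy hY]
  simpa using P.hasDerivAt_keplerExt (hasDerivAt_line p Y) (by simpa using hy)

/-! ### The Laplace-Runge-Lenz vector and the function `D` -/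

/-- The component of the Laplace-Runge-Lenz vector along a vector `a`. -/
def lrlOn (a : EuclideanSpace ℝ (Fin d)) (p : State d) : ℝ :=
  (p.1.2 * inner ℝ p.2.1 p.2.1 - p.2.2 * inner ℝ p.1.1 p.2.1) * inner ℝ p.1.1 a
    - (p.1.2 * inner ℝ p.1.1 p.2.1 - p.2.2 * inner ℝ p.1.1 p.1.1) * inner ℝ p.2.1 a
    - P.mass₁ * (inner ℝ p.1.1 a / ‖p.1.1‖)

/-- The directional derivative of `lrlOn`. -/
def lrlDeriv (a : EuclideanSpace ℝ (Fin d)) (p Y : State d) : ℝ :=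
  (Y.1.2 * inner ℝ p.2.1 p.2.1 + p.1.2 * (2 * inner ℝ p.2.1 Y.2.1)
      - Y.2.2 * inner ℝ p.1.1 p.2.1 - p.2.2 * (inner ℝ Y.1.1 p.2.1 + inner ℝ p.1.1 Y.2.1))
        * inner ℝ p.1.1 a
    + (p.1.2 * inner ℝ p.2.1 p.2.1 - p.2.2 * inner ℝ p.1.1 p.2.1) * inner ℝ Y.1.1 a
    - (Y.1.2 * inner ℝ p.1.1 p.2.1 + p.1.2 * (inner ℝ Y.1.1 p.2.1 + inner ℝ p.1.1 Y.2.1)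
      - Y.2.2 * inner ℝ p.1.1 p.1.1 - p.2.2 * (2 * inner ℝ p.1.1 Y.1.1)) * inner ℝ p.2.1 a
    - (p.1.2 * inner ℝ p.1.1 p.2.1 - p.2.2 * inner ℝ p.1.1 p.1.1) * inner ℝ Y.2.1 a
    - P.mass₁ * (inner ℝ Y.1.1 a / ‖p.1.1‖
      - inner ℝ p.1.1 a * inner ℝ p.1.1 Y.1.1 / ‖p.1.1‖ ^ 3)

/-- The Hamiltonian vector field of `lrlOn`. -/
def hamLrl (a : EuclideanSpace ℝ (Fin d)) (p : State d) : State d :=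
  let y := p.1.1
  let s := p.1.2
  let w := p.2.1
  let σ := p.2.2
  let M : EuclideanSpace ℝ (Fin d) := inner ℝ y a • w - inner ℝ w a • y
  let x : EuclideanSpace ℝ (Fin d) := s • w - σ • y
  ((s • M + inner ℝ y a • x - inner ℝ x y • a, -(P.geom.curv * inner ℝ y M)),
   (σ • M + inner ℝ w a • x - inner ℝ x w • a
      + P.mass₁ • ((‖y‖)⁻¹ • a - (inner ℝ y a / ‖y‖ ^ 3) • y), -(P.geom.curv * inner ℝ w M)))

theorem inner_lrl (a : EuclideanSpace ℝ (Fin d)) (p : State d) :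
    inner ℝ (P.lrl p) a = P.lrlOn a p := by
  simp only [lrl, lrlOn, inner_sub_left, inner_sub_right, inner_smul_left, inner_smul_right,
    conj_trivial, real_inner_comm p.1.1 p.2.1]
  ring

theorem contDiffAt_lrlOn (a : EuclideanSpace ℝ (Fin d)) {p : State d} (hy : p.1.1 ≠ 0) :
    ContDiffAt ℝ ∞ (P.lrlOn a) p := by
  have h1 : ContDiffAt ℝ ∞ (fun p : State d => ‖p.1.1‖) p :=
    ContDiffAt.norm ℝ (by fun_prop) hy
  have h2 : ‖p.1.1‖ ≠ 0 := norm_ne_zero_iff.2 hy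
  unfold lrlOn
  fun_prop (disch := assumption)

theorem hasDerivAt_lrlOn (a : EuclideanSpace ℝ (Fin d)) {c : ℝ → State d} {Y : State d} {t : ℝ}
    (h : HasDerivAt c Y t) (hy : (c t).1.1 ≠ 0) :
    HasDerivAt (fun t => P.lrlOn a (c t)) (P.lrlDeriv a (c t) Y) t := by
  have h2 : ‖(c t).1.1‖ ≠ 0 := norm_ne_zero_iff.2 hy
  have hy' : HasDerivAt (fun t => (c t).1.1) Y.1.1 t := h.fst.fst
  have hw : HasDerivAt (fun t => (c t).2.1) Y.2.1 t := h.snd.fst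
  have hσ : HasDerivAt (fun t => (c t).2.2) Y.2.2 t := h.snd.snd
  have hs : HasDerivAt (fun t => (c t).1.2) Y.1.2 t := h.fst.snd
  have hr := hasDerivAt_norm hy' hy
  have hya := hy'.inner ℝ (hasDerivAt_const t a)
  have hwa := hw.inner ℝ (hasDerivAt_const t a)
  have hyw := hy'.inner ℝ hw
  have := ((((hs.mul (hw.inner ℝ hw)).sub (hσ.mul hyw)).mul hya).sub
    (((hs.mul hyw).sub (hσ.mul (hy'.inner ℝ hy'))).mul hwa)).sub
    ((hya.div hr h2).const_mul P.mass₁)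
  refine this.congr_deriv ?_
  simp only [lrlDeriv, real_inner_comm (c t).2.1 Y.2.1, real_inner_comm (c t).1.1 Y.1.1,
    inner_zero_right, Pi.mul_apply, Pi.sub_apply]
  field_simp
  ring

theorem symp_hamLrl (a : EuclideanSpace ℝ (Fin d)) {p Y : State d}
    (hp : p ∈ tangentBundle P.geom d)
    (hY : Y ∈ phaseTangent P.geom p) :
    symp P.geom (P.hamLrl a p) Y = P.lrlDeriv a p Y := by
  obtain ⟨h3, h4⟩ := curv_sq_mul_phaseTangent hp hY
  have h5 := curv_sq_mul_snd hp.1 hp.2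
  simp only [symp, hamLrl, lrlDeriv, form, inner_smul_left, inner_smul_right, inner_sub_left,
    inner_sub_right, inner_add_left, conj_trivial, real_inner_comm p.1.1 p.2.1,
    real_inner_comm Y.1.1 a, real_inner_comm Y.2.1 a, real_inner_comm p.2.1 Y.1.1]
  linear_combination -(inner ℝ p.1.1 a * inner ℝ p.1.1 p.2.1
      - inner ℝ p.2.1 a * inner ℝ p.1.1 p.1.1) * h4
    + (inner ℝ p.1.1 a * inner ℝ p.2.1 p.2.1 - inner ℝ p.2.1 a * inner ℝ p.1.1 p.2.1) * h3

theorem hamLrl_mem (a : EuclideanSpace ℝ (Fin d)) {p : State d} (hy : p.1.1 ≠ 0) :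
    P.hamLrl a p ∈ phaseTangent P.geom p := by
  have h2 : ‖p.1.1‖ ≠ 0 := norm_ne_zero_iff.2 hy
  constructor
  · simp only [hamLrl, inner_smul_left, inner_smul_right, inner_sub_left,
      inner_sub_right, inner_add_right, conj_trivial,
      real_inner_comm p.1.1 p.2.1]
    ring
  · have e : (‖p.1.1‖)⁻¹ * inner ℝ p.1.1 a
        - inner ℝ p.1.1 a / ‖p.1.1‖ ^ 3 * inner ℝ p.1.1 p.1.1 = 0 := by
      rw [← norm_sq_eq]; field_simp; ring
    simp only [hamLrl, inner_smul_left, inner_smul_right, inner_sub_left,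
      inner_sub_right, inner_add_left, inner_add_right, conj_trivial,
      real_inner_comm p.1.1 p.2.1, real_inner_comm p.2.1 a]
    linear_combination P.geom.curv * P.mass₁ * e

/-- The Hamiltonian vector field of `D`. -/
def hamD (p : State d) : State d :=
  P.geom.cs (2 * P.halfDist) • hamAngMomOn (ContinuousLinearMap.id ℝ _) p
    - P.geom.sn (2 * P.halfDist) • P.hamLrl P.axis p

theorem D_eq (p : State d) : P.D p = P.geom.cs (2 * P.halfDist)
    * angMomOn (ContinuousLinearMap.id ℝ _) p
      - P.geom.sn (2 * P.halfDist) * P.lrlOn P.axis p := by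
  rw [D, P.angMomSq_eq, P.inner_lrl]

theorem contDiffAt_D {p : State d} (hy : p.1.1 ≠ 0) : ContDiffAt ℝ ∞ P.D p := by
  have h : P.D = fun p => P.geom.cs (2 * P.halfDist)
    * angMomOn (ContinuousLinearMap.id ℝ _) p
      - P.geom.sn (2 * P.halfDist) * P.lrlOn P.axis p := funext P.D_eq
  rw [h]
  exact (contDiffAt_const.mul contDiff_angMomOn.contDiffAt).sub
    (contDiffAt_const.mul (P.contDiffAt_lrlOn _ hy))

/-- The directional derivative of `D`. -/
def derivD (p Y : State d) : ℝ :=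
  P.geom.cs (2 * P.halfDist) * angMomOnDeriv (ContinuousLinearMap.id ℝ _) p Y
    - P.geom.sn (2 * P.halfDist) * P.lrlDeriv P.axis p Y

theorem hasDerivAt_D {c : ℝ → State d} {Y : State d} {t : ℝ} (h : HasDerivAt c Y t)
    (hy : (c t).1.1 ≠ 0) : HasDerivAt (fun t => P.D (c t)) (P.derivD (c t) Y) t := by
  simp only [P.D_eq]
  exact ((hasDerivAt_angMomOn h).const_mul _).sub ((P.hasDerivAt_lrlOn _ h hy).const_mul _)

theorem symp_hamD {p Y : State d} (hp : p ∈ tangentBundle P.geom d)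
    (hY : Y ∈ phaseTangent P.geom p) : symp P.geom (P.hamD p) Y = P.derivD p Y := by
  rw [derivD, ← symp_hamAngMomOn isProj_id, ← P.symp_hamLrl _ hp hY]
  simp only [symp, hamD, Prod.fst_sub, Prod.snd_sub, Prod.smul_fst, Prod.smul_snd,
    form_sub_left, form_smul_left]
  ring

theorem hamD_mem {p : State d} (hy : p.1.1 ≠ 0) :
    P.hamD p ∈ phaseTangent P.geom p := by
  obtain ⟨h1, h2⟩ := hamAngMomOn_mem isProj_id P.geom p
  obtain ⟨h3, h4⟩ := P.hamLrl_mem P.axis hy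
  unfold hamD
  generalize hamAngMomOn _ p = X at *
  generalize P.hamLrl _ p = X' at *
  constructor <;>
    simp only [Prod.fst_sub, Prod.snd_sub, Prod.smul_fst, Prod.smul_snd, inner_sub_left,
      inner_sub_right, inner_smul_left, inner_smul_right, conj_trivial, smul_eq_mul]
  · linear_combination P.geom.cs (2 * P.halfDist) * h1 - P.geom.sn (2 * P.halfDist) * h3
  · linear_combination P.geom.cs (2 * P.halfDist) * h2 - P.geom.sn (2 * P.halfDist) * h4

theorem isHamiltonianVector_D {p : State d} (hp : p ∈ tangentBundle P.geom d) (hy : p.1.1 ≠ 0) :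
    IsHamiltonianVector P.geom P.D p (P.hamD p) := by
  refine isHamiltonianVector_of_extension hp (P.hamD_mem hy) (fun _ _ => rfl)
    ((P.contDiffAt_D hy).differentiableAt (by simp)) fun Y hY => ?_
  rw [P.symp_hamD hp hY]
  simpa using P.hasDerivAt_D (hasDerivAt_line p Y) (by simpa using hy)

/-! ### The commutation relations -/

/-- The vector field is an infinitesimal rotation with coefficients depending on the state, and the
Keplerian energy is rotation invariant. -/
theorem keplerDeriv_hamAngMomOn {π : EuclideanSpace ℝ (Fin d) →L[ℝ] EuclideanSpace ℝ (Fin d)}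
    (hπ : IsProj π) (p : State d) : P.keplerDeriv p (hamAngMomOn π p) = 0 := by
  simp only [keplerDeriv, hamAngMomOn, form, inner_sub_right, inner_smul_right,
    hπ.inner_comm p.1.1 p.2.1, ← hπ.symm]
  simp only [hπ.symm, hπ.idem]
  ring

/-- The force is central: the first component of the acceleration is a multiple of `y`, which does
not affect the Gram determinant of `π y` and `π w` to first order. -/
theorem angMomOnDeriv_hamKepler (π : EuclideanSpace ℝ (Fin d) →L[ℝ] EuclideanSpace ℝ (Fin d))
    (p : State d) : angMomOnDeriv π p (P.hamKepler p) = 0 := by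
  simp only [angMomOnDeriv, hamKepler, map_smul, inner_smul_right,
    real_inner_comm (π p.1.1) (π p.2.1)]
  ring

/-- The Laplace-Runge-Lenz vector is conserved by the Kepler flow. -/
theorem lrlDeriv_hamKepler (a : EuclideanSpace ℝ (Fin d)) {p : State d}
    (hp : p ∈ tangentBundle P.geom d) (hy : p.1.1 ≠ 0) :
    P.lrlDeriv a p (P.hamKepler p) = 0 := by
  have h1 := space_sq hp.1
  have h2 : ‖p.1.1‖ ≠ 0 := norm_ne_zero_iff.2 hy
  simp only [lrlDeriv, hamKepler, inner_smul_left, inner_smul_right, conj_trivial,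
    real_inner_comm p.1.1 p.2.1, ← norm_sq_eq]
  generalize form P.geom p.2 p.2 = K
  field_simp
  linear_combination (-P.mass₁ * (inner ℝ p.1.1 a * inner ℝ p.1.1 p.2.1
    - inner ℝ p.2.1 a * ‖p.1.1‖ ^ 2)) * h1

/-- The rotations generated on the range of `π` fix `a`, hence also the component of an equivariant
vector along `a`. -/
theorem lrlDeriv_hamAngMomOn {π : EuclideanSpace ℝ (Fin d) →L[ℝ] EuclideanSpace ℝ (Fin d)}
    (hπ : IsProj π) {a : EuclideanSpace ℝ (Fin d)} (ha : π a = 0) (p : State d) :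
    P.lrlDeriv a p (hamAngMomOn π p) = 0 := by
  have e : ∀ x, inner ℝ (π x) a = 0 := fun x => by rw [hπ.symm, ha, inner_zero_right]
  simp only [lrlDeriv, hamAngMomOn, inner_sub_left, inner_sub_right, inner_smul_left,
    inner_smul_right, conj_trivial, e]
  simp only [hπ.symm, hπ.idem, hπ.inner_comm p.1.1 p.2.1]
  ring

end TwoCenter

/-! ### Elastic reflections -/

/-- A differential along the configuration space is determined by any extension. -/
theorem hasFDerivWithinAt_space_apply {G : Geometry} {f : Ambient d → ℝ} {L : Ambient d →L[ℝ] ℝ}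
    {q a : Ambient d} {δ : ℝ} (hq : q ∈ space G d) (ha : a ∈ tangent G q)
    (hL : HasFDerivWithinAt f L (space G d) q) (hd : DifferentiableAt ℝ f q)
    (h : HasDerivAt (fun ε : ℝ => f (q + ε • a)) δ 0) : L a = δ := by
  rw [← fderiv_apply_of_line hd h]
  have hp : ((q, 0) : State d) ∈ tangentBundle G d := ⟨hq, by simp [tangent]⟩
  have hY : ((a, 0) : State d) ∈ phaseTangent G (q, 0) :=
    ⟨ha, by simp⟩
  obtain ⟨c, hc0, hc, hcm⟩ := exists_curve hp hY
  have hc1 : HasDerivAt (fun ε => (c ε).1) a 0 := hc.fst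
  have key : ∀ K : Ambient d →L[ℝ] ℝ, HasFDerivWithinAt f K (space G d) q →
      HasDerivAt (fun ε => f (c ε).1) (K a) 0 := by
    intro K hK
    have h1 : HasDerivWithinAt (f ∘ fun ε => (c ε).1) (K a)
        {ε | c ε ∈ tangentBundle G d} 0 := by
      refine HasFDerivWithinAt.comp_hasDerivWithinAt (t := space G d) 0 ?_
        hc1.hasDerivWithinAt (fun ε hε => hε.1)
      rwa [hc0]
    exact h1.hasDerivAt hcm
  exact (key L hL).unique (key _ hd.hasFDerivAt.hasFDerivWithinAt)

/-- Reflections preserve the norm of the velocity. -/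
theorem form_reflect (G : Geometry) (v n : Ambient d) :
    form G (v - (2 * form G v n / form G n n) • n) (v - (2 * form G v n / form G n n) • n)
      = form G v v := by
  have e : ∀ γ : ℝ, form G (v - γ • n) (v - γ • n)
      = form G v v - 2 * γ * form G v n + γ ^ 2 * form G n n := by
    intro γ
    rw [form_sub_left, form_smul_left, form_comm G v, form_comm G n (v - γ • n), form_sub_left,
      form_sub_left, form_smul_left, form_smul_left, form_comm G n v]
    ring
  rw [e]
  by_cases h : form G n n = 0
  · simp [h]
  · field_simp; ring

theorem phaseTangent_zero_right {G : Geometry} {p : State d} {n : Ambient d}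
    (hn : n ∈ tangent G p.1) : ((0, n) : State d) ∈ phaseTangent G p := by
  refine ⟨by simp, ?_⟩
  simpa [tangent] using hn

namespace TwoCenter

variable (P : TwoCenter d)

/-- `D` is a polynomial of degree two in the velocity, so its second-order Taylor expansion is
exact. The derivative at velocity `n` in direction `n` is twice the quadratic part, since the mass
term does not depend on the velocity. -/
theorem D_sub_smul (q v n : Ambient d) (γ : ℝ) :
    P.D (q, v - γ • n) = P.D (q, v) - γ * P.derivD (q, v) (0, n)
      + γ ^ 2 / 2 * P.derivD (q, n) (0, n) := by
  rw [P.D_eq, P.D_eq]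
  simp only [derivD, angMomOn, angMomOnDeriv, lrlOn, lrlDeriv, ContinuousLinearMap.id_apply,
    Prod.fst_sub, Prod.snd_sub, Prod.smul_fst, Prod.smul_snd, inner_sub_left, inner_sub_right,
    inner_smul_left, inner_smul_right, conj_trivial, smul_eq_mul, Prod.fst_zero, Prod.snd_zero,
    inner_zero_left, inner_zero_right, real_inner_comm v.1 n.1]
  ring

/-- `D` is preserved by the reflection in a wall if the Hamiltonian vector field of `D`, a
linear function of the velocity, has the conormal of the wall as an eigenvector. -/
theorem D_reflect {q v n : Ambient d} {L : Ambient d →L[ℝ] ℝ} {lam : ℝ}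
    (hq : q ∈ space P.geom d) (hv : v ∈ tangent P.geom q) (hn : n ∈ tangent P.geom q)
    (hn0 : n ≠ 0) (hy : q.1 ≠ 0) (hL : ∀ a ∈ tangent P.geom q, form P.geom n a = L a)
    (h : ∀ a ∈ tangent P.geom q, L (P.hamD (q, a)).1 = 2 * lam * L a) :
    P.D (q, v - (2 * form P.geom v n / form P.geom n n) • n) = P.D (q, v) := by
  have key : ∀ a ∈ tangent P.geom q, P.derivD (q, a) (0, n) = 2 * lam * form P.geom n a := by
    intro a ha
    have hp : ((q, a) : State d) ∈ tangentBundle P.geom d := ⟨hq, ha⟩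
    rw [← P.symp_hamD hp (phaseTangent_zero_right hn), hL a ha, ← h a ha]
    rw [← hL _ (P.hamD_mem (p := (q, a)) hy).1, form_comm]
    simp [symp, form]
  have hnn : form P.geom n n ≠ 0 := fun h0 => hn0 (eq_zero_of_form_self hq hn h0)
  rw [D_sub_smul, key v hv, key n hn, form_comm P.geom n v]
  field_simp
  ring

/-- Reflections preserve the components of the angular momentum that generate symmetries of
the wall. -/
theorem angMomOn_reflect {π : EuclideanSpace ℝ (Fin d) →L[ℝ] EuclideanSpace ℝ (Fin d)}
    (hπ : IsProj π) {q v n : Ambient d} {L : Ambient d →L[ℝ] ℝ} {G : Geometry}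
    (hL : ∀ a ∈ tangent G q, form G n a = L a)
    (h : ∀ ζ, π ζ = ζ → inner ℝ q.1 ζ = 0 → L (ζ, 0) = 0) (γ : ℝ) :
    angMomOn π (q, v - γ • n) = angMomOn π (q, v) := by
  by_cases hy : π q.1 = 0
  · simp [angMomOn, hy]
  have hyy : inner ℝ (π q.1) (π q.1) ≠ 0 := inner_self_ne_zero.2 hy
  -- The normal is orthogonal to all vectors in the range of `π` that are orthogonal to `q`. Hence
  -- `π n` is a multiple of `π q`, and the reflection changes `π v` by a multiple of `π q`, which
  -- leaves the Gram determinant alone.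
  obtain ⟨t, ht⟩ : ∃ t : ℝ, t * inner ℝ (π q.1) (π q.1) = inner ℝ (π q.1) (π n.1) :=
    ⟨_, div_mul_cancel₀ _ hyy⟩
  have hz : π n.1 - t • π q.1 = 0 := by
    set ζ := π n.1 - t • π q.1 with hζ
    have h1 : π ζ = ζ := by simp only [hζ, map_sub, map_smul, hπ.idem]
    have h2 : inner ℝ q.1 ζ = 0 := by
      rw [← h1, ← hπ.symm, hζ, inner_sub_right, inner_smul_right]
      linarith
    have h3 := h ζ h1 h2
    rw [← hL _ (by simp [tangent, h2])] at h3
    have h4 : inner ℝ (π n.1) ζ = 0 := by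
      rw [hπ.symm, h1]; simpa [form] using h3
    have h5 : inner ℝ (π q.1) ζ = 0 := by rw [hπ.symm, h1, h2]
    have h6 : inner ℝ ζ ζ = 0 := by
      conv_lhs => rw [hζ]
      rw [inner_sub_left, inner_smul_left, ← hζ, h4, h5]; simp
    exact inner_self_eq_zero.1 h6
  have e : π n.1 = t • π q.1 := sub_eq_zero.1 hz
  simp only [angMomOn, Prod.fst_sub, Prod.smul_fst, map_sub, map_smul, e, inner_sub_left,
    inner_sub_right, inner_smul_left, inner_smul_right, conj_trivial,
    real_inner_comm (π q.1) (π v.1)]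
  ring

/-! ### The confocal family -/

/-- This and the next two identities express the position part of the vector field of `D`, a linear
map of the velocity, in the homogeneous coordinates at the midpoint, in which the confocal family
has a diagonal form. The duplication formulas convert `2 h` into `h`. -/
theorem axisCoord_hamD (haxis : ‖P.axis‖ = 1) (p : State d) :
    P.axisCoord (P.hamD p).1 = 2 * P.geom.cs P.halfDist ^ 2 *
      (P.rhoSq p.1 * P.axisCoord p.2 -
        (inner ℝ p.1.1 p.2.1 - inner ℝ p.1.1 P.axis * inner ℝ p.2.1 P.axis)
          * P.axisCoord p.1) := by
  have h1 : inner ℝ P.axis P.axis = (1 : ℝ) := by rw [← norm_sq_eq, haxis]; norm_num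
  have h0 := P.geom.cs_sq_add P.halfDist
  simp only [axisCoord, hamD, rhoSq, hamAngMomOn, hamLrl, P.geom.cs_two_mul, P.geom.sn_two_mul,
    ContinuousLinearMap.id_apply, Prod.fst_sub, Prod.snd_sub, Prod.smul_fst, Prod.smul_snd,
    inner_sub_left, inner_sub_right, inner_add_left, inner_smul_left, inner_smul_right, conj_trivial, smul_eq_mul,
    h1, norm_sq_eq, real_inner_comm p.1.1 p.2.1]
  ring

theorem midCoord_hamD (haxis : ‖P.axis‖ = 1) (p : State d) :
    P.midCoord (P.hamD p).1 = 2 * (P.geom.curv * P.geom.sn P.halfDist ^ 2) *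
      ((inner ℝ p.1.1 p.2.1 - inner ℝ p.1.1 P.axis * inner ℝ p.2.1 P.axis) * P.midCoord p.1
        - P.rhoSq p.1 * P.midCoord p.2) := by
  have h1 : inner ℝ P.axis P.axis = (1 : ℝ) := by rw [← norm_sq_eq, haxis]; norm_num
  have h0 := P.geom.cs_sq_add P.halfDist
  simp only [midCoord, hamD, rhoSq, hamAngMomOn, hamLrl, P.geom.cs_two_mul, P.geom.sn_two_mul,
    ContinuousLinearMap.id_apply, Prod.fst_sub, Prod.snd_sub, Prod.smul_fst, Prod.smul_snd,
    inner_sub_left, inner_sub_right, inner_add_left, inner_smul_left, inner_smul_right, conj_trivial, smul_eq_mul,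
    h1, norm_sq_eq, real_inner_comm p.1.1 p.2.1]
  ring

theorem rho_hamD (haxis : ‖P.axis‖ = 1) (p : State d) :
    inner ℝ p.1.1 (P.hamD p).1.1 - inner ℝ p.1.1 P.axis * inner ℝ (P.hamD p).1.1 P.axis =
      2 * ((inner ℝ p.1.1 p.2.1 - inner ℝ p.1.1 P.axis * inner ℝ p.2.1 P.axis) *
        (P.geom.cs P.halfDist ^ 2 * P.axisCoord p.1 ^ 2
          - P.geom.sn P.halfDist ^ 2 * P.midCoord p.1 ^ 2)
      + P.rhoSq p.1 * (P.geom.sn P.halfDist ^ 2 * P.midCoord p.1 * P.midCoord p.2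
          - P.geom.cs P.halfDist ^ 2 * P.axisCoord p.1 * P.axisCoord p.2)) := by
  have h1 : inner ℝ P.axis P.axis = (1 : ℝ) := by rw [← norm_sq_eq, haxis]; norm_num
  have h0 := P.geom.cs_sq_add P.halfDist
  simp only [midCoord, axisCoord, hamD, rhoSq, hamAngMomOn, hamLrl, P.geom.cs_two_mul,
    P.geom.sn_two_mul, ContinuousLinearMap.id_apply, Prod.fst_sub, Prod.smul_fst,
    inner_sub_left, inner_sub_right, inner_add_left, inner_add_right, inner_smul_left,
    inner_smul_right, conj_trivial, h1, norm_sq_eq, real_inner_comm p.1.1 p.2.1]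
  generalize inner ℝ p.1.1 P.axis = α, inner ℝ p.2.1 P.axis = η, inner ℝ p.1.1 p.1.1 = r,
    inner ℝ p.1.1 p.2.1 = ρ, p.1.2 = s, p.2.2 = σ, P.geom.curv = κ, P.geom.cs P.halfDist = c,
    P.geom.sn P.halfDist = b at *
  linear_combination (-2*b*c*r*s*η - 2*b*c*r*α*σ + 4*b*c*s*α*ρ - 2*b*c*s*α^2*η
    + 2*b*c*α^3*σ - 2*b^2*r*α*κ*η + 2*b^2*α^2*κ*ρ + 2*c^2*r*α*η - 2*c^2*α^2*ρ) * h0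

/-- The left side of the equation is a homogeneous quadratic form on the ambient space, so the
expansion along a line terminates. -/
theorem hasDerivAt_quadricEq (l : ℝ) (q a : Ambient d) :
    HasDerivAt (fun ε : ℝ => P.quadricEq l (q + ε • a))
      (2 * (l * (inner ℝ q.1 a.1 - inner ℝ q.1 P.axis * inner ℝ a.1 P.axis)
        + P.geom.cs P.halfDist ^ 2 * (l - P.geom.sn P.halfDist ^ 2)
          * (P.axisCoord q * P.axisCoord a)
        - l * (l - P.geom.sn P.halfDist ^ 2) * (P.midCoord q * P.midCoord a))) 0 := by
  have e : ∀ ε : ℝ, P.quadricEq l (q + ε • a) = P.quadricEq l q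
      + ε * (2 * (l * (inner ℝ q.1 a.1 - inner ℝ q.1 P.axis * inner ℝ a.1 P.axis)
        + P.geom.cs P.halfDist ^ 2 * (l - P.geom.sn P.halfDist ^ 2)
          * (P.axisCoord q * P.axisCoord a)
        - l * (l - P.geom.sn P.halfDist ^ 2) * (P.midCoord q * P.midCoord a)))
      + ε ^ 2 * P.quadricEq l a := by
    intro ε
    simp only [quadricEq, axisCoord, midCoord, rhoSq, Prod.fst_add, Prod.snd_add, Prod.smul_fst,
      Prod.smul_snd, norm_sq_eq, inner_add_left, inner_add_right, inner_smul_left,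
      inner_smul_right, conj_trivial, smul_eq_mul, real_inner_comm q.1 a.1]
    ring
  simp only [e]
  have := (((hasDerivAt_id (0 : ℝ)).mul_const (2 * (l * (inner ℝ q.1 a.1
        - inner ℝ q.1 P.axis * inner ℝ a.1 P.axis)
        + P.geom.cs P.halfDist ^ 2 * (l - P.geom.sn P.halfDist ^ 2)
          * (P.axisCoord q * P.axisCoord a)
        - l * (l - P.geom.sn P.halfDist ^ 2) * (P.midCoord q * P.midCoord a)))).const_add
    (P.quadricEq l q)).add ((hasDerivAt_pow 2 (0 : ℝ)).mul_const (P.quadricEq l a))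
  refine this.congr_deriv ?_
  simp

theorem hasDerivAt_of_linear {f : Ambient d → ℝ} (hadd : ∀ a b, f (a + b) = f a + f b)
    (hsmul : ∀ (r : ℝ) a, f (r • a) = r * f a) (q a : Ambient d) :
    HasDerivAt (fun ε : ℝ => f (q + ε • a)) (f a) 0 := by
  simp only [hadd, hsmul]
  simpa using ((hasDerivAt_id (0 : ℝ)).mul_const (f a)).const_add (f q)

theorem axisCoord_add (a b : Ambient d) :
    P.axisCoord (a + b) = P.axisCoord a + P.axisCoord b := by
  simp only [axisCoord, Prod.fst_add, Prod.snd_add, inner_add_left]; ring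

theorem axisCoord_smul (r : ℝ) (a : Ambient d) : P.axisCoord (r • a) = r * P.axisCoord a := by
  simp only [axisCoord, Prod.smul_fst, Prod.smul_snd, inner_smul_left, smul_eq_mul,
    conj_trivial]
  ring

theorem midCoord_add (a b : Ambient d) :
    P.midCoord (a + b) = P.midCoord a + P.midCoord b := by
  simp only [midCoord, Prod.fst_add, Prod.snd_add, inner_add_left]; ring

theorem midCoord_smul (r : ℝ) (a : Ambient d) : P.midCoord (r • a) = r * P.midCoord a := by
  simp only [midCoord, Prod.smul_fst, Prod.smul_snd, inner_smul_left, smul_eq_mul,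
    conj_trivial]
  ring

/-- The conormals of the members of the confocal family are eigenvectors of the Hamiltonian
vector field of `D`, and they annihilate the rotations about the axis. -/
theorem IsConfocal.eigen (haxis : ‖P.axis‖ = 1) {f : Ambient d → ℝ} (hf : P.IsConfocal f)
    {q : Ambient d} (hq : q ∈ space P.geom d) (hfq : f q = 0) {L : Ambient d →L[ℝ] ℝ}
    (hL : HasFDerivWithinAt f L (space P.geom d) q) (hy : q.1 ≠ 0) :
    (∃ lam : ℝ, ∀ a ∈ tangent P.geom q, L (P.hamD (q, a)).1 = 2 * lam * L a) ∧
    (3 ≤ d → ∀ ζ, inner ℝ q.1 ζ = 0 → inner ℝ ζ P.axis = 0 → L (ζ, 0) = 0) := by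
  have hDm : ∀ a, (P.hamD (q, a)).1 ∈ tangent P.geom q :=
    fun a => (P.hamD_mem (p := (q, a)) hy).1
  have hζ : ∀ ζ, inner ℝ q.1 ζ = 0 → ((ζ, 0) : Ambient d) ∈ tangent P.geom q := by
    intro ζ h; simp [tangent, h]
  rcases hf with ⟨l, -, -, rfl⟩ | rfl | rfl | ⟨hd, e, -, hea, rfl⟩
  · have hdiff : DifferentiableAt ℝ (P.quadricEq l) q := by
      have h1 : ContDiff ℝ 1 (P.quadricEq l) := by
        unfold quadricEq rhoSq axisCoord midCoord
        simp only [norm_sq_eq]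
        fun_prop
      exact h1.differentiable one_ne_zero q
    have hLa := fun a ha =>
      hasFDerivWithinAt_space_apply hq ha hL hdiff (P.hasDerivAt_quadricEq l q a)
    -- In the flat case this eigenvalue is `l' - h²`, where `l'` is the other root of the equation
    -- of the family at `q`, that is, the parameter of the other confocal quadric through that
    -- point.
    refine ⟨⟨P.geom.cs P.halfDist ^ 2 * (P.rhoSq q + P.axisCoord q ^ 2) - l * P.midCoord q ^ 2,
      fun a ha => ?_⟩, fun _ ζ h1 h2 => ?_⟩
    · rw [hLa a ha, hLa _ (hDm a)]
      have e1 := P.axisCoord_hamD haxis (q, a)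
      have e2 := P.midCoord_hamD haxis (q, a)
      have e3 := P.rho_hamD haxis (q, a)
      have h0 := P.geom.cs_sq_add P.halfDist
      simp only at e1 e2 e3
      rw [e1, e2, e3]
      simp only [quadricEq] at hfq
      generalize inner ℝ q.1 a.1 - inner ℝ q.1 P.axis * inner ℝ a.1 P.axis = XW at *
      generalize P.axisCoord a = zd, P.midCoord a = md, P.axisCoord q = z, P.midCoord q = m,
        P.rhoSq q = X, P.geom.curv = κ, P.geom.cs P.halfDist = c, P.geom.sn P.halfDist = b at *
      linear_combination (4 * l * (m * md + κ * (z * zd + XW))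
        - 4 * (c ^ 2 + κ * l) * (XW + z * zd)) * hfq
        + 4 * l * (l - b ^ 2) * m * (X * md - XW * m) * h0
    · rw [hLa _ (hζ ζ h1)]
      simp [h1, h2, axisCoord, midCoord]
  · have hLa := fun a ha => hasFDerivWithinAt_space_apply hq ha hL
      (by unfold axisCoord; fun_prop)
      (hasDerivAt_of_linear P.axisCoord_add P.axisCoord_smul q a)
    refine ⟨⟨P.geom.cs P.halfDist ^ 2 * P.rhoSq q, fun a ha => ?_⟩, fun _ ζ h1 h2 => ?_⟩
    · rw [hLa a ha, hLa _ (hDm a), P.axisCoord_hamD haxis (q, a), hfq]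
      ring
    · rw [hLa _ (hζ ζ h1)]
      simp [h2, axisCoord]
  · have hLa := fun a ha => hasFDerivWithinAt_space_apply hq ha hL
      (by unfold midCoord; fun_prop)
      (hasDerivAt_of_linear P.midCoord_add P.midCoord_smul q a)
    refine ⟨⟨-(P.geom.curv * P.geom.sn P.halfDist ^ 2 * P.rhoSq q), fun a ha => ?_⟩,
      fun _ ζ h1 h2 => ?_⟩
    · rw [hLa a ha, hLa _ (hDm a), P.midCoord_hamD haxis (q, a), hfq]
      ring
    · rw [hLa _ (hζ ζ h1)]
      simp [h2, midCoord]
  · have hLa := fun a ha => hasFDerivWithinAt_space_apply hq ha hL (by fun_prop)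
      (hasDerivAt_of_linear (f := fun q : Ambient d => inner ℝ q.1 e)
        (fun a b => by simp [inner_add_left])
        (fun r a => by simp [inner_smul_left]) q a)
    refine ⟨⟨P.geom.cs (2 * P.halfDist) * ‖q.1‖ ^ 2
      - P.geom.sn (2 * P.halfDist) * q.2 * inner ℝ q.1 P.axis, fun a ha => ?_⟩,
      fun h => by omega⟩
    rw [hLa a ha, hLa _ (hDm a)]
    have hae : inner ℝ P.axis e = (0 : ℝ) := by rw [real_inner_comm, hea]
    simp only at hfq
    simp only [hamD, hamAngMomOn, hamLrl, ContinuousLinearMap.id_apply, Prod.fst_sub,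
      Prod.smul_fst, inner_sub_left, inner_add_left, inner_smul_left, conj_trivial, hfq, hae,
      norm_sq_eq]
    ring

theorem Reflects.form_eq {B : P.WallPiece} {q v v' : Ambient d} (h : B.Reflects q v v') :
    form P.geom v' v' = form P.geom v v := by
  obtain ⟨-, n, -, -, -, rfl⟩ := h
  exact form_reflect _ _ _

theorem Reflects.keplerEnergy_eq {B : P.WallPiece} {q v v' : Ambient d}
    (h : B.Reflects q v v') : P.keplerEnergy (q, v') = P.keplerEnergy (q, v) := by
  simp only [keplerEnergy, Reflects.form_eq P h]

theorem Reflects.D_eq (haxis : ‖P.axis‖ = 1) {B : P.WallPiece} {q v v' : Ambient d}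
    (hv : (q, v) ∈ tangentBundle P.geom d) (hy : q.1 ≠ 0)
    (h : B.Reflects q v v') : P.D (q, v') = P.D (q, v) := by
  obtain ⟨hqB, n, hn, hn0, ⟨L, hL, hLn⟩, rfl⟩ := h
  obtain ⟨⟨lam, hlam⟩, -⟩ := IsConfocal.eigen P haxis B.confocal hqB.1 hqB.2.2 hL hy
  exact P.D_reflect hv.1 hv.2 hn hn0 hy hLn hlam

theorem Reflects.angMomOn_eq {π : EuclideanSpace ℝ (Fin d) →L[ℝ] EuclideanSpace ℝ (Fin d)}
    (hπ : IsProj π) (hπa : π P.axis = 0) (hd : 3 ≤ d) (haxis : ‖P.axis‖ = 1) {B : P.WallPiece}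
    {q v v' : Ambient d} (hy : q.1 ≠ 0) (h : B.Reflects q v v') :
    angMomOn π (q, v') = angMomOn π (q, v) := by
  obtain ⟨hqB, n, -, -, ⟨L, hL, hLn⟩, rfl⟩ := h
  refine angMomOn_reflect hπ hLn (fun ζ h1 h2 => ?_) _
  refine (IsConfocal.eigen P haxis B.confocal hqB.1 hqB.2.2 hL hy).2 hd ζ h2 ?_
  rw [← h1, hπ.symm, hπa, inner_zero_right]

end TwoCenter

/-! ### Smooth dependence of integrals on parameters -/

theorem continuousOn_slice {E F : Type*} [TopologicalSpace E] [TopologicalSpace F] {f : E × ℝ → F} {s : Set (E × ℝ)} (hf : ContinuousOn f s) {x : E}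
    {a b : ℝ} (hx : ∀ t ∈ uIcc a b, (x, t) ∈ s) : ContinuousOn (fun t => f (x, t)) (uIcc a b) :=
  hf.comp (by fun_prop) hx

theorem isOpen_parametric {E : Type*} [TopologicalSpace E] {s : Set (E × ℝ)} (hs : IsOpen s) (a b : ℝ) :
    IsOpen {x | ∀ t ∈ uIcc a b, (x, t) ∈ s} := by
  rw [isOpen_iff_mem_nhds]
  intro x hx
  exact isCompact_uIcc.eventually_forall_of_forall_eventually
    fun t ht => hs.eventually_mem (hx t ht)

section Parametric

variable {E F : Type} [NormedAddCommGroup E] [NormedSpace ℝ E] [NormedAddCommGroup F]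
  [NormedSpace ℝ F]

theorem hasFDerivAt_parametric {f : E × ℝ → F} {s : Set (E × ℝ)} (hs : IsOpen s)
    (hf : ContDiffOn ℝ ∞ f s) {a b : ℝ} {x : E} (hx : ∀ t ∈ uIcc a b, (x, t) ∈ s) :
    HasFDerivAt (fun x => ∫ t in a..b, f (x, t))
      (∫ t in a..b, (fderiv ℝ f (x, t)).comp (ContinuousLinearMap.inl ℝ E ℝ)) x := by
  have hf' : ContinuousOn (fun z => (fderiv ℝ f z).comp (ContinuousLinearMap.inl ℝ E ℝ)) s :=
    (hf.continuousOn_fderiv_of_isOpen hs (by simp)).clm_comp continuousOn_const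
  -- The bound on the compact slice over `x` persists, with slack `1`, on a neighbourhood of `x`
  -- that is uniform in `t`; the constant `M + 1` then dominates.
  obtain ⟨M, hM⟩ := isCompact_uIcc.exists_bound_of_continuousOn (continuousOn_slice hf' hx)
  have hev : ∀ᶠ y in 𝓝 x, ∀ t ∈ uIcc a b, (y, t) ∈ s ∧
      ‖(fderiv ℝ f (y, t)).comp (ContinuousLinearMap.inl ℝ E ℝ)‖ < M + 1 := by
    refine isCompact_uIcc.eventually_forall_of_forall_eventually fun t ht => ?_
    have h1 := (hf'.continuousAt (hs.mem_nhds (hx t ht))).norm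
    exact (hs.eventually_mem (hx t ht)).and
      (h1.eventually_lt_const ((hM t ht).trans_lt (lt_add_one M)))
  refine (intervalIntegral.hasFDerivAt_integral_of_dominated_of_fderiv_le (𝕜 := ℝ)
    (F := fun y t => f (y, t)) (a := a) (b := b) (μ := MeasureTheory.volume)
    (F' := fun y t => (fderiv ℝ f (y, t)).comp (ContinuousLinearMap.inl ℝ E ℝ)) (bound := fun _ => M + 1) hev ?_ ?_ ?_ ?_ ?_ ?_)
  · filter_upwards [hev] with y hy
    exact ((continuousOn_slice hf.continuousOn fun t ht => (hy t ht).1).mono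
      uIoc_subset_uIcc).aestronglyMeasurable measurableSet_uIoc
  · exact (continuousOn_slice hf.continuousOn hx).intervalIntegrable
  · exact ((continuousOn_slice hf' hx).mono uIoc_subset_uIcc).aestronglyMeasurable
      measurableSet_uIoc
  · refine Eventually.of_forall fun t ht y hy => (hy t (uIoc_subset_uIcc ht)).2.le
  · exact intervalIntegrable_const
  · refine Eventually.of_forall fun t ht y hy => ?_
    have h1 : HasFDerivAt f (fderiv ℝ f (y, t)) (y, t) :=
      ((hf.contDiffAt (hs.mem_nhds (hy t (uIoc_subset_uIcc ht)).1)).differentiableAt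
        (by simp)).hasFDerivAt
    exact h1.comp y (hasFDerivAt_prodMk_left y t)

end Parametric

/-- Induction on the order of differentiability. The target space is quantified inside the induction
because the derivative is an integral of the same type with values in linear maps. -/
theorem contDiffOn_parametric_nat {E : Type} [NormedAddCommGroup E] [NormedSpace ℝ E]
    {s : Set (E × ℝ)} (hs : IsOpen s) (a b : ℝ) (n : ℕ) :
    ∀ {F : Type} [NormedAddCommGroup F] [NormedSpace ℝ F] [CompleteSpace F] {f : E × ℝ → F},
      ContDiffOn ℝ ∞ f s →
        ContDiffOn ℝ n (fun x => ∫ t in a..b, f (x, t)) {x | ∀ t ∈ uIcc a b, (x, t) ∈ s} := by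
  induction n with
  | zero =>
    intro F _ _ _ f hf
    rw [Nat.cast_zero, contDiffOn_zero]
    exact fun x hx => (hasFDerivAt_parametric hs hf hx).continuousAt.continuousWithinAt
  | succ n ih =>
    intro F _ _ _ f hf
    have hU := isOpen_parametric hs a b
    have hf' : ContDiffOn ℝ ∞
        (fun z => (fderiv ℝ f z).comp (ContinuousLinearMap.inl ℝ E ℝ)) s :=
      (hf.fderiv_of_isOpen hs (by simp)).clm_comp contDiffOn_const
    push_cast
    rw [contDiffOn_succ_iff_fderiv_of_isOpen hU]
    refine ⟨fun x hx => (hasFDerivAt_parametric hs hf hx).differentiableAt.differentiableWithinAt,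
      by simp, ?_⟩
    exact (ih hf').congr fun x hx => (hasFDerivAt_parametric hs hf hx).fderiv

theorem contDiffOn_parametric {E F : Type} [NormedAddCommGroup E] [NormedSpace ℝ E]
    [NormedAddCommGroup F] [NormedSpace ℝ F] [CompleteSpace F] {f : E × ℝ → F}
    {s : Set (E × ℝ)} (hs : IsOpen s) (hf : ContDiffOn ℝ ∞ f s) (a b : ℝ) :
    ContDiffOn ℝ ∞ (fun x => ∫ t in a..b, f (x, t)) {x | ∀ t ∈ uIcc a b, (x, t) ∈ s} :=
  contDiffOn_infty.2 fun n => contDiffOn_parametric_nat hs a b n hf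

/-! ### Averages over Kepler orbits in terms of the orbital elements -/

/-- The orbital elements `(b, g, u, p, k)` of a state: the components `b`, `g` of the axis along
the radial and the angular unit vector, the quotient `u = s / ‖y‖` (the cotangent of the
distance from the center), its derivative `p` with respect to the angle, and `k = m₁ / C²`. -/
abbrev Elements : Type := ℝ × ℝ × ℝ × ℝ × ℝ

namespace Elements

/-- The radial component of the axis after the angle `φ`. -/
def b (x : Elements) (φ : ℝ) : ℝ := x.1 * Real.cos φ + x.2.1 * Real.sin φ

/-- The angular component of the axis after the angle `φ`. -/
def g (x : Elements) (φ : ℝ) : ℝ := x.2.1 * Real.cos φ - x.1 * Real.sin φ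

/-- The constant element `k`. -/
def k (x : Elements) : ℝ := x.2.2.2.2

/-- The value of `u` after the angle `φ`. -/
def u (x : Elements) (φ : ℝ) : ℝ :=
  x.k + (x.2.2.1 - x.k) * Real.cos φ + x.2.2.2.1 * Real.sin φ

/-- The value of `p` after the angle `φ`. -/
def p (x : Elements) (φ : ℝ) : ℝ :=
  x.2.2.2.1 * Real.cos φ - (x.2.2.1 - x.k) * Real.sin φ

/-- The component of the Laplace-Runge-Lenz vector, divided by `C²`, in the direction that is
orthogonal to the axis in the orbital plane. -/
def J (x : Elements) : ℝ := (x.2.2.1 - x.k) * x.2.1 - x.2.2.2.1 * x.1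

variable (x : Elements) (φ : ℝ)

theorem hasDerivAt_b : HasDerivAt x.b (x.g φ) φ := by
  have := ((Real.hasDerivAt_cos φ).const_mul x.1).add ((Real.hasDerivAt_sin φ).const_mul x.2.1)
  exact this.congr_deriv (by simp only [g]; ring)

theorem hasDerivAt_u : HasDerivAt x.u (x.p φ) φ := by
  have := (((Real.hasDerivAt_cos φ).const_mul (x.2.2.1 - x.k)).const_add x.k).add
    ((Real.hasDerivAt_sin φ).const_mul x.2.2.2.1)
  exact this.congr_deriv (by simp only [p]; ring)

theorem hasDerivAt_g : HasDerivAt x.g (-x.b φ) φ := by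
  have := ((Real.hasDerivAt_cos φ).const_mul x.2.1).sub ((Real.hasDerivAt_sin φ).const_mul x.1)
  exact this.congr_deriv (by simp only [b]; ring)

theorem hasDerivAt_p : HasDerivAt x.p (x.k - x.u φ) φ := by
  have := ((Real.hasDerivAt_cos φ).const_mul x.2.2.2.1).sub
    ((Real.hasDerivAt_sin φ).const_mul (x.2.2.1 - x.k))
  exact this.congr_deriv (by simp only [u]; ring)

/-- Both pairs `(u - k, p)` and `(b, g)` rotate by the same angle, so their cross product does not
depend on `φ`. -/
theorem J_eq : (x.u φ - x.k) * x.g φ - x.p φ * x.b φ = x.J := by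
  have h := Real.sin_sq_add_cos_sq φ
  simp only [u, g, p, b, J]
  linear_combination ((x.2.2.1 - x.k) * x.2.1 - x.2.2.2.1 * x.1) * h

theorem b_add_smul (ν : Elements) (ε : ℝ) : b (x + ε • ν) φ = x.b φ + ε * ν.b φ := by
  simp only [b, Prod.fst_add, Prod.snd_add, Prod.smul_fst, Prod.smul_snd, smul_eq_mul]; ring

theorem u_add_smul (ν : Elements) (ε : ℝ) : u (x + ε • ν) φ = x.u φ + ε * ν.u φ := by
  simp only [u, k, Prod.fst_add, Prod.snd_add, Prod.smul_fst, Prod.smul_snd, smul_eq_mul]; ring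

theorem b_periodic : x.b (2 * Real.pi) = x.b 0 := by simp [b]

theorem u_periodic : x.u (2 * Real.pi) = x.u 0 := by simp [u]

end Elements

/-! ### The averaged potential as a function of the elements, and its stationarity along the flow of
`D` -/

namespace TwoCenter

variable (P : TwoCenter d)

/-- The inverse of the squared distance from the center, up to the geometry: `1 / sn²`. -/
def qFun (u : ℝ) : ℝ := u ^ 2 + P.geom.curv

/-- The numerator of the potential of the second center. -/
def numFun (b u : ℝ) : ℝ :=
  P.geom.cs (2 * P.halfDist) * u + P.geom.curv * P.geom.sn (2 * P.halfDist) * b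

/-- The square of the denominator of the potential of the second center. -/
def denSq (b u : ℝ) : ℝ :=
  1 - b ^ 2 + (P.geom.cs (2 * P.halfDist) * b - P.geom.sn (2 * P.halfDist) * u) ^ 2

/-- The potential of the second center for the mass `-1`, as a function of the direction. -/
def potFun (b u : ℝ) : ℝ := P.numFun b u / √(P.denSq b u)

/-- The potential correction of the second integral of the two-center problem. -/
def conjFun (b u : ℝ) : ℝ :=
  P.geom.sn (2 * P.halfDist) *
    (P.geom.cs (2 * P.halfDist) * b - P.geom.sn (2 * P.halfDist) * u) / √(P.denSq b u)

theorem hasDerivAt_sqrt_denSq {b u : ℝ → ℝ} {b' u' t : ℝ} (hb : HasDerivAt b b' t)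
    (hu : HasDerivAt u u' t) (h : 0 < P.denSq (b t) (u t)) :
    HasDerivAt (fun t => √(P.denSq (b t) (u t)))
      (-(P.geom.sn (2 * P.halfDist) * (P.numFun (b t) (u t) * b'
        + (P.geom.cs (2 * P.halfDist) * b t - P.geom.sn (2 * P.halfDist) * u t) * u'))
        / √(P.denSq (b t) (u t))) t := by
  have h0 := P.geom.cs_sq_add (2 * P.halfDist)
  have h1 := (((hb.pow 2).const_sub 1).add
    (((hb.const_mul (P.geom.cs (2 * P.halfDist))).sub
      (hu.const_mul (P.geom.sn (2 * P.halfDist)))).pow 2)).sqrt h.ne'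
  refine h1.congr_deriv ?_
  simp only [numFun]
  change _ / (2 * √(P.denSq (b t) (u t))) = _
  have hR : √(P.denSq (b t) (u t)) ≠ 0 := (Real.sqrt_pos.2 h).ne'
  generalize √(P.denSq (b t) (u t)) = R at *
  field_simp
  push_cast
  simp only [Pi.sub_apply]
  linear_combination 2 * b t * b' * h0

theorem hasDerivAt_potFun {b u : ℝ → ℝ} {b' u' t : ℝ} (hb : HasDerivAt b b' t)
    (hu : HasDerivAt u u' t) (h : 0 < P.denSq (b t) (u t)) :
    HasDerivAt (fun t => P.potFun (b t) (u t))
      ((P.geom.sn (2 * P.halfDist) * P.qFun (u t) * b'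
        + (P.geom.cs (2 * P.halfDist) - P.geom.sn (2 * P.halfDist) * u t * b t) * u')
        / √(P.denSq (b t) (u t)) ^ 3) t := by
  have h0 := P.geom.cs_sq_add (2 * P.halfDist)
  have hR : √(P.denSq (b t) (u t)) ≠ 0 := (Real.sqrt_pos.2 h).ne'
  have hR2 : √(P.denSq (b t) (u t)) ^ 2 = _ := Real.sq_sqrt h.le
  have h1 := ((hu.const_mul (P.geom.cs (2 * P.halfDist))).add
    (hb.const_mul (P.geom.curv * P.geom.sn (2 * P.halfDist)))).div
      (P.hasDerivAt_sqrt_denSq hb hu h) hR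
  refine h1.congr_deriv ?_
  simp only [numFun, qFun, denSq, Pi.add_apply] at hR2 ⊢
  change _ at hR
  simp only [denSq] at hR
  generalize √(1 - b t ^ 2 + (P.geom.cs (2 * P.halfDist) * b t
    - P.geom.sn (2 * P.halfDist) * u t) ^ 2) = R at *
  generalize b t = β, u t = υ, P.geom.curv = κ, P.geom.cs (2 * P.halfDist) = c,
    P.geom.sn (2 * P.halfDist) = S at *
  field_simp
  linear_combination (c * u' + κ * S * b') * hR2
    + (b' * S * β ^ 2 * κ + b' * S * υ ^ 2 - S * u' * β * υ + u' * c * β ^ 2) * h0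

/-- Compared with `hasDerivAt_potFun`, the partial derivative of `conjFun` in `b` is `sn(2h)` times
that of `potFun` in `u`. Such relations make the derivative of the potential along `D` a total
derivative along the orbit. -/
theorem hasDerivAt_conjFun {b u : ℝ → ℝ} {b' u' t : ℝ} (hb : HasDerivAt b b' t)
    (hu : HasDerivAt u u' t) (h : 0 < P.denSq (b t) (u t)) :
    HasDerivAt (fun t => P.conjFun (b t) (u t))
      (P.geom.sn (2 * P.halfDist) *
        ((P.geom.cs (2 * P.halfDist) - P.geom.sn (2 * P.halfDist) * u t * b t) * b'
        - P.geom.sn (2 * P.halfDist) * (1 - b t ^ 2) * u')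
        / √(P.denSq (b t) (u t)) ^ 3) t := by
  have h0 := P.geom.cs_sq_add (2 * P.halfDist)
  have hR : √(P.denSq (b t) (u t)) ≠ 0 := (Real.sqrt_pos.2 h).ne'
  have hR2 : √(P.denSq (b t) (u t)) ^ 2 = _ := Real.sq_sqrt h.le
  have h1 := (((hb.const_mul (P.geom.cs (2 * P.halfDist))).sub
    (hu.const_mul (P.geom.sn (2 * P.halfDist)))).const_mul (P.geom.sn (2 * P.halfDist))).div
      (P.hasDerivAt_sqrt_denSq hb hu h) hR
  refine h1.congr_deriv ?_
  simp only [numFun, denSq, Pi.sub_apply] at hR2 ⊢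
  simp only [denSq] at hR
  generalize √(1 - b t ^ 2 + (P.geom.cs (2 * P.halfDist) * b t
    - P.geom.sn (2 * P.halfDist) * u t) ^ 2) = R at *
  generalize b t = β, u t = υ, P.geom.curv = κ, P.geom.cs (2 * P.halfDist) = c,
    P.geom.sn (2 * P.halfDist) = S at *
  field_simp
  linear_combination S * (c * b' - S * u') * hR2
    + (b' * S * c * β ^ 2 - b' * S ^ 2 * β * υ) * h0

/-- The direction in which the orbital elements move under the flow of `D`, up to a factor and
up to a multiple `c₀` of the direction of the Kepler flow. -/
def elementsDir (x : Elements) (c₀ : ℝ) : Elements :=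
  let c := P.geom.cs (2 * P.halfDist)
  let S := P.geom.sn (2 * P.halfDist)
  let b := x.1
  let g := x.2.1
  let u := x.2.2.1
  let p := x.2.2.2.1
  let k := x.k
  let J := x.J
  ((2 * c + c₀) * g - S * (J * b + p), -(2 * c + c₀) * b - S * (J * g + k - u),
    -(S * J * u) - S * k * J - S * (k ^ 2 + P.geom.curv) * g + c₀ * p,
    -(S * J * p) + S * (k ^ 2 + P.geom.curv) * b + c₀ * (k - u), -2 * (S * k * J))

/-- The formula at the angle `φ` has the same shape as the definition at angle `0`, reflecting that
the flow of `D` commutes with the motion along Kepler orbits. -/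
theorem b_elementsDir (x : Elements) (c₀ φ : ℝ) :
    (P.elementsDir x c₀).b φ = (2 * P.geom.cs (2 * P.halfDist) + c₀) * x.g φ
      - P.geom.sn (2 * P.halfDist) * (x.J * x.b φ + x.p φ) := by
  simp only [elementsDir, Elements.b, Elements.g, Elements.p]; ring

theorem u_elementsDir (x : Elements) (c₀ φ : ℝ) :
    (P.elementsDir x c₀).u φ = -(P.geom.sn (2 * P.halfDist) * x.J * x.u φ)
      - P.geom.sn (2 * P.halfDist) * x.k * x.J
      - P.geom.sn (2 * P.halfDist) * (x.k ^ 2 + P.geom.curv) * x.g φ + c₀ * x.p φ := by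
  simp only [elementsDir, Elements.u, Elements.g, Elements.p, Elements.k]; ring

/-- The variation of the time along the orbit. -/
def timeShift (x : Elements) (c₀ φ : ℝ) : ℝ :=
  (P.geom.sn (2 * P.halfDist) * x.b φ * (x.u φ + x.k) + c₀) / P.qFun (x.u φ)

/-- The variation of the time element `1 / qFun` is a multiple of it up to a total derivative. The
multiple is `sn(2h) J`, the logarithmic rate at which `C` changes (compare the last entry of
`elementsDir` with `k = m₁ / C²`): the integral of `1 / qFun` over a turn is `C` times the period,
and the period is preserved. -/
theorem hasDerivAt_timeShift (x : Elements) (c₀ φ : ℝ) (hQ : 0 < P.qFun (x.u φ)) :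
    HasDerivAt (P.timeShift x c₀)
      (-(2 * x.u φ * (P.elementsDir x c₀).u φ / P.qFun (x.u φ) ^ 2)
        - P.geom.sn (2 * P.halfDist) * x.J * (1 / P.qFun (x.u φ))) φ := by
  have hb := x.hasDerivAt_b φ
  have hu := x.hasDerivAt_u φ
  have := (((hb.const_mul (P.geom.sn (2 * P.halfDist))).mul (hu.add_const x.k)).add_const c₀).div
    ((hu.pow 2).add_const P.geom.curv) hQ.ne'
  refine this.congr_deriv ?_
  rw [P.u_elementsDir, ← x.J_eq φ]
  simp only [qFun, Pi.mul_apply, Pi.pow_apply] at hQ ⊢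
  have hQ' := hQ.ne'
  field_simp
  push_cast
  ring

/-- The elements of the orbits that stay in the space form and avoid the second center. -/
def goodPairs : Set (Elements × ℝ) :=
  {z | 0 < P.qFun (z.1.u z.2) ∧ (P.geom ≠ .spherical → 0 < z.1.u z.2) ∧
    0 < P.denSq (z.1.b z.2) (z.1.u z.2)}

/-- The elements of the regular orbits. -/
def goodElements : Set Elements :=
  {x | ∀ φ ∈ uIcc 0 (2 * Real.pi), (x, φ) ∈ P.goodPairs}

theorem contDiff_b : ContDiff ℝ ∞ fun z : Elements × ℝ => z.1.b z.2 := by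
  unfold Elements.b; fun_prop

theorem contDiff_u : ContDiff ℝ ∞ fun z : Elements × ℝ => z.1.u z.2 := by
  unfold Elements.u Elements.k; fun_prop

theorem isOpen_goodPairs : IsOpen P.goodPairs := by
  have h1 := contDiff_b.continuous
  have h2 := contDiff_u.continuous
  have h3 : Continuous fun z : Elements × ℝ => P.qFun (z.1.u z.2) := by unfold qFun; fun_prop
  have h4 : Continuous fun z : Elements × ℝ => P.denSq (z.1.b z.2) (z.1.u z.2) := by
    unfold denSq; fun_prop
  refine IsOpen.inter (isOpen_lt continuous_const h3)
    (IsOpen.inter ?_ (isOpen_lt continuous_const h4))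
  by_cases h : P.geom = .spherical
  · simp [h]
    exact isOpen_univ
  · simp only [ne_eq, h, not_false_eq_true, forall_const]
    exact isOpen_lt continuous_const h2

theorem isOpen_goodElements : IsOpen P.goodElements := isOpen_parametric P.isOpen_goodPairs _ _

/-- The integrand for the period. -/
def weight (z : Elements × ℝ) : ℝ := 1 / P.qFun (z.1.u z.2)

/-- The integrand for the integral of the potential. -/
def weightedPot (z : Elements × ℝ) : ℝ :=
  P.potFun (z.1.b z.2) (z.1.u z.2) * (1 / P.qFun (z.1.u z.2))

theorem contDiffOn_weight : ContDiffOn ℝ ∞ P.weight P.goodPairs := by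
  intro z hz
  have h2 := contDiff_u.contDiffAt (x := z)
  refine ContDiffAt.contDiffWithinAt ?_
  exact contDiffAt_const.div ((h2.pow 2).add contDiffAt_const) hz.1.ne'

theorem contDiffOn_weightedPot : ContDiffOn ℝ ∞ P.weightedPot P.goodPairs := by
  intro z hz
  have h1 := contDiff_b.contDiffAt (x := z)
  have h2 := contDiff_u.contDiffAt (x := z)
  refine ContDiffWithinAt.mul (ContDiffAt.contDiffWithinAt ?_) (P.contDiffOn_weight z hz)
  refine ContDiffAt.div (by unfold numFun; fun_prop) (ContDiffAt.sqrt ?_ hz.2.2.ne')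
    (Real.sqrt_pos.2 hz.2.2).ne'
  unfold denSq
  fun_prop

/-- The average of `potFun` over the orbit with given elements. -/
def orbitAverage (x : Elements) : ℝ :=
  (∫ φ in (0 : ℝ)..2 * Real.pi, P.weightedPot (x, φ)) /
    ∫ φ in (0 : ℝ)..2 * Real.pi, P.weight (x, φ)

theorem integral_weight_pos {x : Elements} (hx : x ∈ P.goodElements) :
    0 < ∫ φ in (0 : ℝ)..2 * Real.pi, P.weight (x, φ) := by
  refine intervalIntegral.intervalIntegral_pos_of_pos_on
    (continuousOn_slice P.contDiffOn_weight.continuousOn hx).intervalIntegrable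
    (fun φ hφ => ?_) (by positivity)
  exact one_div_pos.2 (hx φ (by rw [uIcc_of_le (by positivity)]; exact Ioo_subset_Icc_self hφ)).1

theorem contDiffOn_orbitAverage : ContDiffOn ℝ ∞ P.orbitAverage P.goodElements :=
  (contDiffOn_parametric P.isOpen_goodPairs P.contDiffOn_weightedPot _ _).div
    (contDiffOn_parametric P.isOpen_goodPairs P.contDiffOn_weight _ _)
    fun _ hx => (P.integral_weight_pos hx).ne'

/-- If the directional derivative of an integrand is a multiple of the integrand up to a total
derivative of a periodic function, then the same holds for the integral. -/
theorem fderiv_integral_apply {f : Elements × ℝ → ℝ} (hf : ContDiffOn ℝ ∞ f P.goodPairs)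
    {x ν : Elements} (hx : x ∈ P.goodElements) {h : ℝ → ℝ} {j : ℝ}
    (hper : h (2 * Real.pi) = h 0)
    (H : ∀ φ ∈ uIcc 0 (2 * Real.pi), ∃ δ, HasDerivAt (fun ε : ℝ => f (x + ε • ν, φ)) δ 0 ∧
      HasDerivAt h (δ - j * f (x, φ)) φ) :
    fderiv ℝ (fun x => ∫ φ in (0 : ℝ)..2 * Real.pi, f (x, φ)) x ν =
      j * ∫ φ in (0 : ℝ)..2 * Real.pi, f (x, φ) := by
  rw [(hasFDerivAt_parametric P.isOpen_goodPairs hf hx).fderiv]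
  have hc : ContinuousOn (fun φ => (fderiv ℝ f (x, φ)).comp (ContinuousLinearMap.inl ℝ Elements ℝ))
      (uIcc 0 (2 * Real.pi)) :=
    continuousOn_slice ((hf.continuousOn_fderiv_of_isOpen P.isOpen_goodPairs (by simp)).clm_comp
      continuousOn_const) hx
  have hcf := continuousOn_slice hf.continuousOn hx
  rw [ContinuousLinearMap.intervalIntegral_apply hc.intervalIntegrable]
  have e : ∀ φ ∈ uIcc 0 (2 * Real.pi), HasDerivAt h
      ((fderiv ℝ f (x, φ)).comp (ContinuousLinearMap.inl ℝ Elements ℝ) ν - j * f (x, φ)) φ := by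
    intro φ hφ
    obtain ⟨δ, h1, h2⟩ := H φ hφ
    have hd : DifferentiableAt ℝ f (x, φ) :=
      (hf.contDiffAt (P.isOpen_goodPairs.mem_nhds (hx φ hφ))).differentiableAt (by simp)
    have h3 : fderiv ℝ f (x, φ) (ν, 0) = δ :=
      fderiv_apply_of_line hd (by simpa using h1)
    rw [ContinuousLinearMap.comp_apply, ContinuousLinearMap.inl_apply, h3]
    exact h2
  have hc' : ContinuousOn (fun φ => (fderiv ℝ f (x, φ)).comp
      (ContinuousLinearMap.inl ℝ Elements ℝ) ν) (uIcc 0 (2 * Real.pi)) :=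
    hc.clm_apply continuousOn_const
  have hjf : ContinuousOn (fun φ => j * f (x, φ)) (uIcc 0 (2 * Real.pi)) :=
    continuousOn_const.mul hcf
  have h0 := intervalIntegral.integral_eq_sub_of_hasDerivAt e (hc'.sub hjf).intervalIntegrable
  rw [intervalIntegral.integral_sub hc'.intervalIntegrable hjf.intervalIntegrable, hper, sub_self,
    intervalIntegral.integral_const_mul] at h0
  linarith

/-- Integrate `hasDerivAt_timeShift` over a full turn; the time shift is periodic. -/
theorem fderiv_integral_weight {x : Elements} (hx : x ∈ P.goodElements) (c₀ : ℝ) :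
    fderiv ℝ (fun x => ∫ φ in (0 : ℝ)..2 * Real.pi, P.weight (x, φ)) x (P.elementsDir x c₀) =
      (P.geom.sn (2 * P.halfDist) * x.J) * ∫ φ in (0 : ℝ)..2 * Real.pi, P.weight (x, φ) := by
  refine P.fderiv_integral_apply P.contDiffOn_weight hx (h := P.timeShift x c₀) ?_
    fun φ hφ => ⟨_, ?_, P.hasDerivAt_timeShift x c₀ φ (hx φ hφ).1⟩
  · simp only [timeShift, x.b_periodic, x.u_periodic]
  · simp only [weight, Elements.u_add_smul, qFun]
    have h1 := (((hasDerivAt_id (0 : ℝ)).mul_const ((P.elementsDir x c₀).u φ)).const_add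
      (x.u φ)).pow 2
    have h2 := (hasDerivAt_const (0 : ℝ) (1 : ℝ)).div (h1.add_const P.geom.curv)
      (by simpa [qFun] using (hx φ hφ).1.ne')
    refine h2.congr_deriv ?_
    simp
    ring

/-- Here the separability of the two-center problem enters. The primitive has two parts: `conjFun`,
the correction of the second integral, accounts for the bracket of the potential with `D`; the time
shift times the potential accounts for comparing neighbouring orbits at equal angles instead of
equal times. -/
theorem fderiv_integral_weightedPot {x : Elements} (hx : x ∈ P.goodElements) (c₀ : ℝ) :
    fderiv ℝ (fun x => ∫ φ in (0 : ℝ)..2 * Real.pi, P.weightedPot (x, φ)) x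
        (P.elementsDir x c₀) =
      (P.geom.sn (2 * P.halfDist) * x.J) *
        ∫ φ in (0 : ℝ)..2 * Real.pi, P.weightedPot (x, φ) := by
  refine P.fderiv_integral_apply P.contDiffOn_weightedPot hx
    (h := fun φ => P.conjFun (x.b φ) (x.u φ)
      + P.timeShift x c₀ φ * P.potFun (x.b φ) (x.u φ)) ?_ fun φ hφ => ?_
  · simp only [timeShift, x.b_periodic, x.u_periodic]
  obtain ⟨hQ, -, hR⟩ := hx φ hφ
  have hb := x.hasDerivAt_b φ
  have hu := x.hasDerivAt_u φ
  have hb' : HasDerivAt (fun ε : ℝ => x.b φ + ε * (P.elementsDir x c₀).b φ)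
      ((P.elementsDir x c₀).b φ) 0 := by
    simpa using ((hasDerivAt_id (0 : ℝ)).mul_const ((P.elementsDir x c₀).b φ)).const_add (x.b φ)
  have hu' : HasDerivAt (fun ε : ℝ => x.u φ + ε * (P.elementsDir x c₀).u φ)
      ((P.elementsDir x c₀).u φ) 0 := by
    simpa using ((hasDerivAt_id (0 : ℝ)).mul_const ((P.elementsDir x c₀).u φ)).const_add (x.u φ)
  have hW := (P.hasDerivAt_conjFun hb hu hR).add
    ((P.hasDerivAt_timeShift x c₀ φ hQ).mul (P.hasDerivAt_potFun hb hu hR))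
  have hV := P.hasDerivAt_potFun hb' hu' (by simpa using hR)
  have hw := (hasDerivAt_const (0 : ℝ) (1 : ℝ)).div ((hu'.pow 2).add_const P.geom.curv)
    (by simpa [qFun] using hQ.ne')
  refine ⟨(P.geom.sn (2 * P.halfDist) * P.qFun (x.u φ) * (P.elementsDir x c₀).b φ
        + (P.geom.cs (2 * P.halfDist) - P.geom.sn (2 * P.halfDist) * x.u φ * x.b φ)
          * (P.elementsDir x c₀).u φ) / √(P.denSq (x.b φ) (x.u φ)) ^ 3 * (1 / P.qFun (x.u φ))
      + P.potFun (x.b φ) (x.u φ)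
        * -(2 * x.u φ * (P.elementsDir x c₀).u φ / P.qFun (x.u φ) ^ 2), ?_, hW.congr_deriv ?_⟩
  · simp only [weightedPot, Elements.u_add_smul, Elements.b_add_smul]
    refine (hV.mul hw).congr_deriv ?_
    simp [qFun]
    ring
  · have hQ' := hQ.ne'
    have hR' := (Real.sqrt_pos.2 hR).ne'
    simp only [weightedPot, timeShift]
    simp only at hQ' hR'
    rw [P.u_elementsDir, P.b_elementsDir, ← x.J_eq φ]
    generalize P.potFun (x.b φ) (x.u φ) = V
    generalize √(P.denSq (x.b φ) (x.u φ)) = R at *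
    simp only [qFun] at *
    field_simp
    ring

/-- Numerator and denominator vary at the same logarithmic rate `sn(2h) J`, so the quotient is
stationary. The constant `c₀` is free, since it only adds motion along the Kepler orbit. -/
theorem fderiv_orbitAverage {x : Elements} (hx : x ∈ P.goodElements) (c₀ : ℝ) :
    fderiv ℝ P.orbitAverage x (P.elementsDir x c₀) = 0 := by
  have hI := P.integral_weight_pos hx
  have h1 : DifferentiableAt ℝ (fun x => ∫ φ in (0 : ℝ)..2 * Real.pi, P.weightedPot (x, φ)) x :=
    (hasFDerivAt_parametric P.isOpen_goodPairs P.contDiffOn_weightedPot hx).differentiableAt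
  have h2 : DifferentiableAt ℝ (fun x => ∫ φ in (0 : ℝ)..2 * Real.pi, P.weight (x, φ)) x :=
    (hasFDerivAt_parametric P.isOpen_goodPairs P.contDiffOn_weight hx).differentiableAt
  refine fderiv_apply_of_line (((P.contDiffOn_orbitAverage).contDiffAt
    (P.isOpen_goodElements.mem_nhds hx)).differentiableAt (by simp)) ?_
  have hl := fun (F : Elements → ℝ) (hF : DifferentiableAt ℝ F x) =>
    (show HasFDerivAt F (fderiv ℝ F x) (x + (0 : ℝ) • P.elementsDir x c₀) by
      simpa using hF.hasFDerivAt).comp_hasDerivAt (0 : ℝ)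
      (show HasDerivAt (fun ε : ℝ => x + ε • P.elementsDir x c₀) (P.elementsDir x c₀) 0 by
        simpa using ((hasDerivAt_id (0 : ℝ)).smul_const (P.elementsDir x c₀)).const_add x)
  have h3 := (hl _ h1).div (hl _ h2) (by simpa using hI.ne')
  refine h3.congr_deriv ?_
  simp only [P.fderiv_integral_weight hx, P.fderiv_integral_weightedPot hx, Function.comp_apply,
    zero_smul, add_zero]
  ring

end TwoCenter

/-! ### The orbital elements of a state -/

/-- The squared norm of the angular momentum. -/
abbrev angSq (p : State d) : ℝ := angMomOn (ContinuousLinearMap.id ℝ _) p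

theorem angSq_eq (p : State d) : angSq p =
    ‖p.1.1‖ ^ 2 * inner ℝ p.2.1 p.2.1 - inner ℝ p.1.1 p.2.1 ^ 2 := by
  simp [angSq, angMomOn]

theorem angSq_nonneg (p : State d) : 0 ≤ angSq p := by
  have h := abs_le.1 (abs_real_inner_le_norm p.1.1 p.2.1)
  have := sq_le_sq' h.1 h.2
  rw [angSq_eq, ← norm_sq_eq]
  linarith [mul_pow ‖p.1.1‖ ‖p.2.1‖ 2]

theorem ne_zero_of_angSq {p : State d} (h : 0 < angSq p) : p.1.1 ≠ 0 := by
  intro h0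
  rw [angSq_eq, h0] at h
  simp at h

/-- The norm of the angular momentum. -/
def ang (p : State d) : ℝ := √(angSq p)

theorem ang_sq (p : State d) : ang p ^ 2 = angSq p := Real.sq_sqrt (angSq_nonneg p)

theorem ang_pos {p : State d} (h : 0 < angSq p) : 0 < ang p := Real.sqrt_pos.2 h

/-- The orbital elements of a state, with respect to a mass `m` and a vector `a`. -/
def elementsOf (m : ℝ) (a : EuclideanSpace ℝ (Fin d)) (p : State d) : Elements :=
  (inner ℝ p.1.1 a / ‖p.1.1‖,
    (‖p.1.1‖ ^ 2 * inner ℝ p.2.1 a - inner ℝ p.1.1 p.2.1 * inner ℝ p.1.1 a) / (‖p.1.1‖ * ang p),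
    p.1.2 / ‖p.1.1‖,
    (p.2.2 * ‖p.1.1‖ ^ 2 - p.1.2 * inner ℝ p.1.1 p.2.1) / (‖p.1.1‖ * ang p),
    m / angSq p)

/-- The directional derivative of `elementsOf`. -/
def elementsDeriv (m : ℝ) (a : EuclideanSpace ℝ (Fin d)) (p Y : State d) : Elements :=
  let r := ‖p.1.1‖
  let C := ang p
  let T := angMomOnDeriv (ContinuousLinearMap.id ℝ _) p Y
  let ρ : ℝ := inner ℝ p.1.1 Y.1.1
  let l := ρ / r ^ 2 + T / (2 * C ^ 2)
  (inner ℝ Y.1.1 a / r - inner ℝ p.1.1 a * ρ / r ^ 3,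
    (2 * ρ * inner ℝ p.2.1 a + r ^ 2 * inner ℝ Y.2.1 a
      - (inner ℝ Y.1.1 p.2.1 + inner ℝ p.1.1 Y.2.1) * inner ℝ p.1.1 a
      - inner ℝ p.1.1 p.2.1 * inner ℝ Y.1.1 a) / (r * C)
      - (r ^ 2 * inner ℝ p.2.1 a - inner ℝ p.1.1 p.2.1 * inner ℝ p.1.1 a) / (r * C) * l,
    Y.1.2 / r - p.1.2 * ρ / r ^ 3,
    (Y.2.2 * r ^ 2 + 2 * p.2.2 * ρ - Y.1.2 * inner ℝ p.1.1 p.2.1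
      - p.1.2 * (inner ℝ Y.1.1 p.2.1 + inner ℝ p.1.1 Y.2.1)) / (r * C)
      - (p.2.2 * r ^ 2 - p.1.2 * inner ℝ p.1.1 p.2.1) / (r * C) * l,
    -(m * T / C ^ 4))

theorem contDiffAt_elementsOf (m : ℝ) (a : EuclideanSpace ℝ (Fin d)) {p : State d}
    (hp : 0 < angSq p) : ContDiffAt ℝ ∞ (elementsOf m a) p := by
  have h1 : ContDiffAt ℝ ∞ (fun p : State d => ‖p.1.1‖) p :=
    ContDiffAt.norm ℝ (by fun_prop) (ne_zero_of_angSq hp)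
  have h2 : ‖p.1.1‖ ≠ 0 := norm_ne_zero_iff.2 (ne_zero_of_angSq hp)
  have h3 : ContDiffAt ℝ ∞ (angSq (d := d)) p := contDiff_angMomOn.contDiffAt
  have h4 : ContDiffAt ℝ ∞ (ang (d := d)) p := h3.sqrt hp.ne'
  have h5 := hp.ne'
  have h6 := mul_ne_zero h2 (ang_pos hp).ne'
  unfold elementsOf
  refine ContDiffAt.prodMk (by fun_prop (disch := assumption)) (ContDiffAt.prodMk ?_
    (ContDiffAt.prodMk (by fun_prop (disch := assumption)) (ContDiffAt.prodMk ?_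
      (contDiffAt_const.div h3 h5))))
  · exact ContDiffAt.div (by fun_prop) (h1.mul h4) h6
  · exact ContDiffAt.div (by fun_prop) (h1.mul h4) h6

theorem hasDerivAt_elementsOf (m : ℝ) (a : EuclideanSpace ℝ (Fin d)) {c : ℝ → State d}
    {Y : State d} {t : ℝ} (h : HasDerivAt c Y t) (hp : 0 < angSq (c t)) :
    HasDerivAt (fun t => elementsOf m a (c t)) (elementsDeriv m a (c t) Y) t := by
  have hy0 := ne_zero_of_angSq hp
  have hr0 : ‖(c t).1.1‖ ≠ 0 := norm_ne_zero_iff.2 hy0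
  have hC0 := (ang_pos hp).ne'
  have hy : HasDerivAt (fun t => (c t).1.1) Y.1.1 t := h.fst.fst
  have hw : HasDerivAt (fun t => (c t).2.1) Y.2.1 t := h.snd.fst
  have hσ : HasDerivAt (fun t => (c t).2.2) Y.2.2 t := h.snd.snd
  have hs : HasDerivAt (fun t => (c t).1.2) Y.1.2 t := h.fst.snd
  have hr := hasDerivAt_norm hy hy0
  have hya := hy.inner ℝ (hasDerivAt_const t a)
  have hwa := hw.inner ℝ (hasDerivAt_const t a)
  have hyw := hy.inner ℝ hw
  have hT := hasDerivAt_angMomOn (π := ContinuousLinearMap.id ℝ _) h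
  have hC : HasDerivAt (fun t => ang (c t))
      (angMomOnDeriv (ContinuousLinearMap.id ℝ _) (c t) Y / (2 * ang (c t))) t := hT.sqrt hp.ne'
  have hrC := hr.mul hC
  have hrC0 : ((fun t => ‖(c t).1.1‖) * fun t => ang (c t)) t ≠ 0 := mul_ne_zero hr0 hC0
  have e1 := hya.div hr hr0
  have e2 := (((hr.pow 2).mul hwa).sub (hyw.mul hya)).div hrC hrC0
  have e3 := hs.div hr hr0
  have e4 := ((hσ.mul (hr.pow 2)).sub (hs.mul hyw)).div hrC hrC0
  have e5 := (hasDerivAt_const t m).div hT hp.ne'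
  refine (e1.prodMk (e2.prodMk (e3.prodMk (e4.prodMk e5)))).congr_deriv ?_
  have hC2 := ang_sq (c t)
  change _ = angMomOn _ _ at hC2
  simp only [elementsDeriv, ← hC2]
  simp only [Pi.mul_apply, Pi.sub_apply, Pi.pow_apply, inner_zero_right]
  generalize ang (c t) = C at *
  generalize angMomOnDeriv _ _ _ = T at *
  refine Prod.ext ?_ (Prod.ext ?_ (Prod.ext ?_ (Prod.ext ?_ ?_)))
  all_goals
    simp only
    field_simp
    try push_cast
    try ring

/-- The scalar invariants of a state in terms of the orbital elements. -/
theorem scalars_of_elements {G : Geometry} (m : ℝ) (a : EuclideanSpace ℝ (Fin d)) {p : State d}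
    (hp : p ∈ tangentBundle G d) (hC : 0 < angSq p) {b g u q k r C : ℝ}
    (hr : ‖p.1.1‖ = r) (hCC : ang p = C) (hx : elementsOf m a p = (b, g, u, q, k)) :
    r ≠ 0 ∧ C ≠ 0 ∧ p.1.2 = r * u ∧ p.2.2 = q * C * (1 - u ^ 2 * r ^ 2) / r ∧
    inner ℝ p.1.1 p.1.1 = r ^ 2 ∧ inner ℝ p.1.1 p.2.1 = -(u * q * C * r ^ 2) ∧
    inner ℝ p.2.1 p.2.1 = (u * q * C * r) ^ 2 + C ^ 2 / r ^ 2 ∧ inner ℝ p.1.1 a = r * b ∧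
    inner ℝ p.2.1 a = -(u * q * C * r * b) + C / r * g ∧
    G.curv = (1 - r ^ 2 * u ^ 2) / r ^ 2 ∧ m = k * C ^ 2 := by
  have hr0 : r ≠ 0 := hr ▸ norm_ne_zero_iff.2 (ne_zero_of_angSq hC)
  have hC0 : C ≠ 0 := hCC ▸ (ang_pos hC).ne'
  have h1 := space_sq hp.1
  have h2 : p.1.2 * p.2.2 + G.curv * inner ℝ p.1.1 p.2.1 = 0 := hp.2
  have hT : C ^ 2 = angSq p := hCC ▸ ang_sq p
  have hT2 := angSq_eq p
  simp only [elementsOf, hr, hCC, ← hT, Prod.mk.injEq] at hx hT2 h1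
  obtain ⟨rfl, rfl, rfl, rfl, rfl⟩ := hx
  -- The curvature is eliminated along with the mass. After this substitution every identity between
  -- the elements and their derivatives is one of rational functions in `b, g, u, q, k, r, C`, the
  -- same for all geometries.
  have hκ : G.curv = (1 - p.1.2 ^ 2) / r ^ 2 := by
    field_simp; linarith
  have e1 : inner ℝ p.2.1 p.2.1 = (C ^ 2 + inner ℝ p.1.1 p.2.1 ^ 2) / r ^ 2 := by
    rw [hT2]; field_simp; ring
  have e2 : p.1.2 * (p.2.2 * r ^ 2) = (p.1.2 ^ 2 - 1) * inner ℝ p.1.1 p.2.1 := by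
    rw [hκ] at h2; field_simp at h2; linarith
  have e3 : inner ℝ p.1.1 p.2.1 = -(p.1.2 * (p.2.2 * r ^ 2 - p.1.2 * inner ℝ p.1.1 p.2.1)) := by
    linear_combination e2
  refine ⟨hr0, hC0, by field_simp, ?_, by rw [← norm_sq_eq, hr], ?_, ?_, by field_simp, ?_,
    by rw [hκ]; field_simp, by field_simp⟩
  · field_simp
    linear_combination p.1.2 * e2
  · field_simp
    linear_combination e2
  · rw [e1]
    field_simp
    linear_combination (inner ℝ p.1.1 p.2.1
      - p.1.2 * (p.2.2 * r ^ 2 - p.1.2 * inner ℝ p.1.1 p.2.1)) * e3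
  · field_simp
    linear_combination inner ℝ p.1.1 a * e3

/-- The elements depend only on rotation invariants and on inner products with `a`, all of which are
fixed by rotations that fix `a`. -/
theorem elementsDeriv_hamAngMomOn {π : EuclideanSpace ℝ (Fin d) →L[ℝ] EuclideanSpace ℝ (Fin d)}
    (hπ : IsProj π) {a : EuclideanSpace ℝ (Fin d)} (ha : π a = 0) (m : ℝ) (p : State d) :
    elementsDeriv m a p (hamAngMomOn π p) = 0 := by
  have e : ∀ x, inner ℝ (π x) a = 0 := fun x => by rw [hπ.symm, ha, inner_zero_right]
  have h0 : angMomOnDeriv (ContinuousLinearMap.id ℝ _) p (hamAngMomOn π p) = 0 := by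
    rw [← symp_hamAngMomOn isProj_id .euclidean, symp_swap,
      symp_hamAngMomOn_hamAngMomOn hπ (fun _ => rfl), neg_zero]
  simp only [elementsDeriv, h0]
  simp only [hamAngMomOn, inner_sub_left, inner_sub_right, inner_smul_left,
    inner_smul_right, conj_trivial, e]
  simp only [hπ.symm, hπ.idem]
  refine Prod.ext ?_ (Prod.ext ?_ (Prod.ext ?_ (Prod.ext ?_ ?_)))
  all_goals
    simp only [Prod.fst_zero, Prod.snd_zero]
    ring

namespace TwoCenter

variable (P : TwoCenter d)

/-- The elements rotate with the angular velocity `C / r²`, which is `ang p * qFun u`; the equation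
for `u` and its angular derivative is the Binet equation `u'' + u = k`. -/
theorem elementsDeriv_hamKepler (a : EuclideanSpace ℝ (Fin d)) {p : State d}
    (hp : p ∈ tangentBundle P.geom d) (hC : 0 < angSq p) {b g u q k : ℝ}
    (hx : elementsOf P.mass₁ a p = (b, g, u, q, k)) :
    elementsDeriv P.mass₁ a p (P.hamKepler p) =
      (ang p * P.qFun u) • ((g, -b, q, k - u, 0) : Elements) := by
  have h0 := P.angMomOnDeriv_hamKepler (ContinuousLinearMap.id ℝ _) p
  obtain ⟨r, hr⟩ : ∃ r, ‖p.1.1‖ = r := ⟨_, rfl⟩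
  obtain ⟨C, hCC⟩ : ∃ C, ang p = C := ⟨_, rfl⟩
  obtain ⟨hr0, hC0, h1, h2, h3, h4, h5, h6, h7, h8, h9⟩ :=
    scalars_of_elements P.mass₁ a hp hC hr hCC hx
  simp only [elementsDeriv, h0]
  simp only [hamKepler, inner_smul_left, inner_smul_right, conj_trivial, qFun]
  generalize form P.geom p.2 p.2 = K
  simp only [hr, hCC, h1, h2, h3, h4, h5, h6, h7, h8, h9]
  refine Prod.ext ?_ (Prod.ext ?_ (Prod.ext ?_ (Prod.ext ?_ ?_)))
  all_goals
    simp only [Prod.smul_mk, smul_eq_mul]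
    field_simp
    try ring

/-- Links the abstract direction `elementsDir` to the flow of `D`. The value of `c₀` is the one for
which `timeShift` vanishes at angle `0`: the elements are those of the moved state itself, not of a
later point of its orbit. -/
theorem elementsDeriv_hamD (haxis : ‖P.axis‖ = 1) {p : State d}
    (hp : p ∈ tangentBundle P.geom d) (hC : 0 < angSq p) :
    elementsDeriv P.mass₁ P.axis p (P.hamD p) =
      ang p • P.elementsDir (elementsOf P.mass₁ P.axis p)
        (-(P.geom.sn (2 * P.halfDist) * (elementsOf P.mass₁ P.axis p).1
          * ((elementsOf P.mass₁ P.axis p).2.2.1 + (elementsOf P.mass₁ P.axis p).k))) := by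
  have ha : inner ℝ P.axis P.axis = (1 : ℝ) := by rw [← norm_sq_eq, haxis]; norm_num
  obtain ⟨⟨b, g, u, q, k⟩, hx⟩ : ∃ x, elementsOf P.mass₁ P.axis p = x := ⟨_, rfl⟩
  obtain ⟨r, hr⟩ : ∃ r, ‖p.1.1‖ = r := ⟨_, rfl⟩
  obtain ⟨C, hCC⟩ : ∃ C, ang p = C := ⟨_, rfl⟩
  obtain ⟨hr0, hC0, h1, h2, h3, h4, h5, h6, h7, h8, h9⟩ :=
    scalars_of_elements P.mass₁ P.axis hp hC hr hCC hx
  rw [hx]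
  have h7' : inner ℝ P.axis p.2.1 = -(u * q * C * r * b) + C / r * g := by
    rw [real_inner_comm, h7]
  simp only [elementsDeriv, elementsDir, Elements.J, Elements.k, angMomOnDeriv, hamD, hamAngMomOn,
    hamLrl, ContinuousLinearMap.id_apply, Prod.fst_sub, Prod.snd_sub, Prod.smul_fst,
    Prod.smul_snd, smul_eq_mul, inner_add_left, inner_add_right,
    inner_sub_left, inner_sub_right, inner_smul_left, inner_smul_right, conj_trivial,
    real_inner_comm p.1.1 p.2.1, ha]
  simp only [hr, hCC, h1, h2, h3, h4, h5, h6, h7, h7', h8, h9]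
  generalize P.geom.cs (2 * P.halfDist) = c, P.geom.sn (2 * P.halfDist) = S
  refine Prod.ext ?_ (Prod.ext ?_ (Prod.ext ?_ (Prod.ext ?_ ?_)))
  all_goals
    simp only [Prod.smul_mk, smul_eq_mul]
    field_simp
    try ring

end TwoCenter

/-! ### Kepler orbits in terms of the orbital elements -/

/-- `X² + Y²` is constant. Applied to differences, this is uniqueness for the rotation equations
satisfied by the elements. -/
theorem eq_zero_of_rotation {f X Y : ℝ → ℝ} (hX : ∀ t, HasDerivAt X (f t * Y t) t)
    (hY : ∀ t, HasDerivAt Y (-(f t * X t)) t) (hX0 : X 0 = 0) (hY0 : Y 0 = 0) (t : ℝ) :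
    X t = 0 ∧ Y t = 0 := by
  have hd : ∀ t, HasDerivAt (fun t => X t ^ 2 + Y t ^ 2) 0 t := fun t =>
    (((hX t).pow 2).add ((hY t).pow 2)).congr_deriv (by push_cast; ring)
  have h := is_const_of_deriv_eq_zero (fun t => (hd t).differentiableAt)
    (fun t => (hd t).deriv) t 0
  simp only [hX0, hY0] at h
  constructor <;> nlinarith [sq_nonneg (X t), sq_nonneg (Y t)]

theorem fst_ne_zero_of_ne_center {G : Geometry} {q : Ambient d} (hq : q ∈ space G d)
    (h1 : q ≠ (0, 1)) (h2 : q ≠ -(0, 1)) : q.1 ≠ 0 := by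
  intro h0
  have h := space_sq hq
  rw [h0, norm_zero] at h
  have h3 : (q.2 - 1) * (q.2 + 1) = 0 := by linear_combination h
  rcases mul_eq_zero.1 h3 with h4 | h4
  · exact h1 (Prod.ext h0 (by simpa using sub_eq_zero.1 h4))
  · exact h2 (Prod.ext (by simpa using h0) (by simpa using eq_neg_of_add_eq_zero_left h4))

namespace Elements

theorem continuous_u (x : Elements) : Continuous x.u :=
  continuous_iff_continuousAt.2 fun φ => (x.hasDerivAt_u φ).continuousAt

theorem continuous_b (x : Elements) : Continuous x.b :=
  continuous_iff_continuousAt.2 fun φ => (x.hasDerivAt_b φ).continuousAt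

theorem periodic_u (x : Elements) : Function.Periodic x.u (2 * Real.pi) := fun φ => by
  simp [u]

theorem periodic_b (x : Elements) : Function.Periodic x.b (2 * Real.pi) := fun φ => by
  simp [b]

end Elements

namespace TwoCenter

variable {P : TwoCenter d}

theorem qFun_eq {p : State d} (hp : p ∈ tangentBundle P.geom d) (hy : p.1.1 ≠ 0) :
    P.qFun (p.1.2 / ‖p.1.1‖) = 1 / ‖p.1.1‖ ^ 2 := by
  have h := space_sq hp.1
  have hr : ‖p.1.1‖ ≠ 0 := norm_ne_zero_iff.2 hy
  rw [qFun]
  field_simp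
  linarith

theorem IsKeplerOrbit.fst_ne_zero {γ : ℝ → State d} (h : P.IsKeplerOrbit γ) (t : ℝ) :
    (γ t).1.1 ≠ 0 :=
  fst_ne_zero_of_ne_center (h t).1.1 (h t).2.1 (h t).2.2.1

theorem IsKeplerOrbit.hasDerivAt (haxis : ‖P.axis‖ = 1) {γ : ℝ → State d}
    (h : P.IsKeplerOrbit γ) (t : ℝ) : HasDerivAt γ (P.hamKepler (γ t)) t := by
  obtain ⟨h1, -, -, X, hX, hd⟩ := h t
  rwa [← hX.unique h1 (P.isHamiltonianVector_kepler haxis h1 (h.fst_ne_zero t))]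

theorem IsKeplerOrbit.angSq_eq (haxis : ‖P.axis‖ = 1) {γ : ℝ → State d}
    (h : P.IsKeplerOrbit γ) (t : ℝ) : angSq (γ t) = angSq (γ 0) := by
  have hd : ∀ t, HasDerivAt (fun t => angSq (γ t)) 0 t := fun t =>
    (hasDerivAt_angMomOn (h.hasDerivAt haxis t)).congr_deriv (P.angMomOnDeriv_hamKepler _ _)
  exact is_const_of_deriv_eq_zero (fun t => (hd t).differentiableAt) (fun t => (hd t).deriv) t 0

/-- Along a Kepler orbit, the elements rotate. -/
theorem IsKeplerOrbit.exists_angle (haxis : ‖P.axis‖ = 1) {γ : ℝ → State d}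
    (h : P.IsKeplerOrbit γ) (hC : 0 < angSq (γ 0)) :
    ∃ φ : ℝ → ℝ, φ 0 = 0 ∧ (∀ t, HasDerivAt φ (ang (γ 0) / ‖(γ t).1.1‖ ^ 2) t) ∧
      ∀ a t, (elementsOf P.mass₁ a (γ t)).1 = (elementsOf P.mass₁ a (γ 0)).b (φ t) ∧
        (elementsOf P.mass₁ a (γ t)).2.2.1 = (elementsOf P.mass₁ a (γ 0)).u (φ t) := by
  have hγ := h.hasDerivAt haxis
  have hcont : Continuous fun t => ang (γ 0) / ‖(γ t).1.1‖ ^ 2 := by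
    have h1 : Continuous γ := continuous_iff_continuousAt.2 fun t => (hγ t).continuousAt
    exact continuous_const.div (by fun_prop)
      fun t => pow_ne_zero 2 (norm_ne_zero_iff.2 (h.fst_ne_zero t))
  have hφ : ∀ t, HasDerivAt (fun t => ∫ τ in (0 : ℝ)..t, ang (γ 0) / ‖(γ τ).1.1‖ ^ 2)
      (ang (γ 0) / ‖(γ t).1.1‖ ^ 2) t := fun t =>
    intervalIntegral.integral_hasDerivAt_right (hcont.intervalIntegrable _ _)
      (hcont.stronglyMeasurableAtFilter _ _) hcont.continuousAt
  generalize hφdef : (fun t => ∫ τ in (0 : ℝ)..t, ang (γ 0) / ‖(γ τ).1.1‖ ^ 2) = φ at hφ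
  have hφ0 : φ 0 = 0 := by rw [← hφdef]; simp
  refine ⟨φ, hφ0, hφ, fun a => ?_⟩
  have hA : ∀ t, angSq (γ t) = angSq (γ 0) := h.angSq_eq haxis
  have hk : ∀ t, (elementsOf P.mass₁ a (γ t)).2.2.2.2 = (elementsOf P.mass₁ a (γ 0)).k := by
    intro t
    simp only [elementsOf, Elements.k, hA t]
  have hE : ∀ t, HasDerivAt (fun t => elementsOf P.mass₁ a (γ t))
      ((ang (γ 0) / ‖(γ t).1.1‖ ^ 2) • (((elementsOf P.mass₁ a (γ t)).2.1,
        -(elementsOf P.mass₁ a (γ t)).1, (elementsOf P.mass₁ a (γ t)).2.2.2.1,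
        (elementsOf P.mass₁ a (γ 0)).k - (elementsOf P.mass₁ a (γ t)).2.2.1, 0) : Elements)) t := by
    intro t
    have hCt : 0 < angSq (γ t) := (hA t).symm ▸ hC
    refine (hasDerivAt_elementsOf P.mass₁ a (hγ t) hCt).congr_deriv ?_
    rw [P.elementsDeriv_hamKepler a (h t).1 hCt rfl]
    have hs : ang (γ t) * P.qFun ((γ t).1.2 / ‖(γ t).1.1‖) = ang (γ 0) / ‖(γ t).1.1‖ ^ 2 := by
      rw [qFun_eq (h t).1 (h.fst_ne_zero t), mul_one_div]
      simp only [ang, hA t]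
    rw [hs, ← hk t]
    rfl
  set x := elementsOf P.mass₁ a (γ 0) with hx
  have e1 : ∀ t, HasDerivAt (fun t => (elementsOf P.mass₁ a (γ t)).1) _ t := fun t => (hE t).fst
  have e2 : ∀ t, HasDerivAt (fun t => (elementsOf P.mass₁ a (γ t)).2.1) _ t := fun t =>
    (hE t).snd.fst
  have e3 : ∀ t, HasDerivAt (fun t => (elementsOf P.mass₁ a (γ t)).2.2.1) _ t := fun t =>
    (hE t).snd.snd.fst
  have e4 : ∀ t, HasDerivAt (fun t => (elementsOf P.mass₁ a (γ t)).2.2.2.1) _ t := fun t =>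
    (hE t).snd.snd.snd.fst
  have f1 : ∀ t, HasDerivAt (fun t => x.b (φ t)) _ t := fun t =>
    (x.hasDerivAt_b _).comp t (hφ t)
  have f2 : ∀ t, HasDerivAt (fun t => x.g (φ t)) _ t := fun t =>
    (x.hasDerivAt_g _).comp t (hφ t)
  have f3 : ∀ t, HasDerivAt (fun t => x.u (φ t)) _ t := fun t =>
    (x.hasDerivAt_u _).comp t (hφ t)
  have f4 : ∀ t, HasDerivAt (fun t => x.p (φ t)) _ t := fun t =>
    (x.hasDerivAt_p _).comp t (hφ t)
  intro t
  constructor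
  · have := eq_zero_of_rotation (f := fun t => ang (γ 0) / ‖(γ t).1.1‖ ^ 2)
      (X := fun t => (elementsOf P.mass₁ a (γ t)).1 - x.b (φ t))
      (Y := fun t => (elementsOf P.mass₁ a (γ t)).2.1 - x.g (φ t))
      (fun t => ((e1 t).sub (f1 t)).congr_deriv (by
        simp only [Prod.smul_mk, smul_eq_mul]; ring))
      (fun t => ((e2 t).sub (f2 t)).congr_deriv (by
        simp only [Prod.smul_mk, smul_eq_mul]; ring))
      (by simp [hφ0, Elements.b, hx]) (by simp [hφ0, Elements.g, hx]) t
    exact sub_eq_zero.1 this.1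
  · have := eq_zero_of_rotation (f := fun t => ang (γ 0) / ‖(γ t).1.1‖ ^ 2)
      (X := fun t => (elementsOf P.mass₁ a (γ t)).2.2.1 - x.u (φ t))
      (Y := fun t => (elementsOf P.mass₁ a (γ t)).2.2.2.1 - x.p (φ t))
      (fun t => ((e3 t).sub (f3 t)).congr_deriv (by
        simp only [Prod.smul_mk, smul_eq_mul]; ring))
      (fun t => ((e4 t).sub (f4 t)).congr_deriv (by
        simp only [Prod.smul_mk, smul_eq_mul]; ring))
      (by simp [hφ0, Elements.u, hx]) (by simp [hφ0, Elements.p, hx]) t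
    exact sub_eq_zero.1 this.1

/-- A period of a Kepler orbit corresponds to a number of full turns. -/
theorem exists_turns {γ : ℝ → State d}
    (h : P.IsKeplerOrbit γ) (hC : 0 < angSq (γ 0)) {T : ℝ} (hT : 0 < T)
    (hper : Function.Periodic γ T) {φ : ℝ → ℝ} (hφ0 : φ 0 = 0)
    (hφ : ∀ t, HasDerivAt φ (ang (γ 0) / ‖(γ t).1.1‖ ^ 2) t)
    (hb : ∀ a t, (elementsOf P.mass₁ a (γ t)).1 = (elementsOf P.mass₁ a (γ 0)).b (φ t)) :
    ∃ n : ℕ, φ T = (n + 1) * (2 * Real.pi) := by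
  have hmono : StrictMono φ := strictMono_of_deriv_pos fun t => by
    rw [(hφ t).deriv]
    have := norm_pos_iff.2 (h.fst_ne_zero t)
    have := ang_pos hC
    positivity
  have hpos : 0 < φ T := hφ0 ▸ hmono hT
  -- With the initial position in place of the axis, the radial element at time `t` is `‖y(0)‖ cos
  -- (φ t)`, so a return to the initial state forces `cos (φ T) = 1`.
  have h1 := hb (γ 0).1.1 T
  have hγT : γ T = γ 0 := by simpa using hper 0
  rw [hγT] at h1
  have hr := norm_pos_iff.2 (h.fst_ne_zero 0)
  have h2 : (elementsOf P.mass₁ (γ 0).1.1 (γ 0)).1 = ‖(γ 0).1.1‖ := by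
    simp only [elementsOf, ← norm_sq_eq]; field_simp
  have h3 : (elementsOf P.mass₁ (γ 0).1.1 (γ 0)).2.1 = 0 := by
    simp only [elementsOf, ← norm_sq_eq, real_inner_comm (γ 0).1.1 (γ 0).2.1]
    rw [mul_comm, sub_self, zero_div]
  rw [Elements.b, h2, h3, zero_mul, add_zero] at h1
  have h4 : Real.cos (φ T) = 1 := by
    have : ‖(γ 0).1.1‖ * (Real.cos (φ T) - 1) = 0 := by linarith
    rcases mul_eq_zero.1 this with h | h
    · exact absurd h hr.ne'
    · linarith
  obtain ⟨n, hn⟩ := (Real.cos_eq_one_iff _).1 h4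
  have hn0 : 0 < n := by
    have h5 : (0 : ℝ) < n * (2 * Real.pi) := hn ▸ hpos
    have : (0 : ℝ) < n := by
      by_contra hle
      have := mul_nonpos_of_nonpos_of_nonneg (not_lt.1 hle) (by positivity : 0 ≤ 2 * Real.pi)
      linarith
    exact_mod_cast this
  refine ⟨(n - 1).toNat, ?_⟩
  have h6 : (((n - 1).toNat : ℤ) : ℝ) = ((n - 1 : ℤ) : ℝ) := by
    rw [Int.toNat_of_nonneg (by omega)]
  rw [← hn]
  push_cast at h6
  rw [h6]; ring

/-! ### Construction of closed Kepler orbits -/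

/-- An autonomous scalar equation with a positive periodic right hand side. -/
theorem exists_angle_solution {F : ℝ → ℝ} {p M : ℝ} (hc : Continuous F) (hpos : ∀ x, 0 < F x)
    (hM : ∀ x, F x ≤ M) (hp : 0 < p) (hper : Function.Periodic F p) :
    ∃ (φ : ℝ → ℝ) (T : ℝ), 0 < T ∧ φ 0 = 0 ∧ (∀ t, HasDerivAt φ (F (φ t)) t) ∧
      ∀ t, φ (t + T) = φ t + p := by
  have hMpos : 0 < M := (hpos 0).trans_le (hM 0)
  have hcont : Continuous fun x => (F x)⁻¹ := hc.inv₀ fun x => (hpos x).ne'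
  -- Separation of variables: `τ` is the time as a function of the angle, and the solution is its
  -- inverse. The upper bound on `F` makes `τ` grow at least linearly, hence surjective, so the
  -- solution exists for all times.
  set τ : ℝ → ℝ := fun x => ∫ ξ in (0 : ℝ)..x, (F ξ)⁻¹ with hτ
  have hd : ∀ x, HasDerivAt τ (F x)⁻¹ x := fun x =>
    intervalIntegral.integral_hasDerivAt_right (hcont.intervalIntegrable _ _)
      (hcont.stronglyMeasurableAtFilter _ _) hcont.continuousAt
  have hτ0 : τ 0 = 0 := by simp [hτ]
  have hmono : StrictMono τ := strictMono_of_deriv_pos fun x => by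
    rw [(hd x).deriv]; exact inv_pos.2 (hpos x)
  have hτc : Continuous τ := continuous_iff_continuousAt.2 fun x => (hd x).continuousAt
  have hmono2 : Monotone fun x => τ x - M⁻¹ * x := by
    have hd2 : ∀ x, HasDerivAt (fun x => τ x - M⁻¹ * x) ((F x)⁻¹ - M⁻¹ * 1) x := fun x =>
      (hd x).sub ((hasDerivAt_id x).const_mul M⁻¹)
    refine monotone_of_deriv_nonneg (fun x => (hd2 x).differentiableAt) fun x => ?_
    rw [(hd2 x).deriv, mul_one, sub_nonneg]
    exact inv_anti₀ (hpos x) (hM x)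
  have hMi : 0 < M⁻¹ := inv_pos.2 hMpos
  have hsurj : Function.Surjective τ := by
    refine hτc.surjective ?_ ?_
    · refine tendsto_atTop_mono' atTop ?_ (tendsto_id.const_mul_atTop hMi)
      filter_upwards [eventually_ge_atTop 0] with x hx
      have := hmono2 hx
      simp only [hτ0, mul_zero, sub_zero] at this
      simpa using this
    · refine tendsto_atBot_mono' atBot ?_ (tendsto_id.const_mul_atBot hMi)
      filter_upwards [eventually_le_atBot 0] with x hx
      have := hmono2 hx
      simp only [hτ0, mul_zero, sub_zero] at this
      simpa using this
  set e := hmono.orderIsoOfSurjective τ hsurj with he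
  have hes : ∀ t, τ (e.symm t) = t := fun t => e.apply_symm_apply t
  have hse : ∀ x, e.symm (τ x) = x := fun x => e.symm_apply_apply x
  have hshift : ∀ x, τ (x + p) = τ x + τ p := by
    intro x
    have hi : Function.Periodic (fun x => (F x)⁻¹) p := fun x => by simp only [hper x]
    have h1 := hi.intervalIntegral_add_eq x 0
    rw [zero_add] at h1
    simp only [hτ]
    rw [← h1, intervalIntegral.integral_add_adjacent_intervals (hcont.intervalIntegrable _ _)
      (hcont.intervalIntegrable _ _)]
  refine ⟨e.symm, τ p, hτ0 ▸ hmono hp, ?_, fun t => ?_, fun t => ?_⟩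
  · conv_lhs => rw [← hτ0]
    exact hse 0
  · have := (hd (e.symm t)).of_local_left_inverse e.symm.continuous.continuousAt
      (inv_ne_zero (hpos _).ne') (Eventually.of_forall hes)
    simpa using this
  · rw [← hse (e.symm t + p), hshift, hes]

end TwoCenter

/-! ### The closed Kepler orbits -/

namespace TwoCenter

variable {P : TwoCenter d}

variable (P) in
/-- The elements of orbits that stay in the space form. -/
def closedElements : Set Elements :=
  {x | ∀ φ : ℝ, 0 < P.qFun (x.u φ) ∧ (P.geom ≠ .spherical → 0 < x.u φ)}

/-- Periodicity in the angle. The condition on a compact interval is the one that is visibly open in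
the elements; the condition for all angles is the one used along orbits. -/
theorem mem_goodElements_iff {x : Elements} : x ∈ P.goodElements ↔
    x ∈ P.closedElements ∧ ∀ φ : ℝ, 0 < P.denSq (x.b φ) (x.u φ) := by
  constructor
  · intro h
    have key : ∀ φ : ℝ, (x, φ) ∈ P.goodPairs := by
      intro φ
      have hper : Function.Periodic (fun φ => (x.b φ, x.u φ)) (2 * Real.pi) := fun φ => by
        simp only [x.periodic_b φ, x.periodic_u φ]
      obtain ⟨ψ, hψ, he⟩ := hper.exists_mem_Ico₀ (by positivity) φ
      simp only [Prod.mk.injEq] at he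
      have := h ψ (by rw [uIcc_of_le (by positivity)]; exact Ico_subset_Icc_self hψ)
      simpa only [goodPairs, mem_ofPred_eq, he.1, he.2] using this
    exact ⟨fun φ => ⟨(key φ).1, (key φ).2.1⟩, fun φ => (key φ).2.2⟩
  · exact fun h φ _ => ⟨(h.1 φ).1, (h.1 φ).2, h.2 φ⟩

theorem sn_two_halfDist_ne_zero (hdist : 0 < P.halfDist)
    (hsph : P.geom = .spherical → P.halfDist < Real.pi / 2) :
    P.geom.sn (2 * P.halfDist) ≠ 0 := by
  cases h : P.geom with
  | euclidean => simp only [Geometry.sn]; positivity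
  | spherical =>
    exact (Real.sin_pos_of_pos_of_lt_pi (by positivity) (by linarith [hsph h])).ne'
  | hyperbolic => exact (Real.sinh_pos_iff.2 (by positivity)).ne'

theorem denSq_mul (y : EuclideanSpace ℝ (Fin d)) (hy : y ≠ 0) (s : ℝ) :
    P.denSq (inner ℝ y P.axis / ‖y‖) (s / ‖y‖) * ‖y‖ ^ 2 =
      ‖y‖ ^ 2 - inner ℝ y P.axis ^ 2 + (P.geom.cs (2 * P.halfDist) * inner ℝ y P.axis
          - P.geom.sn (2 * P.halfDist) * s) ^ 2 := by
  have hr : ‖y‖ ≠ 0 := norm_ne_zero_iff.2 hy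
  simp only [denSq]
  field_simp

/-- The denominator is a sum of two nonnegative terms. If both vanish, the point lies on the axis
and its axial component `α` satisfies `cs(2h) α = sn(2h) s`; the equation of the space form then
gives `α = ± sn(2h)`. -/
theorem denSq_pos_iff (haxis : ‖P.axis‖ = 1) (hS : P.geom.sn (2 * P.halfDist) ≠ 0)
    {q : Ambient d} (hq : q ∈ space P.geom d) (hy : q.1 ≠ 0) :
    0 < P.denSq (inner ℝ q.1 P.axis / ‖q.1‖) (q.2 / ‖q.1‖) ↔
      q ≠ P.center₂ ∧ q ≠ -P.center₂ := by
  have hr : 0 < ‖q.1‖ ^ 2 := pow_pos (norm_pos_iff.2 hy) 2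
  rw [← mul_pos_iff_of_pos_right hr, denSq_mul _ hy]
  have hρ := rho_sq_nonneg (y := q.1) haxis
  have h0 := P.geom.cs_sq_add (2 * P.halfDist)
  have h1 := space_sq hq
  have ha : inner ℝ P.axis P.axis = (1 : ℝ) := by rw [← norm_sq_eq, haxis]; norm_num
  constructor
  · intro h
    constructor <;> rintro rfl
    all_goals
      simp only [center₂, Prod.fst_neg, Prod.snd_neg, norm_neg, inner_neg_left, norm_smul, haxis,
        mul_one, inner_smul_left, conj_trivial, ha, Real.norm_eq_abs, sq_abs] at h
      ring_nf at h
      exact lt_irrefl _ h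
  · intro h
    by_contra hle
    have e1 : ‖q.1‖ ^ 2 = inner ℝ q.1 P.axis ^ 2 := by
      nlinarith [sq_nonneg (P.geom.cs (2 * P.halfDist) * inner ℝ q.1 P.axis
        - P.geom.sn (2 * P.halfDist) * q.2)]
    have e2 : P.geom.cs (2 * P.halfDist) * inner ℝ q.1 P.axis
        = P.geom.sn (2 * P.halfDist) * q.2 := by
      have : (P.geom.cs (2 * P.halfDist) * inner ℝ q.1 P.axis
        - P.geom.sn (2 * P.halfDist) * q.2) ^ 2 = 0 :=
          le_antisymm (by linarith) (sq_nonneg _)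
      exact sub_eq_zero.1 (pow_eq_zero_iff two_ne_zero |>.1 this)
    have e3 : q.1 = (inner ℝ q.1 P.axis : ℝ) • P.axis := by
      rw [← sub_eq_zero, ← norm_eq_zero, ← pow_eq_zero_iff two_ne_zero, norm_sub_sq_real,
        norm_smul, inner_smul_right, haxis, e1, mul_one, Real.norm_eq_abs, sq_abs]
      ring
    set α : ℝ := inner ℝ q.1 P.axis
    set c := P.geom.cs (2 * P.halfDist)
    set S := P.geom.sn (2 * P.halfDist)
    rw [e1] at h1
    have e4 : (α - S) * (α + S) = 0 := by
      linear_combination S ^ 2 * h1 + (c * α + S * q.2) * e2 - α ^ 2 * h0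
    rcases mul_eq_zero.1 e4 with e5 | e5
    · have e6 : α = S := sub_eq_zero.1 e5
      refine h.1 (Prod.ext (by rw [e3, e6]; rfl) (mul_left_cancel₀ hS ?_))
      rw [← e2, e6, mul_comm]; rfl
    · have e6 : α = -S := eq_neg_of_add_eq_zero_left e5
      refine h.2 (Prod.ext ?_ (mul_left_cancel₀ hS ?_))
      · rw [e3, e6, neg_smul]; rfl
      · rw [← e2, e6]; simp only [center₂, Prod.snd_neg]; ring

theorem potential_eq_potFun (haxis : ‖P.axis‖ = 1) (m : ℝ) {q : Ambient d}
    (hq : q ∈ space P.geom d) (hy : q.1 ≠ 0) : P.potential m P.center₂ q =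
      -(m * P.potFun (inner ℝ q.1 P.axis / ‖q.1‖) (q.2 / ‖q.1‖)) := by
  have hr : 0 < ‖q.1‖ := norm_pos_iff.2 hy
  rw [P.potential_center₂ haxis m hq, ← denSq_mul _ hy, Real.sqrt_mul' _ (sq_nonneg _),
    Real.sqrt_sq hr.le, potFun, numFun]
  congr 2
  have e : P.geom.cs (2 * P.halfDist) * (q.2 / ‖q.1‖) + P.geom.curv * P.geom.sn (2 * P.halfDist)
      * (inner ℝ q.1 P.axis / ‖q.1‖) = (P.geom.cs (2 * P.halfDist) * q.2
        + P.geom.curv * (P.geom.sn (2 * P.halfDist) * inner ℝ q.1 P.axis)) / ‖q.1‖ := by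
    field_simp
  rw [e, div_div, mul_comm ‖q.1‖]

/-- The angle covers all values if the orbit is periodic. -/
theorem exists_angle_of_periodic {γ : ℝ → State d}
    (h : P.IsKeplerOrbit γ) (hC : 0 < angSq (γ 0)) {T : ℝ} (hT : 0 < T)
    (hper : Function.Periodic γ T) {φ : ℝ → ℝ} (hφ0 : φ 0 = 0)
    (hφ : ∀ t, HasDerivAt φ (ang (γ 0) / ‖(γ t).1.1‖ ^ 2) t)
    (hb : ∀ a t, (elementsOf P.mass₁ a (γ t)).1 = (elementsOf P.mass₁ a (γ 0)).b (φ t))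
    (hu : ∀ a t, (elementsOf P.mass₁ a (γ t)).2.2.1 = (elementsOf P.mass₁ a (γ 0)).u (φ t))
    (ψ : ℝ) : ∃ t, (elementsOf P.mass₁ P.axis (γ 0)).b ψ = inner ℝ (γ t).1.1 P.axis / ‖(γ t).1.1‖ ∧
      (elementsOf P.mass₁ P.axis (γ 0)).u ψ = (γ t).1.2 / ‖(γ t).1.1‖ := by
  set x := elementsOf P.mass₁ P.axis (γ 0) with hx
  have hper' : Function.Periodic (fun φ => (x.b φ, x.u φ)) (2 * Real.pi) := fun φ => by
    simp only [x.periodic_b φ, x.periodic_u φ]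
  obtain ⟨ψ', hψ, he⟩ := hper'.exists_mem_Ico₀ (by positivity) ψ
  simp only [Prod.mk.injEq] at he
  obtain ⟨n, hn⟩ := exists_turns h hC hT hper hφ0 hφ hb
  have hc : ContinuousOn φ (Icc 0 T) := fun t _ => (hφ t).continuousAt.continuousWithinAt
  -- During one period the angle increases by at least `2π`, so it passes through every reduced
  -- angle.
  obtain ⟨t, -, ht⟩ := intermediate_value_Icc hT.le hc (show ψ' ∈ Icc (φ 0) (φ T) by
    rw [hφ0, hn]
    refine ⟨hψ.1, hψ.2.le.trans ?_⟩
    nlinarith [Real.pi_pos, (Nat.cast_nonneg n : (0 : ℝ) ≤ n)])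
  refine ⟨t, ?_, ?_⟩
  · rw [he.1, ← ht, ← hb]; rfl
  · rw [he.2, ← ht, ← hu]; rfl

theorem IsKeplerOrbit.closed_of_periodic (haxis : ‖P.axis‖ = 1) {γ : ℝ → State d}
    (h : P.IsKeplerOrbit γ) (hC : 0 < angSq (γ 0)) {T : ℝ} (hT : 0 < T)
    (hper : Function.Periodic γ T) : elementsOf P.mass₁ P.axis (γ 0) ∈ P.closedElements := by
  obtain ⟨φ, hφ0, hφ, hE⟩ := h.exists_angle haxis hC
  intro ψ
  obtain ⟨t, -, ht⟩ := exists_angle_of_periodic h hC hT hper hφ0 hφ (fun a t => (hE a t).1)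
    (fun a t => (hE a t).2) ψ
  have hr := norm_pos_iff.2 (h.fst_ne_zero t)
  rw [ht]
  refine ⟨?_, fun hG => div_pos ((h t).1.1.2 hG) hr⟩
  rw [qFun_eq (h t).1 (h.fst_ne_zero t)]
  positivity

/-- An orbit with good elements does not meet the second center. -/
theorem IsKeplerOrbit.ne_center₂ (haxis : ‖P.axis‖ = 1) (hS : P.geom.sn (2 * P.halfDist) ≠ 0)
    {γ : ℝ → State d} (h : P.IsKeplerOrbit γ) (hC : 0 < angSq (γ 0))
    (hx : elementsOf P.mass₁ P.axis (γ 0) ∈ P.goodElements) (t : ℝ) :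
    (γ t).1 ≠ P.center₂ ∧ (γ t).1 ≠ -P.center₂ := by
  obtain ⟨φ, hφ0, hφ, hE⟩ := h.exists_angle haxis hC
  have := (mem_goodElements_iff.1 hx).2 (φ t)
  rw [← (hE P.axis t).1, ← (hE P.axis t).2] at this
  exact (denSq_pos_iff haxis hS (h t).1.1 (h.fst_ne_zero t)).1 this

/-- A periodic orbit that does not meet the second center has good elements. -/
theorem IsKeplerOrbit.good_of_periodic (haxis : ‖P.axis‖ = 1)
    (hS : P.geom.sn (2 * P.halfDist) ≠ 0) {γ : ℝ → State d}
    (h : P.IsKeplerOrbit γ) (hC : 0 < angSq (γ 0)) {T : ℝ} (hT : 0 < T)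
    (hper : Function.Periodic γ T)
    (hne : ∀ t, (γ t).1 ≠ P.center₂ ∧ (γ t).1 ≠ -P.center₂) :
    elementsOf P.mass₁ P.axis (γ 0) ∈ P.goodElements := by
  refine mem_goodElements_iff.2 ⟨h.closed_of_periodic haxis hC hT hper, fun ψ => ?_⟩
  obtain ⟨φ, hφ0, hφ, hE⟩ := h.exists_angle haxis hC
  obtain ⟨t, ht, ht'⟩ := exists_angle_of_periodic h hC hT hper hφ0 hφ
    (fun a t => (hE a t).1) (fun a t => (hE a t).2) ψ
  rw [ht, ht']
  exact (denSq_pos_iff haxis hS (h t).1.1 (h.fst_ne_zero t)).2 (hne t)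

/-- The time average of the potential of the second center over a closed orbit. -/
theorem IsKeplerOrbit.average_eq (haxis : ‖P.axis‖ = 1) {γ : ℝ → State d}
    (h : P.IsKeplerOrbit γ) (hC : 0 < angSq (γ 0)) {T : ℝ} (hT : 0 < T)
    (hper : Function.Periodic γ T) (hx : elementsOf P.mass₁ P.axis (γ 0) ∈ P.goodElements) :
    T⁻¹ * ∫ t in (0 : ℝ)..T, P.potential P.mass₂ P.center₂ (γ t).1 =
      -(P.mass₂ * P.orbitAverage (elementsOf P.mass₁ P.axis (γ 0))) := by
  obtain ⟨φ, hφ0, hφ, hE⟩ := h.exists_angle haxis hC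
  obtain ⟨n, hn⟩ := exists_turns h hC hT hper hφ0 hφ (fun a t => (hE a t).1)
  have hI := P.integral_weight_pos hx
  obtain ⟨hcl, hden⟩ := mem_goodElements_iff.1 hx
  set x := elementsOf P.mass₁ P.axis (γ 0) with hxdef
  have hC' := ang_pos hC
  have hγc : Continuous γ :=
    continuous_iff_continuousAt.2 fun t => (h.hasDerivAt haxis t).continuousAt
  have hc' : Continuous fun t => ang (γ 0) / ‖(γ t).1.1‖ ^ 2 :=
    continuous_const.div (by fun_prop)
      fun t => pow_ne_zero 2 (norm_ne_zero_iff.2 (h.fst_ne_zero t))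
  have hwc : Continuous fun ψ => P.weight (x, ψ) := by
    have h1 := x.continuous_u
    refine continuous_const.div ?_ fun ψ => (hcl ψ).1.ne'
    simp only [qFun]; fun_prop
  have hpc : Continuous fun ψ => P.weightedPot (x, ψ) := by
    have h1 := x.continuous_u
    have h2 := x.continuous_b
    refine Continuous.mul (Continuous.div ?_ ?_ fun ψ => (Real.sqrt_pos.2 (hden ψ)).ne') hwc
    · simp only [numFun]; fun_prop
    · simp only [denSq]; fun_prop
  -- The substitution `ψ = φ t` turns time integrals over a period into integrals over `n + 1` full
  -- turns. The same factor occurs in the period itself and cancels in the average.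
  have sub : ∀ f : ℝ → ℝ, Continuous f → Function.Periodic f (2 * Real.pi) →
      ∫ t in (0 : ℝ)..T, f (φ t) * (ang (γ 0) / ‖(γ t).1.1‖ ^ 2) =
        (n + 1) * ∫ ψ in (0 : ℝ)..2 * Real.pi, f ψ := by
    intro f hf hfp
    have h1 := intervalIntegral.integral_comp_mul_deriv (a := 0) (b := T) (fun t _ => hφ t)
      hc'.continuousOn hf
    simp only [Function.comp_apply] at h1
    have h2 := hfp.intervalIntegral_add_zsmul_eq (n + 1) 0 (fun _ _ => hf.intervalIntegrable _ _)
    simp only [zero_add, zsmul_eq_mul] at h2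
    push_cast at h2
    rw [h1, hφ0, hn, h2]
  have hQ : ∀ t, P.qFun (x.u (φ t)) = 1 / ‖(γ t).1.1‖ ^ 2 := fun t => by
    rw [← (hE P.axis t).2]; exact qFun_eq (h t).1 (h.fst_ne_zero t)
  have e1 := sub _ hwc fun ψ => by simp only [weight, x.periodic_u ψ]
  have e2 := sub _ hpc fun ψ => by simp only [weightedPot, x.periodic_u ψ, x.periodic_b ψ]
  have e3 : ∀ t, P.weight (x, φ t) * (ang (γ 0) / ‖(γ t).1.1‖ ^ 2) = ang (γ 0) := fun t => by
    have hr := norm_ne_zero_iff.2 (h.fst_ne_zero t)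
    simp only [weight, hQ t]
    field_simp
  have e4 : ∀ t, P.potential P.mass₂ P.center₂ (γ t).1 = -(P.mass₂ / ang (γ 0)) *
      (P.weightedPot (x, φ t) * (ang (γ 0) / ‖(γ t).1.1‖ ^ 2)) := fun t => by
    have hr := norm_ne_zero_iff.2 (h.fst_ne_zero t)
    rw [potential_eq_potFun haxis _ (h t).1.1 (h.fst_ne_zero t)]
    simp only [weightedPot, hQ t]
    rw [← (hE P.axis t).1, ← (hE P.axis t).2]
    simp only [elementsOf]
    field_simp
  simp only [e3, intervalIntegral.integral_const, smul_eq_mul, sub_zero] at e1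
  simp only [e4, intervalIntegral.integral_const_mul, e2]
  have hT' : T = (n + 1) * (∫ ψ in (0 : ℝ)..2 * Real.pi, P.weight (x, ψ)) / ang (γ 0) := by
    rw [← e1]; field_simp
  rw [hT', orbitAverage]
  have hn0 : (n : ℝ) + 1 ≠ 0 := by positivity
  have := hI.ne'
  field_simp

end TwoCenter

/-! ### Construction of closed Kepler orbits from orbital elements -/

namespace TwoCenter

variable {P : TwoCenter d}

variable (P) in
/-- The state at distance `ρ` in the direction `e`, with the elements `u`, `q`, the angular
momentum `C`, and the angular direction `f`. -/
def orbitState (e f : EuclideanSpace ℝ (Fin d)) (ρ u q C : ℝ) : State d :=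
  ((ρ • e, ρ * u), (-(u * q * C * ρ) • e + (C / ρ) • f, P.geom.curv * q * C * ρ))

theorem orbitState_mem {e f : EuclideanSpace ℝ (Fin d)} {ρ u q C : ℝ}
    (he : inner ℝ e e = (1 : ℝ)) (hef : inner ℝ e f = (0 : ℝ)) (hρ : 0 < ρ)
    (hQ : ρ ^ 2 * P.qFun u = 1) (hu : P.geom ≠ .spherical → 0 < u) :
    P.orbitState e f ρ u q C ∈ tangentBundle P.geom d := by
  rw [qFun] at hQ
  refine ⟨⟨?_, fun hG => mul_pos hρ (hu hG)⟩, ?_⟩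
  · simp only [orbitState, norm_sq_eq, inner_smul_left, inner_smul_right, he, conj_trivial]
    linear_combination hQ
  · simp only [orbitState, tangent, mem_ofPred_eq, inner_smul_left, inner_smul_right,
      inner_add_right, he, hef, conj_trivial]
    ring

theorem form_orbitState {e f : EuclideanSpace ℝ (Fin d)} {ρ u q C : ℝ}
    (he : inner ℝ e e = (1 : ℝ)) (hef : inner ℝ e f = (0 : ℝ)) (hf : inner ℝ f f = (1 : ℝ))
    (hρ : 0 < ρ) (hQ : ρ ^ 2 * P.qFun u = 1) :
    form P.geom (P.orbitState e f ρ u q C).2 (P.orbitState e f ρ u q C).2 =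
      q ^ 2 * C ^ 2 + C ^ 2 / ρ ^ 2 := by
  rw [qFun] at hQ
  have hfe : inner ℝ f e = (0 : ℝ) := by rw [real_inner_comm, hef]
  simp only [form, orbitState, inner_smul_left, inner_smul_right, inner_add_left,
      inner_add_right, he, hef, hf, hfe, conj_trivial]
  have h3 := P.geom.curv_pow_three
  field_simp
  linear_combination q ^ 2 * C ^ 2 * ρ ^ 2 * hQ + q ^ 2 * C ^ 2 * ρ ^ 4 * h3

/-- The orbit in terms of the angle solves the Kepler problem up to the time change. -/
theorem hasDerivAt_orbitState {e f : ℝ → EuclideanSpace ℝ (Fin d)} {ρ u q : ℝ → ℝ} {C k φ : ℝ}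
    (hC : 0 < C) (hm : P.mass₁ = k * C ^ 2)
    (he : inner ℝ (e φ) (e φ) = (1 : ℝ)) (hef : inner ℝ (e φ) (f φ) = (0 : ℝ))
    (hf : inner ℝ (f φ) (f φ) = (1 : ℝ)) (hρ : 0 < ρ φ) (hQ : ρ φ ^ 2 * P.qFun (u φ) = 1)
    (de : HasDerivAt e (f φ) φ) (df : HasDerivAt f (-e φ) φ)
    (du : HasDerivAt u (q φ) φ) (dq : HasDerivAt q (k - u φ) φ)
    (dρ : HasDerivAt ρ (-(ρ φ ^ 3 * u φ * q φ)) φ) :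
    HasDerivAt (fun φ => P.orbitState (e φ) (f φ) (ρ φ) (u φ) (q φ) C)
      ((ρ φ ^ 2 / C) • P.hamKepler (P.orbitState (e φ) (f φ) (ρ φ) (u φ) (q φ) C)) φ := by
  have hK := form_orbitState (P := P) (q := q φ) (C := C) he hef hf hρ hQ
  have hn : ‖(P.orbitState (e φ) (f φ) (ρ φ) (u φ) (q φ) C).1.1‖ = ρ φ := by
    have h1 : ‖e φ‖ = 1 := by
      rw [← sq_eq_sq₀ (norm_nonneg _) zero_le_one, norm_sq_eq, he, one_pow]
    simp only [orbitState, norm_smul, h1, Real.norm_eq_abs, abs_of_pos hρ, mul_one]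
  have d1 := (dρ.smul de).prodMk (dρ.mul du)
  have d2 := ((((du.mul dq).mul_const C).mul dρ).neg.smul de).add
    (((hasDerivAt_const φ C).div dρ hρ.ne').smul df)
  have d3 := ((dq.const_mul P.geom.curv).mul_const C).mul dρ
  refine (d1.prodMk (d2.prodMk d3)).congr_deriv ?_
  simp only [hamKepler, hK, hn, hm]
  have hκ : P.geom.curv = (1 - ρ φ ^ 2 * u φ ^ 2) / ρ φ ^ 2 := by
    rw [qFun] at hQ
    field_simp
    linear_combination hQ
  simp only [orbitState, Pi.mul_apply, Pi.neg_apply, Pi.div_apply, hκ]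
  generalize ρ φ = r at *
  generalize u φ = υ, q φ = p, e φ = E, f φ = F at *
  refine Prod.ext (Prod.ext ?_ ?_) (Prod.ext ?_ ?_)
  · simp only [Prod.smul_fst]
    match_scalars
    all_goals field_simp
  · simp only [Prod.smul_fst, Prod.smul_snd, smul_eq_mul]
    field_simp
    ring
  · simp only [Prod.smul_fst, Prod.smul_snd]
    match_scalars
    all_goals
      field_simp
      ring
  · simp only [Prod.smul_snd, smul_eq_mul]
    field_simp
    ring

/-- Every state with closed elements lies on a periodic Kepler orbit. -/
theorem exists_periodic_orbit (haxis : ‖P.axis‖ = 1) {p : State d}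
    (hp : p ∈ tangentBundle P.geom d) (hC : 0 < angSq p)
    (hcl : elementsOf P.mass₁ P.axis p ∈ P.closedElements) :
    ∃ γ, P.IsKeplerOrbit γ ∧ γ 0 = p ∧ ∃ T, 0 < T ∧ Function.Periodic γ T := by
  obtain ⟨x, hx⟩ : ∃ x, elementsOf P.mass₁ P.axis p = x := ⟨_, rfl⟩
  obtain ⟨r, hr⟩ : ∃ r, ‖p.1.1‖ = r := ⟨_, rfl⟩
  obtain ⟨C, hCC⟩ : ∃ C, ang p = C := ⟨_, rfl⟩
  obtain ⟨hr0, hC0, h1, h2, h3, h4, h5, -, -, h8, h9⟩ :=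
    scalars_of_elements P.mass₁ P.axis hp hC hr hCC hx
  rw [hx] at hcl
  have hCpos : 0 < C := hCC ▸ ang_pos hC
  have hrpos : 0 < r := lt_of_le_of_ne (hr ▸ norm_nonneg _) hr0.symm
  -- The radial and angular unit vectors of the orbital plane at `p`; the second is found by solving
  -- the velocity in `orbitState` for `f`.
  set e₀ : EuclideanSpace ℝ (Fin d) := r⁻¹ • p.1.1 with he₀
  set f₀ : EuclideanSpace ℝ (Fin d) :=
    (r / C) • p.2.1 + (x.2.2.1 * x.2.2.2.1 * r) • p.1.1 with hf₀
  have i1 : inner ℝ e₀ e₀ = (1 : ℝ) := by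
    simp only [he₀, inner_smul_left, inner_smul_right, conj_trivial, h3]; field_simp
  have i2 : inner ℝ e₀ f₀ = (0 : ℝ) := by
    simp only [he₀, hf₀, inner_smul_left, inner_smul_right, inner_add_right, conj_trivial, h3, h4]
    field_simp; ring
  have i3 : inner ℝ f₀ f₀ = (1 : ℝ) := by
    simp only [hf₀, inner_smul_left, inner_smul_right, inner_add_right, inner_add_left,
      conj_trivial, real_inner_comm p.1.1 p.2.1, h3, h4, h5]
    field_simp; ring
  have i2' : inner ℝ f₀ e₀ = (0 : ℝ) := by rw [real_inner_comm, i2]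
  set e : ℝ → EuclideanSpace ℝ (Fin d) := fun φ => Real.cos φ • e₀ + Real.sin φ • f₀ with he
  set f : ℝ → EuclideanSpace ℝ (Fin d) := fun φ => Real.cos φ • f₀ - Real.sin φ • e₀ with hf
  have de : ∀ φ, HasDerivAt e (f φ) φ := fun φ =>
    (((Real.hasDerivAt_cos φ).smul_const e₀).add ((Real.hasDerivAt_sin φ).smul_const f₀)).congr_deriv
      (by simp only [hf]; module)
  have df : ∀ φ, HasDerivAt f (-e φ) φ := fun φ =>
    (((Real.hasDerivAt_cos φ).smul_const f₀).sub ((Real.hasDerivAt_sin φ).smul_const e₀)).congr_deriv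
      (by simp only [he]; module)
  have ee : ∀ φ, inner ℝ (e φ) (e φ) = (1 : ℝ) := fun φ => by
    simp only [he, inner_smul_left, inner_smul_right, inner_add_right, inner_add_left,
      conj_trivial, i1, i2, i3, i2']
    linear_combination Real.sin_sq_add_cos_sq φ
  have ef : ∀ φ, inner ℝ (e φ) (f φ) = (0 : ℝ) := fun φ => by
    simp only [he, hf, inner_smul_left, inner_smul_right, inner_sub_right, inner_add_left,
      conj_trivial, i1, i2, i3, i2']
    ring
  have ff : ∀ φ, inner ℝ (f φ) (f φ) = (1 : ℝ) := fun φ => by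
    simp only [hf, inner_smul_left, inner_smul_right, inner_sub_right, inner_sub_left,
      conj_trivial, i1, i2, i3, i2']
    linear_combination Real.sin_sq_add_cos_sq φ
  set ρ : ℝ → ℝ := fun φ => (√(P.qFun (x.u φ)))⁻¹ with hρ
  have ρpos : ∀ φ, 0 < ρ φ := fun φ => inv_pos.2 (Real.sqrt_pos.2 (hcl φ).1)
  have ρsq : ∀ φ, ρ φ ^ 2 * P.qFun (x.u φ) = 1 := fun φ => by
    simp only [hρ, inv_pow, Real.sq_sqrt (hcl φ).1.le]
    exact inv_mul_cancel₀ (hcl φ).1.ne'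
  have dρ : ∀ φ, HasDerivAt ρ (-(ρ φ ^ 3 * x.u φ * x.p φ)) φ := fun φ => by
    have hs := Real.sqrt_pos.2 (hcl φ).1
    have := ((((x.hasDerivAt_u φ).pow 2).add_const P.geom.curv).sqrt (hcl φ).1.ne').inv hs.ne'
    refine this.congr_deriv ?_
    simp only [hρ, qFun, Pi.pow_apply] at hs ⊢
    field_simp
    push_cast
    ring
  set Ψ : ℝ → State d := fun φ => P.orbitState (e φ) (f φ) (ρ φ) (x.u φ) (x.p φ) C with hΨ
  have dΨ : ∀ φ, HasDerivAt Ψ ((ρ φ ^ 2 / C) • P.hamKepler (Ψ φ)) φ := fun φ =>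
    hasDerivAt_orbitState hCpos h9 (ee φ) (ef φ) (ff φ) (ρpos φ) (ρsq φ) (de φ) (df φ)
      (x.hasDerivAt_u φ) (x.hasDerivAt_p φ) (dρ φ)
  have Ψmem : ∀ φ, Ψ φ ∈ tangentBundle P.geom d := fun φ =>
    orbitState_mem (ee φ) (ef φ) (ρpos φ) (ρsq φ) (hcl φ).2
  have Ψne : ∀ φ, (Ψ φ).1.1 ≠ 0 := fun φ h0 => by
    have : inner ℝ (Ψ φ).1.1 (e φ) = ρ φ := by
      simp only [hΨ, orbitState, inner_smul_left, conj_trivial, ee φ, mul_one]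
    rw [h0, inner_zero_left] at this
    exact (ρpos φ).ne this
  have Ψper : Function.Periodic Ψ (2 * Real.pi) := fun φ => by
    simp only [hΨ, he, hf, hρ, Real.cos_add_two_pi, Real.sin_add_two_pi, x.periodic_u φ,
      Elements.p]
  have u0 : x.u 0 = x.2.2.1 := by simp [Elements.u]
  have p0 : x.p 0 = x.2.2.2.1 := by simp [Elements.p]
  have ρ0 : ρ 0 = r := by
    have hQ : P.qFun (x.u 0) = (r⁻¹) ^ 2 := by rw [u0, qFun, h8]; field_simp; ring
    simp only [hρ, hQ, Real.sqrt_sq (inv_pos.2 hrpos).le, inv_inv]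
  have Ψ0 : Ψ 0 = p := by
    have e0 : e 0 = e₀ := by simp [he]
    have f0 : f 0 = f₀ := by simp [hf]
    simp only [hΨ, u0, p0, ρ0, e0, f0, orbitState]
    refine Prod.ext (Prod.ext ?_ h1.symm) (Prod.ext ?_ ?_)
    · simp only [he₀, smul_smul, mul_inv_cancel₀ hr0, one_smul]
    · simp only [he₀, hf₀]
      match_scalars
      all_goals field_simp
      all_goals ring
    · simp only [h2, h8]
      field_simp
  have hFc : Continuous fun φ => C * P.qFun (x.u φ) := by
    have := x.continuous_u
    simp only [qFun]; fun_prop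
  have hFp : Function.Periodic (fun φ => C * P.qFun (x.u φ)) (2 * Real.pi) := fun φ => by
    simp only [x.periodic_u φ]
  obtain ⟨M, hM⟩ : ∃ M, ∀ φ, C * P.qFun (x.u φ) ≤ M := by
    obtain ⟨M, hM⟩ := (isCompact_Icc.image_of_continuousOn
      (hFc.continuousOn (s := Icc 0 (2 * Real.pi)))).bddAbove
    refine ⟨M, fun φ => ?_⟩
    obtain ⟨ψ, hψ, h⟩ := hFp.exists_mem_Ico₀ (by positivity) φ
    rw [h]
    exact hM ⟨ψ, Ico_subset_Icc_self hψ, rfl⟩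
  -- The time change `φ' = C qFun(u) = C / ρ²` cancels the factor `ρ² / C` by which the curve
  -- parametrized by the angle misses the Kepler flow.
  obtain ⟨φ, T, hT, hφ0, hφ, hφT⟩ := exists_angle_solution hFc
    (fun φ => mul_pos hCpos (hcl φ).1) hM (by positivity : 0 < 2 * Real.pi) hFp
  refine ⟨fun t => Ψ (φ t), fun t => ⟨Ψmem _, fun h => Ψne (φ t) ?_, fun h => Ψne (φ t) ?_,
    P.hamKepler (Ψ (φ t)), P.isHamiltonianVector_kepler haxis (Ψmem _) (Ψne _), ?_⟩, ?_, T, hT,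
    fun t => ?_⟩
  · rw [h]; rfl
  · rw [h]; simp [center₁]
  · refine ((dΨ (φ t)).scomp t (hφ t)).congr_deriv ?_
    rw [smul_smul]
    have : C * P.qFun (x.u (φ t)) * (ρ (φ t) ^ 2 / C) = 1 := by
      rw [← ρsq (φ t)]; field_simp
    rw [this, one_smul]
  · simp only [hφ0, Ψ0]
  · simp only [hφT, Ψper (φ t)]

end TwoCenter

/-! ### Radial orbits -/

/-- A bounded function does not have a second derivative that is bounded below by a positive
constant. -/
theorem not_bounded_of_second_deriv {f g g' : ℝ → ℝ} {m M : ℝ} (hm : 0 < m)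
    (hf : ∀ t, HasDerivAt f (g t) t) (hg : ∀ t, HasDerivAt g (g' t) t) (hg' : ∀ t, m ≤ g' t)
    (hM : ∀ t, |f t| ≤ M) : False := by
  have h1 : Monotone fun t => g t - m * t := by
    have hd : ∀ t, HasDerivAt (fun t => g t - m * t) (g' t - m * 1) t := fun t =>
      (hg t).sub ((hasDerivAt_id t).const_mul m)
    refine monotone_of_deriv_nonneg (fun t => (hd t).differentiableAt) fun t => ?_
    rw [(hd t).deriv]; linarith [hg' t]
  have h2 : ∀ t, 0 ≤ t → g 0 + m * t ≤ g t := fun t ht => by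
    have := h1 ht
    simp only [mul_zero, sub_zero] at this
    linarith
  have h3 : MonotoneOn (fun t => f t - (g 0 * t + m / 2 * t ^ 2)) (Ici 0) := by
    have hd : ∀ t, HasDerivAt (fun t => f t - (g 0 * t + m / 2 * t ^ 2))
        (g t - (g 0 * 1 + m / 2 * (((2 : ℕ) : ℝ) * t ^ (2 - 1)))) t := fun t =>
      (hf t).sub (((hasDerivAt_id t).const_mul (g 0)).add ((hasDerivAt_pow 2 t).const_mul (m / 2)))
    refine monotoneOn_of_deriv_nonneg (convex_Ici 0)
      (fun t _ => (hd t).continuousAt.continuousWithinAt)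
      (fun t _ => (hd t).differentiableAt.differentiableWithinAt) fun t ht => ?_
    rw [interior_Ici, mem_Ioi] at ht
    rw [(hd t).deriv]
    have := h2 t ht.le
    push_cast
    linarith
  -- Chosen such that `t ≥ 1` and `m t / 2 ≥ |g 0| + 2 M + 1`. The quadratic lower bound then gives
  -- `f t - f 0 ≥ 2 M + 1`, which exceeds the possible oscillation `2 M`.
  set t : ℝ := 1 + 2 * (|g 0| + 2 * M + 1) / m with ht
  have hM0 : 0 ≤ M := (abs_nonneg _).trans (hM 0)
  have ht1 : 1 ≤ t := by rw [ht]; linarith [show 0 ≤ 2 * (|g 0| + 2 * M + 1) / m by positivity]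
  have h4 := h3 (mem_Ici.2 le_rfl) (mem_Ici.2 (by linarith : 0 ≤ t)) (by linarith)
  simp only [mul_zero, add_zero, ne_eq, OfNat.ofNat_ne_zero, not_false_eq_true, zero_pow,
    sub_zero] at h4
  have h5 : m * t = m + 2 * (|g 0| + 2 * M + 1) := by rw [ht]; field_simp
  have h6 : t * (2 * M + 1) ≤ t * (g 0 + m * t / 2) := by
    refine mul_le_mul_of_nonneg_left ?_ (by linarith)
    rw [h5]; linarith [neg_abs_le (g 0)]
  have h7 : 2 * M + 1 ≤ t * (2 * M + 1) := le_mul_of_one_le_left (by linarith) ht1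
  linarith [(abs_le.1 (hM t)).2, (abs_le.1 (hM 0)).1]

namespace TwoCenter

variable {P : TwoCenter d}

/-- On a radial orbit of a curved space, the velocity is monotone. -/
theorem IsKeplerOrbit.hasDerivAt_radial (haxis : ‖P.axis‖ = 1) {γ : ℝ → State d}
    (h : P.IsKeplerOrbit γ) (hC : angSq (γ 0) = 0) (hG : P.geom.curv ^ 2 = 1) (t : ℝ) :
    HasDerivAt (fun t => (γ t).2.2 / ‖(γ t).1.1‖)
      (P.mass₁ * P.geom.curv / ‖(γ t).1.1‖ ^ 2) t := by
  have hγ := h.hasDerivAt haxis t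
  have hr : ‖(γ t).1.1‖ ≠ 0 := norm_ne_zero_iff.2 (h.fst_ne_zero t)
  have hA : angSq (γ t) = 0 := (h.angSq_eq haxis t).trans hC
  rw [KeplerBilliard.angSq_eq] at hA
  have h1 := space_sq (h t).1.1
  have h2 : (γ t).1.2 * (γ t).2.2 + P.geom.curv * inner ℝ (γ t).1.1 (γ t).2.1 = 0 := (h t).1.2
  have hσ : HasDerivAt (fun t => (γ t).2.2) (P.hamKepler (γ t)).2.2 t := hγ.snd.snd
  have hn := hasDerivAt_norm (hγ.fst.fst : HasDerivAt (fun t => (γ t).1.1) _ t) (h.fst_ne_zero t)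
  refine (hσ.div hn hr).congr_deriv ?_
  simp only [hamKepler, form]
  obtain ⟨r, hr'⟩ : ∃ r, ‖(γ t).1.1‖ = r := ⟨_, rfl⟩
  rw [hr'] at h1 hr hA ⊢
  generalize inner ℝ (γ t).1.1 (γ t).2.1 = a at *
  have hb : inner ℝ (γ t).2.1 (γ t).2.1 = a ^ 2 / r ^ 2 := by field_simp; linarith
  rw [hb]
  generalize (γ t).2.2 = σ, (γ t).1.2 = s, P.geom.curv = κ at *
  have ha : a = -(κ * (s * σ)) := by linear_combination κ * h2 - a * hG
  subst ha
  field_simp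
  linear_combination (-(κ * s * σ ^ 2)) * h1
    - s ^ 3 * κ * σ ^ 2 * hG

/-- On a radial orbit the bounded function `arcsin s` would have the second derivative `m₁ / ‖y‖² ≥
m₁` for all times. Radial motion thus cannot be complete. -/
theorem IsKeplerOrbit.angSq_pos_of_spherical (haxis : ‖P.axis‖ = 1) (hmass : 0 < P.mass₁)
    (hG : P.geom = .spherical) {γ : ℝ → State d}
    (h : P.IsKeplerOrbit γ) : 0 < angSq (γ 0) := by
  have hκ : P.geom.curv = 1 := by rw [hG]; rfl
  refine (angSq_nonneg _).lt_of_ne' fun hC => ?_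
  have hg := h.hasDerivAt_radial haxis hC (by rw [hκ, one_pow])
  have hs : ∀ t, (γ t).1.2 ^ 2 + ‖(γ t).1.1‖ ^ 2 = 1 := fun t => by
    have := space_sq (h t).1.1
    rwa [hκ, one_mul] at this
  have hr : ∀ t, 0 < ‖(γ t).1.1‖ := fun t => norm_pos_iff.2 (h.fst_ne_zero t)
  refine not_bounded_of_second_deriv hmass (f := fun t => Real.arcsin (γ t).1.2) (fun t => ?_) hg
    (fun t => ?_) (M := Real.pi / 2)
    fun t => abs_le.2 ⟨Real.neg_pi_div_two_le_arcsin _, Real.arcsin_le_pi_div_two _⟩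
  · have hsd : HasDerivAt (fun t => (γ t).1.2) (γ t).2.2 t := (h.hasDerivAt haxis t).fst.snd
    have h1 : (γ t).1.2 ≠ -1 := fun h0 => by nlinarith [hs t, hr t]
    have h2 : (γ t).1.2 ≠ 1 := fun h0 => by nlinarith [hs t, hr t]
    refine ((Real.hasDerivAt_arcsin h1 h2).comp t hsd).congr_deriv ?_
    rw [show 1 - (γ t).1.2 ^ 2 = ‖(γ t).1.1‖ ^ 2 by linarith [hs t], Real.sqrt_sq (hr t).le]
    ring
  · rw [hκ, mul_one, le_div_iff₀ (pow_pos (hr t) 2)]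
    nlinarith [hs t, sq_nonneg (γ t).1.2]

/-- On a radial orbit the quantity `σ / ‖y‖` is strictly decreasing, so the orbit cannot return. -/
theorem IsKeplerOrbit.angSq_pos_of_hyperbolic (haxis : ‖P.axis‖ = 1) (hmass : 0 < P.mass₁)
    (hG : P.geom = .hyperbolic) {γ : ℝ → State d}
    (h : P.IsKeplerOrbit γ) {T : ℝ} (hT : 0 < T) (hper : Function.Periodic γ T) :
    0 < angSq (γ 0) := by
  have hκ : P.geom.curv = -1 := by rw [hG]; rfl
  refine (angSq_nonneg _).lt_of_ne' fun hC => ?_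
  have hg := h.hasDerivAt_radial haxis hC (by rw [hκ]; norm_num)
  have hanti : StrictAnti fun t => (γ t).2.2 / ‖(γ t).1.1‖ := strictAnti_of_deriv_neg fun t => by
    have hr : 0 < ‖(γ t).1.1‖ := norm_pos_iff.2 (h.fst_ne_zero t)
    rw [(hg t).deriv, hκ, mul_neg_one, neg_div]
    exact neg_neg_of_pos (by positivity)
  have h1 := hanti hT
  have h2 : γ T = γ 0 := by simpa using hper 0
  simp only [h2, lt_irrefl] at h1

/-! ### The averaging region -/

/-- The energy is `C² / 2` times `q² + (u - k)² - k²`, and `u` oscillates about `k` with amplitude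
`√(q² + (u - k)²)`. Hence `u` stays positive exactly when the energy is negative. -/
theorem closedElements_iff_of_euclidean (hmass : 0 < P.mass₁) (haxis : ‖P.axis‖ = 1)
    (hG : P.geom = .euclidean) {p : State d} (hp : p ∈ tangentBundle P.geom d)
    (hC : 0 < angSq p) : elementsOf P.mass₁ P.axis p ∈ P.closedElements ↔ P.keplerEnergy p < 0 := by
  obtain ⟨⟨b, g, u, q, k⟩, hx⟩ : ∃ x, elementsOf P.mass₁ P.axis p = x := ⟨_, rfl⟩
  obtain ⟨r, hr⟩ : ∃ r, ‖p.1.1‖ = r := ⟨_, rfl⟩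
  obtain ⟨C, hCC⟩ : ∃ C, ang p = C := ⟨_, rfl⟩
  obtain ⟨hr0, hC0, h1, h2, h3, h4, h5, -, -, h8, h9⟩ :=
    scalars_of_elements P.mass₁ P.axis hp hC hr hCC hx
  have hκ : P.geom.curv = 0 := by rw [hG]; rfl
  have hk : 0 < k := by
    have : 0 < k * C ^ 2 := h9 ▸ hmass
    exact (pos_iff_pos_of_mul_pos this).2 (by positivity)
  have hs : r * u = 1 := by rw [← h1]; exact snd_eq_one_of_mem_space (hG ▸ hp.1)
  have hE : P.keplerEnergy p = C ^ 2 / 2 * (q ^ 2 + (u - k) ^ 2 - k ^ 2) := by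
    rw [P.keplerEnergy_eq haxis hp, keplerExt, form, hκ, h5, h1, hr, h9]
    have : u = 1 / r := by field_simp; linarith
    rw [this]
    field_simp
    ring
  have hC2 : 0 < C ^ 2 / 2 := by positivity
  rw [hE, ← not_le, mul_nonneg_iff_of_pos_left hC2, not_le, hx]
  have hcl : ((b, g, u, q, k) : Elements) ∈ P.closedElements ↔
      ∀ φ : ℝ, 0 < k + (u - k) * Real.cos φ + q * Real.sin φ := by
    simp only [closedElements, mem_ofPred_eq, qFun, hG, Geometry.curv, add_zero, Elements.u,
      Elements.k]
    exact forall_congr' fun φ => ⟨fun h => h.2 (by simp), fun h => ⟨pow_pos h 2, fun _ => h⟩⟩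
  rw [hcl]
  constructor
  · intro h
    -- The argument of `z` is the angle of the aphelion, where `u` takes its minimum `k - ‖z‖`.
    set z : ℂ := ⟨-(u - k), -q⟩ with hz
    have e1 : ‖z‖ * Real.cos z.arg = -(u - k) := Complex.norm_mul_cos_arg z
    have e2 : ‖z‖ * Real.sin z.arg = -q := Complex.norm_mul_sin_arg z
    have e3 : ‖z‖ ^ 2 = (u - k) ^ 2 + q ^ 2 := by
      rw [Complex.sq_norm, Complex.normSq_apply]; ring
    have e4 := h z.arg
    rcases (norm_nonneg z).eq_or_lt with h0 | h0
    · rw [← h0] at e3; nlinarith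
    · have e5 : 0 < ‖z‖ * k - ‖z‖ ^ 2 := by
        have := mul_pos h0 e4
        rw [e3]; linear_combination this + (u - k) * e1 + q * e2
      have e6 : ‖z‖ < k := by nlinarith
      nlinarith
  · intro h φ
    have e := Real.sin_sq_add_cos_sq φ
    have e1 : ((u - k) * Real.cos φ + q * Real.sin φ) ^ 2 < k ^ 2 := by
      have : ((u - k) * Real.cos φ + q * Real.sin φ) ^ 2
          + ((u - k) * Real.sin φ - q * Real.cos φ) ^ 2 = q ^ 2 + (u - k) ^ 2 := by
        linear_combination (q ^ 2 + (u - k) ^ 2) * e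
      nlinarith [sq_nonneg ((u - k) * Real.sin φ - q * Real.cos φ)]
    linarith [(abs_lt.1 (abs_lt_of_sq_lt_sq e1 hk.le)).1]

/-- Unifies the three definitions. In the flat case the sign of the energy decides; on the sphere
completeness excludes radial orbits and closedness is automatic; in the hyperbolic case a period
both excludes radial orbits and keeps all angles admissible. -/
theorem hasRegularOrbit_iff (haxis : ‖P.axis‖ = 1) (hmass : 0 < P.mass₁) {p : State d}
    (hp : p ∈ tangentBundle P.geom d) : P.HasRegularOrbit p ↔
      0 < angSq p ∧ elementsOf P.mass₁ P.axis p ∈ P.closedElements := by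
  rw [HasRegularOrbit]
  split
  next hG =>
    rw [P.angMomSq_eq]
    constructor
    · rintro ⟨h1, h2⟩
      have hC : 0 < angSq p := (angSq_nonneg p).lt_of_ne' h2
      exact ⟨hC, (closedElements_iff_of_euclidean hmass haxis hG hp hC).2 h1⟩
    · rintro ⟨h1, h2⟩
      exact ⟨(closedElements_iff_of_euclidean hmass haxis hG hp h1).1 h2, h1.ne'⟩
  next hG =>
    constructor
    · rintro ⟨γ, hγ, rfl⟩
      refine ⟨hγ.angSq_pos_of_spherical haxis hmass hG, fun φ => ⟨?_, fun h => absurd hG h⟩⟩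
      rw [qFun, hG, Geometry.curv]
      positivity
    · rintro ⟨h1, h2⟩
      obtain ⟨γ, hγ, h0, -⟩ := exists_periodic_orbit haxis hp h1 h2
      exact ⟨γ, hγ, h0⟩
  next hG =>
    constructor
    · rintro ⟨γ, hγ, rfl, T, hT, hper⟩
      have hC := hγ.angSq_pos_of_hyperbolic haxis hmass hG hT hper
      exact ⟨hC, hγ.closed_of_periodic haxis hC hT hper⟩
    · rintro ⟨h1, h2⟩
      exact exists_periodic_orbit haxis hp h1 h2

/-- Replaces the conditions on solutions of the Kepler problem by conditions on the elements alone.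
The orbit through the state exists by `exists_periodic_orbit`, and it sweeps all angles, so missing
the second center and its antipode is the positivity of `denSq`. -/
theorem mem_region_iff (haxis : ‖P.axis‖ = 1) (hmass : 0 < P.mass₁)
    (hS : P.geom.sn (2 * P.halfDist) ≠ 0) {p : State d} : p ∈ P.region ↔
      p ∈ tangentBundle P.geom d ∧ 0 < angSq p ∧
        elementsOf P.mass₁ P.axis p ∈ P.goodElements := by
  constructor
  · rintro ⟨hp, hreg, hhit⟩
    obtain ⟨hC, hcl⟩ := (hasRegularOrbit_iff haxis hmass hp).1 hreg
    obtain ⟨γ, hγ, rfl, T, hT, hper⟩ := exists_periodic_orbit haxis hp hC hcl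
    refine ⟨hp, hC, hγ.good_of_periodic haxis hS hC hT hper fun t => ?_⟩
    exact ⟨fun h => hhit ⟨γ, hγ, rfl, t, Or.inl h⟩, fun h => hhit ⟨γ, hγ, rfl, t, Or.inr h⟩⟩
  · rintro ⟨hp, hC, hx⟩
    refine ⟨hp, (hasRegularOrbit_iff haxis hmass hp).2 ⟨hC, (mem_goodElements_iff.1 hx).1⟩, ?_⟩
    rintro ⟨γ, hγ, rfl, t, ht⟩
    obtain ⟨h1, h2⟩ := hγ.ne_center₂ haxis hS hC hx t
    exact ht.elim h1 h2

/-- The orbit and period in `keplerAverage` are arbitrary choices, but `average_eq` gives the same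
value for each of them. -/
theorem averagedEnergy_eq (haxis : ‖P.axis‖ = 1) {p : State d}
    (hp : p ∈ tangentBundle P.geom d) (hC : 0 < angSq p)
    (hx : elementsOf P.mass₁ P.axis p ∈ P.goodElements) : P.averagedEnergy p =
      P.keplerExt p - P.mass₂ * P.orbitAverage (elementsOf P.mass₁ P.axis p) := by
  obtain ⟨γ, hγ, h0, T, hT, hper⟩ :=
    exists_periodic_orbit haxis hp hC (mem_goodElements_iff.1 hx).1
  have hex : ∃ c : (ℝ → State d) × ℝ,
      P.IsKeplerOrbit c.1 ∧ c.1 0 = p ∧ 0 < c.2 ∧ Function.Periodic c.1 c.2 :=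
    ⟨(γ, T), hγ, h0, hT, hper⟩
  rw [averagedEnergy, keplerAverage, dif_pos hex, P.keplerEnergy_eq haxis hp]
  obtain ⟨h1, h2, h3, h4⟩ := hex.choose_spec
  have := h1.average_eq haxis (by rwa [h2]) h3 h4 (by rwa [h2])
  rw [this, h2]
  ring

/-! ### Smoothness of the averaged energy and its commutation relations -/

variable (P) in
/-- The set of states with good elements, in the ambient space. -/
def goodStates : Set (State d) :=
  {p | 0 < angSq p ∧ elementsOf P.mass₁ P.axis p ∈ P.goodElements}

variable (P) in
/-- A smooth extension of the averaged energy. -/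
def averagedExt (p : State d) : ℝ :=
  P.keplerExt p - P.mass₂ * P.orbitAverage (elementsOf P.mass₁ P.axis p)

theorem isOpen_goodStates : IsOpen P.goodStates := by
  have h1 : IsOpen {p : State d | 0 < angSq p} :=
    isOpen_lt continuous_const contDiff_angMomOn.continuous
  exact ContinuousOn.isOpen_inter_preimage
    (fun p hp => (contDiffAt_elementsOf P.mass₁ P.axis hp).continuousAt.continuousWithinAt) h1
    P.isOpen_goodElements

theorem region_eq (haxis : ‖P.axis‖ = 1) (hmass : 0 < P.mass₁)
    (hS : P.geom.sn (2 * P.halfDist) ≠ 0) :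
    P.region = P.goodStates ∩ tangentBundle P.geom d := by
  ext p
  rw [mem_region_iff haxis hmass hS]
  exact ⟨fun h => ⟨h.2, h.1⟩, fun h => ⟨h.2, h.1⟩⟩

theorem contDiffAt_averagedExt {p : State d} (hp : p ∈ P.goodStates) :
    ContDiffAt ℝ ∞ P.averagedExt p :=
  (P.contDiffAt_keplerExt (ne_zero_of_angSq hp.1)).sub (contDiffAt_const.mul
    ((P.contDiffOn_orbitAverage.contDiffAt (P.isOpen_goodElements.mem_nhds hp.2)).comp p
      (contDiffAt_elementsOf P.mass₁ P.axis hp.1)))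

theorem isSmoothSystem (haxis : ‖P.axis‖ = 1) (hmass : 0 < P.mass₁)
    (hS : P.geom.sn (2 * P.halfDist) ≠ 0) : P.IsSmoothSystem := by
  refine ⟨⟨P.goodStates, isOpen_goodStates, region_eq haxis hmass hS⟩, fun p hp => ?_⟩
  rw [region_eq haxis hmass hS] at hp
  refine ⟨P.goodStates, isOpen_goodStates.mem_nhds hp.1, P.averagedExt,
    fun x hx => (contDiffAt_averagedExt hx).contDiffWithinAt, fun x hx => ?_⟩
  exact averagedEnergy_eq haxis hx.2 hx.1.1 hx.1.2

/-- The averaged energy is conserved by every vector that conserves the Keplerian energy and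
along which its average is stationary. -/
theorem symp_averagedEnergy_eq_zero (haxis : ‖P.axis‖ = 1) {p X Y : State d}
    (hp : p ∈ P.goodStates) (hpt : p ∈ tangentBundle P.geom d)
    (hX : IsHamiltonianVector P.geom P.averagedEnergy p X)
    (hY : Y ∈ phaseTangent P.geom p) (hE : P.keplerDeriv p Y = 0)
    (hN : fderiv ℝ P.orbitAverage (elementsOf P.mass₁ P.axis p)
      (elementsDeriv P.mass₁ P.axis p Y) = 0) : symp P.geom X Y = 0 := by
  have hd : DifferentiableAt ℝ P.averagedExt p := (contDiffAt_averagedExt hp).differentiableAt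
    (by simp)
  have hL : HasFDerivWithinAt P.averagedEnergy (fderiv ℝ P.averagedExt p)
      (tangentBundle P.geom d) p := by
    refine hd.hasFDerivAt.hasFDerivWithinAt.congr_of_eventuallyEq ?_
      (averagedEnergy_eq haxis hpt hp.1 hp.2)
    filter_upwards [self_mem_nhdsWithin,
      mem_nhdsWithin_of_mem_nhds (isOpen_goodStates.mem_nhds hp)] with x hx hx'
    exact averagedEnergy_eq haxis hx hx'.1 hx'.2
  rw [hX.apply_eq hpt hL hY]
  refine fderiv_apply_of_line hd ?_
  have hl := hasDerivAt_line p Y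
  have h0 : p + (0 : ℝ) • Y = p := by simp
  have h1 := P.hasDerivAt_keplerExt hl (by rw [h0]; exact ne_zero_of_angSq hp.1)
  have h2 := hasDerivAt_elementsOf P.mass₁ P.axis hl (by rw [h0]; exact hp.1)
  have h3 : HasFDerivAt P.orbitAverage (fderiv ℝ P.orbitAverage (elementsOf P.mass₁ P.axis p))
      (elementsOf P.mass₁ P.axis (p + (0 : ℝ) • Y)) := by
    rw [h0]
    exact ((P.contDiffOn_orbitAverage.contDiffAt
      (P.isOpen_goodElements.mem_nhds hp.2)).differentiableAt (by simp)).hasFDerivAt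
  refine (h1.sub ((h3.comp_hasDerivAt (0 : ℝ) h2).const_mul P.mass₂)).congr_deriv ?_
  simp only [h0, hE, hN]
  ring

/-- The direction of the Kepler flow is the difference of two directions `elementsDir` with
different `c₀`, so its invariance is contained in that of `D`. -/
theorem fderiv_orbitAverage_kepler {x : Elements} (hx : x ∈ P.goodElements) :
    fderiv ℝ P.orbitAverage x (x.2.1, -x.1, x.2.2.2.1, x.k - x.2.2.1, 0) = 0 := by
  have h := (P.fderiv_orbitAverage hx 1)
  have h' := (P.fderiv_orbitAverage hx 0)
  have e : ((x.2.1, -x.1, x.2.2.2.1, x.k - x.2.2.1, 0) : Elements) =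
      P.elementsDir x 1 - P.elementsDir x 0 := by
    simp only [elementsDir, Prod.mk_sub_mk]
    refine Prod.ext ?_ (Prod.ext ?_ (Prod.ext ?_ (Prod.ext ?_ ?_))) <;> simp only <;> ring
  rw [e, map_sub, h, h', sub_zero]

theorem symp_averagedEnergy_hamKepler (haxis : ‖P.axis‖ = 1) {p X : State d}
    (hp : p ∈ P.goodStates) (hpt : p ∈ tangentBundle P.geom d)
    (hX : IsHamiltonianVector P.geom P.averagedEnergy p X) :
    symp P.geom X (P.hamKepler p) = 0 := by
  have hy := ne_zero_of_angSq hp.1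
  refine symp_averagedEnergy_eq_zero haxis hp hpt hX (P.hamKepler_mem hpt hy) ?_ ?_
  · rw [← P.symp_hamKepler hpt hy (P.hamKepler_mem hpt hy), symp, form_comm, sub_self]
  · rw [P.elementsDeriv_hamKepler P.axis hpt hp.1 rfl, map_smul]
    exact smul_eq_zero_of_right _ (fderiv_orbitAverage_kepler hp.2)

/-- By antisymmetry of the bracket it suffices that `D` is constant along Kepler orbits, and it is a
combination of `C²` and a component of the Laplace-Runge-Lenz vector. -/
theorem keplerDeriv_hamD {p : State d} (hpt : p ∈ tangentBundle P.geom d) (hy : p.1.1 ≠ 0) :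
    P.keplerDeriv p (P.hamD p) = 0 := by
  rw [← P.symp_hamKepler hpt hy (P.hamD_mem hy), symp_swap,
    P.symp_hamD hpt (P.hamKepler_mem hpt hy), derivD, P.angMomOnDeriv_hamKepler,
    P.lrlDeriv_hamKepler _ hpt hy]
  ring

theorem symp_averagedEnergy_hamD (haxis : ‖P.axis‖ = 1) {p X : State d}
    (hp : p ∈ P.goodStates) (hpt : p ∈ tangentBundle P.geom d)
    (hX : IsHamiltonianVector P.geom P.averagedEnergy p X) :
    symp P.geom X (P.hamD p) = 0 := by
  have hy := ne_zero_of_angSq hp.1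
  refine symp_averagedEnergy_eq_zero haxis hp hpt hX (P.hamD_mem hy) (keplerDeriv_hamD hpt hy) ?_
  rw [P.elementsDeriv_hamD haxis hpt hp.1, map_smul, P.fderiv_orbitAverage hp.2, smul_zero]

theorem symp_averagedEnergy_hamAngMomOn (haxis : ‖P.axis‖ = 1)
    {π : EuclideanSpace ℝ (Fin d) →L[ℝ] EuclideanSpace ℝ (Fin d)}
    (hπ : IsProj π) (hπa : π P.axis = 0) {p X : State d}
    (hp : p ∈ P.goodStates) (hpt : p ∈ tangentBundle P.geom d)
    (hX : IsHamiltonianVector P.geom P.averagedEnergy p X) :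
    symp P.geom X (hamAngMomOn π p) = 0 := by
  refine symp_averagedEnergy_eq_zero haxis hp hpt hX (hamAngMomOn_mem hπ _ p)
    (P.keplerDeriv_hamAngMomOn hπ p) ?_
  rw [elementsDeriv_hamAngMomOn hπ hπa, map_zero]

end TwoCenter

/-! ### Conservation along billiard trajectories -/

/-- The finite exceptional set is the set of reflection times, where a conserved quantity is shown
to be continuous only. -/
theorem eq_of_deriv_eq_zero_off_finset {f : ℝ → ℝ} {a b : ℝ} {T : Finset ℝ}
    (hc : ContinuousOn f (Icc a b))
    (hd : ∀ t ∈ Icc a b, t ∉ T → HasDerivWithinAt f 0 (Icc a b) t) {t : ℝ} (ht : t ∈ Icc a b) :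
    f t = f a := by
  have h := MeasureTheory.integral_eq_of_hasDerivAt_off_countable_of_le f (fun _ => 0) ht.1
    T.countable_toSet (hc.mono (Icc_subset_Icc_right ht.2)) (fun x hx => ?_) (by simp)
  · simp only [intervalIntegral.integral_zero] at h
    linarith
  · have hx' : x ∈ Ioo a b := ⟨hx.1.1, hx.1.2.trans_le ht.2⟩
    exact (hd x (Ioo_subset_Icc_self hx') hx.2).hasDerivAt (Icc_mem_nhds hx'.1 hx'.2)

namespace TwoCenter

variable {P : TwoCenter d}

/-- A function is conserved by the billiard if its Hamiltonian vector field annihilates the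
averaged energy and if it is invariant under the reflections. -/
theorem isConserved_of_commute {n : ℕ} {B : Fin n → P.WallPiece} {F : State d → ℝ}
    {Y : State d → State d} (hY : ∀ p ∈ P.region, IsHamiltonianVector P.geom F p (Y p))
    (hcomm : ∀ p ∈ P.region, ∀ X, IsHamiltonianVector P.geom P.averagedEnergy p X →
      symp P.geom X (Y p) = 0)
    (hrefl : ∀ i q v v', (q, v) ∈ P.region → (B i).Reflects q v v' → F (q, v') = F (q, v)) :
    P.IsConserved B F := by
  intro γ t₀ t₁ T hγ
  have hmem : MapsTo γ (Icc t₀ t₁) (tangentBundle P.geom d) := fun t ht =>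
    (hγ.mem_region t ht).1
  have hFc : ∀ p ∈ P.region, ContinuousWithinAt F (tangentBundle P.geom d) p := fun p hp => by
    obtain ⟨-, L, hL, -⟩ := hY p hp
    exact hL.continuousWithinAt
  have hderiv : ∀ t ∈ Icc t₀ t₁, t ∉ T →
      HasDerivWithinAt (fun t => F (γ t)) 0 (Icc t₀ t₁) t := by
    intro t ht hT
    obtain ⟨X, hX, hd⟩ := hγ.flow t ht hT
    have hp := hγ.mem_region t ht
    have h0 := hcomm _ hp X hX
    obtain ⟨-, L, hL, hLY⟩ := hY _ hp
    refine (hL.comp_hasDerivWithinAt t hd hmem).congr_deriv ?_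
    rw [← hLY X hX.1, symp_swap, h0, neg_zero]
  have hcont : ContinuousOn (fun t => F (γ t)) (Icc t₀ t₁) := by
    intro t ht
    by_cases hT : t ∈ T
    · have hright : ContinuousWithinAt (fun t => F (γ t)) (Icc t t₁) t :=
        (hFc _ (hγ.mem_region t ht)).comp (hγ.right_cont t ht hT)
          (hmem.mono_left (Icc_subset_Icc_left ht.1))
      rcases ht.1.eq_or_lt with rfl | hlt
      · exact hright
      · obtain ⟨v, i, hv, htend, hR⟩ := hγ.reflect t ⟨hlt, ht.2⟩ hT
        -- The limit from the left is the value at the incoming velocity; invariance under the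
        -- reflection identifies it with the value at the outgoing velocity, so no jump occurs.
        have hleft : ContinuousWithinAt (fun t => F (γ t)) (Ico t₀ t) t := by
          have h1 : Tendsto γ (𝓝[Ico t₀ t] t) (𝓝[tangentBundle P.geom d] ((γ t).1, v)) :=
            tendsto_nhdsWithin_iff.2 ⟨htend, by
              filter_upwards [self_mem_nhdsWithin] with τ hτ
              exact hmem ⟨hτ.1, hτ.2.le.trans ht.2⟩⟩
          have h2 := (hFc _ hv).tendsto.comp h1
          rwa [← hrefl i _ _ _ hv hR] at h2
        rw [← Ico_union_Icc_eq_Icc hlt.le ht.2]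
        exact hleft.union hright
    · exact (hderiv t ht hT).continuousWithinAt
  intro s hs t ht
  rw [eq_of_deriv_eq_zero_off_finset hcont hderiv hs,
    eq_of_deriv_eq_zero_off_finset hcont hderiv ht]

theorem mem_good_of_mem_region (haxis : ‖P.axis‖ = 1) (hmass : 0 < P.mass₁)
    (hS : P.geom.sn (2 * P.halfDist) ≠ 0) {p : State d} (hp : p ∈ P.region) :
    p ∈ P.goodStates ∧ p ∈ tangentBundle P.geom d ∧ p.1.1 ≠ 0 := by
  rw [region_eq haxis hmass hS] at hp
  exact ⟨hp.1, hp.2, ne_zero_of_angSq hp.1.1⟩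

theorem isConserved_keplerEnergy (haxis : ‖P.axis‖ = 1) (hmass : 0 < P.mass₁)
    (hS : P.geom.sn (2 * P.halfDist) ≠ 0) {n : ℕ} (B : Fin n → P.WallPiece) :
    P.IsConserved B P.keplerEnergy := by
  have hr := fun p => mem_good_of_mem_region (p := p) haxis hmass hS
  exact isConserved_of_commute
    (fun p hp => P.isHamiltonianVector_kepler haxis (hr p hp).2.1 (hr p hp).2.2)
    (fun p hp X hX => symp_averagedEnergy_hamKepler haxis (hr p hp).1 (hr p hp).2.1 hX)
    fun i q v v' _ h => Reflects.keplerEnergy_eq P h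

theorem isConserved_D (haxis : ‖P.axis‖ = 1) (hmass : 0 < P.mass₁)
    (hS : P.geom.sn (2 * P.halfDist) ≠ 0) {n : ℕ} (B : Fin n → P.WallPiece) :
    P.IsConserved B P.D := by
  have hr := fun p => mem_good_of_mem_region (p := p) haxis hmass hS
  exact isConserved_of_commute
    (fun p hp => P.isHamiltonianVector_D (hr p hp).2.1 (hr p hp).2.2)
    (fun p hp X hX => symp_averagedEnergy_hamD haxis (hr p hp).1 (hr p hp).2.1 hX)
    fun i q v v' hv h => Reflects.D_eq P haxis (hr _ hv).2.1 (hr _ hv).2.2 h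

theorem isConserved_angMomOn (haxis : ‖P.axis‖ = 1) (hmass : 0 < P.mass₁)
    (hS : P.geom.sn (2 * P.halfDist) ≠ 0) (hd : 3 ≤ d)
    {π : EuclideanSpace ℝ (Fin d) →L[ℝ] EuclideanSpace ℝ (Fin d)}
    (hπ : IsProj π) (hπa : π P.axis = 0) {n : ℕ} (B : Fin n → P.WallPiece) :
    P.IsConserved B (angMomOn π) := by
  have hr := fun p => mem_good_of_mem_region (p := p) haxis hmass hS
  exact isConserved_of_commute
    (fun p hp => isHamiltonianVector_angMomOn hπ (hr p hp).2.1)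
    (fun p hp X hX => symp_averagedEnergy_hamAngMomOn haxis hπ hπa (hr p hp).1 (hr p hp).2.1 hX)
    fun i q v v' hv h => Reflects.angMomOn_eq P hπ hπa hd haxis (hr _ hv).2.2 h

end TwoCenter

/-! ### Density of nonvanishing conditions -/

/-- Finitely many nonvanishing conditions can be achieved one after the other: each is reached by a
small perturbation, and those achieved before are open and survive it. -/
theorem subset_closure_of_steps {X ι : Type} [TopologicalSpace X] {S A : Set X} (hA : IsOpen A)
    {f : ι → X → ℝ} (hf : ∀ i, Continuous (f i)) (J : Finset ι)
    (step : ∀ i ∈ J, ∀ p ∈ S ∩ A, p ∈ closure (S ∩ {x | f i x ≠ 0})) :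
    S ∩ A ⊆ closure (S ∩ (A ∩ {x | ∀ i ∈ J, f i x ≠ 0})) := by
  classical
  induction J using Finset.induction_on with
  | empty => simpa using subset_closure
  | insert j J hj ih =>
    have h1 := ih fun i hi => step i (Finset.mem_insert_of_mem hi)
    refine h1.trans (closure_minimal ?_ isClosed_closure)
    rintro p ⟨hpS, hpA, hpJ⟩
    have hO : IsOpen (A ∩ {x | ∀ i ∈ J, f i x ≠ 0}) := by
      refine hA.inter ?_
      simp only [ofPred_forall]
      exact isOpen_biInter_finset fun i _ => isOpen_ne_fun (hf i) continuous_const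
    have h2 := step j (Finset.mem_insert_self j J) p ⟨hpS, hpA⟩
    refine closure_mono ?_ (hO.inter_closure ⟨⟨hpA, hpJ⟩, h2⟩)
    rintro x ⟨⟨h3, h4⟩, h5, h6⟩
    refine ⟨h5, h3, fun i hi => ?_⟩
    rcases Finset.mem_insert.1 hi with rfl | hi
    · exact h6
    · exact h4 i hi

theorem subset_closure_of_step {X : Type} [TopologicalSpace X] {S A : Set X} (hA : IsOpen A)
    {f : X → ℝ} (hf : Continuous f)
    (step : ∀ p ∈ S ∩ A, p ∈ closure (S ∩ {x | f x ≠ 0})) :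
    S ∩ A ⊆ closure (S ∩ (A ∩ {x | f x ≠ 0})) := by
  have := subset_closure_of_steps (ι := Unit) hA (fun _ => hf) {()} (fun _ _ => step)
  simpa using this

theorem frequently_quadratic_ne_zero {A B C : ℝ} (h : B ≠ 0 ∨ C ≠ 0) :
    ∃ᶠ t in 𝓝 (0 : ℝ), A + B * t + C * t ^ 2 ≠ 0 := by
  intro hev
  obtain ⟨δ, hδ, hb⟩ := Metric.eventually_nhds_iff.1 hev
  simp only [not_not, Real.dist_eq, sub_zero] at hb
  -- Three zeros `0`, `δ/2`, `-δ/2` annihilate all coefficients of the quadratic polynomial.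
  have h0 := hb (y := 0) (by simpa using hδ)
  have h1 := hb (y := δ / 2) (by rw [abs_of_pos (by positivity)]; linarith)
  have h2 := hb (y := -(δ / 2)) (by rw [abs_neg, abs_of_pos (by positivity)]; linarith)
  have hB : B * δ = 0 := by linarith
  have hC : C * δ ^ 2 = 0 := by nlinarith
  simp only [mul_eq_zero, hδ.ne', or_false, ne_eq, OfNat.ofNat_ne_zero, not_false_eq_true,
    pow_eq_zero_iff] at hB hC
  exact h.elim (absurd hB) (absurd hC)

/-- Change of the velocity in a direction orthogonal to `y`. -/
theorem mem_closure_of_velocity {G : Geometry} {p : State d} (hp : p ∈ tangentBundle G d)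
    {ζ : EuclideanSpace ℝ (Fin d)} (hζ : inner ℝ p.1.1 ζ = (0 : ℝ)) {f : State d → ℝ} {A B C : ℝ}
    (hf : ∀ t : ℝ, f (p.1, (p.2.1 + t • ζ, p.2.2)) = A + B * t + C * t ^ 2)
    (h : B ≠ 0 ∨ C ≠ 0) : p ∈ closure (tangentBundle G d ∩ {x | f x ≠ 0}) := by
  have hc : Continuous fun t : ℝ => ((p.1, (p.2.1 + t • ζ, p.2.2)) : State d) := by fun_prop
  have ht := hc.tendsto 0
  simp only [zero_smul, add_zero] at ht
  refine mem_closure_of_frequently_of_tendsto ?_ ht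
  refine (frequently_quadratic_ne_zero h (A := A)).mono fun t ht => ⟨⟨hp.1, ?_⟩, by
    rw [mem_ofPred_eq, hf]; exact ht⟩
  have := hp.2
  simp only [tangent, mem_ofPred_eq, inner_add_right, inner_smul_right, hζ] at this ⊢
  linarith

/-- The isometry that translates the base point by `ε` in the direction `e`. -/
def translate (G : Geometry) (e : EuclideanSpace ℝ (Fin d)) (ε : ℝ) (q : Ambient d) : Ambient d :=
  (q.1 + ((G.cs ε - 1) * inner ℝ q.1 e + q.2 * G.sn ε) • e,
    G.cs ε * q.2 - G.curv * G.sn ε * inner ℝ q.1 e)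

theorem translate_zero (G : Geometry) (e : EuclideanSpace ℝ (Fin d)) (q : Ambient d) :
    translate G e 0 q = q := by
  simp [translate, G.cs_zero, G.sn_zero]

theorem Geometry.continuous_cs (G : Geometry) : Continuous G.cs := by
  cases G
  · exact continuous_const
  · exact Real.continuous_cos
  · exact Real.continuous_cosh

theorem Geometry.continuous_sn (G : Geometry) : Continuous G.sn := by
  cases G
  · exact continuous_id
  · exact Real.continuous_sin
  · exact Real.continuous_sinh

theorem continuous_translate (G : Geometry) (e : EuclideanSpace ℝ (Fin d)) (q : Ambient d) :
    Continuous fun ε => translate G e ε q := by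
  have h1 := G.continuous_cs
  have h2 := G.continuous_sn
  unfold translate
  fun_prop

theorem translate_form {G : Geometry} {e : EuclideanSpace ℝ (Fin d)} (he : ‖e‖ = 1) (ε : ℝ)
    (q v : Ambient d) : (translate G e ε q).2 * (translate G e ε v).2
      + G.curv * inner ℝ (translate G e ε q).1 (translate G e ε v).1 =
        q.2 * v.2 + G.curv * inner ℝ q.1 v.1 := by
  have h0 := G.cs_sq_add ε
  have h1 : inner ℝ e e = (1 : ℝ) := by rw [← norm_sq_eq, he, one_pow]
  simp only [translate, inner_add_left, inner_add_right, inner_smul_left, inner_smul_right,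
    conj_trivial, h1, real_inner_comm v.1 e]
  linear_combination (q.2 * v.2 + G.curv * inner ℝ q.1 e * inner ℝ v.1 e) * h0

/-- Translations act on the tangent bundle; only the sign of the last coordinate could be lost, and
it persists for small `ε`. Taking `ε` small and positive guarantees `sn ε ≠ 0`. -/
theorem mem_closure_of_translate {G : Geometry} {p : State d} (hp : p ∈ tangentBundle G d)
    {e : EuclideanSpace ℝ (Fin d)} (he : ‖e‖ = 1) {f : State d → ℝ}
    (hf : ∀ ε, G.sn ε ≠ 0 → f (translate G e ε p.1, translate G e ε p.2) ≠ 0) :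
    p ∈ closure (tangentBundle G d ∩ {x | f x ≠ 0}) := by
  have hc := (continuous_translate G e p.1).prodMk (continuous_translate G e p.2)
  have ht := (hc.tendsto 0).mono_left (nhdsWithin_le_nhds (s := Ioi 0))
  simp only [translate_zero] at ht
  refine mem_closure_of_tendsto ht ?_
  have hpos : ∀ᶠ ε in 𝓝[>] (0 : ℝ), G ≠ .spherical → 0 < (translate G e ε p.1).2 := by
    by_cases hG : G = .spherical
    · simp [hG]
    · have h1 := ((continuous_snd.comp (continuous_translate G e p.1)).tendsto 0).mono_left
        (nhdsWithin_le_nhds (s := Ioi 0))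
      simp only [Function.comp_apply, translate_zero] at h1
      filter_upwards [h1.eventually_const_lt (hp.1.2 hG)] with ε hε _ using hε
  filter_upwards [hpos, Ioo_mem_nhdsGT (zero_lt_one (α := ℝ))] with ε hε h01
  have h1 := translate_form (G := G) he ε p.1 p.1
  have h2 := translate_form (G := G) he ε p.1 p.2
  have h3 := space_sq hp.1
  have hsn : G.sn ε ≠ 0 := by
    cases G
    · exact h01.1.ne'
    · exact (Real.sin_pos_of_pos_of_lt_pi h01.1 (by linarith [Real.pi_gt_three, h01.2])).ne'
    · exact (Real.sinh_pos_iff.2 h01.1).ne'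
  refine ⟨⟨⟨?_, hε⟩, ?_⟩, hf ε hsn⟩
  · rw [norm_sq_eq] at h3 ⊢
    linarith
  · exact h2.trans hp.2

/-! ### Orthogonal projections onto coordinate subspaces -/

/-- The orthogonal projection onto the span of the basis vectors with index in `J`. -/
def coordProj (β : OrthonormalBasis (Fin d) ℝ (EuclideanSpace ℝ (Fin d))) (J : Finset (Fin d)) :
    EuclideanSpace ℝ (Fin d) →L[ℝ] EuclideanSpace ℝ (Fin d) :=
  ∑ j ∈ J, (innerSL ℝ (β j)).smulRight (β j)

section CoordProj

variable (β : OrthonormalBasis (Fin d) ℝ (EuclideanSpace ℝ (Fin d))) {J J' : Finset (Fin d)}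

theorem coordProj_apply (x : EuclideanSpace ℝ (Fin d)) :
    coordProj β J x = ∑ j ∈ J, (inner ℝ (β j) x : ℝ) • β j := by
  simp [coordProj]

theorem inner_coordProj (x : EuclideanSpace ℝ (Fin d)) (i : Fin d) :
    inner ℝ (β i) (coordProj β J x) = if i ∈ J then inner ℝ (β i) x else (0 : ℝ) := by
  rw [coordProj_apply, inner_sum]
  simp only [inner_smul_right, β.inner_eq_ite, mul_ite, mul_one, mul_zero, Finset.sum_ite_eq]

theorem coordProj_coordProj (h : J ⊆ J') (x : EuclideanSpace ℝ (Fin d)) :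
    coordProj β J (coordProj β J' x) = coordProj β J x := by
  rw [coordProj_apply β (coordProj β J' x), coordProj_apply β (J := J) x]
  refine Finset.sum_congr rfl fun j hj => ?_
  rw [inner_coordProj, if_pos (h hj)]

theorem isProj_coordProj : IsProj (coordProj β J) where
  symm x y := by
    simp only [coordProj_apply, sum_inner, inner_sum, inner_smul_left, inner_smul_right,
      conj_trivial]
    refine Finset.sum_congr rfl fun j _ => ?_
    rw [real_inner_comm (β j) x]; ring
  idem x := coordProj_coordProj β subset_rfl x

theorem coordProj_basis_of_notMem {i : Fin d} (hi : i ∉ J) : coordProj β J (β i) = 0 := by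
  rw [coordProj_apply]
  refine Finset.sum_eq_zero fun j hj => ?_
  rw [β.inner_eq_ite, if_neg (fun h : j = i => hi (h ▸ hj)), zero_smul]

theorem coordProj_basis_of_mem {i : Fin d} (hi : i ∈ J) : coordProj β J (β i) = β i := by
  rw [coordProj_apply, Finset.sum_eq_single i]
  · rw [β.inner_eq_one, one_smul]
  · intro j _ hj
    rw [β.inner_eq_ite, if_neg hj, zero_smul]
  · exact fun h => absurd hi h

theorem inner_coordProj_self (x : EuclideanSpace ℝ (Fin d)) :
    inner ℝ (coordProj β J x) (coordProj β J x) = ∑ j ∈ J, (inner ℝ x (β j) : ℝ) ^ 2 := by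
  rw [(isProj_coordProj β).symm, (isProj_coordProj β).idem, coordProj_apply, inner_sum]
  refine Finset.sum_congr rfl fun j _ => ?_
  rw [inner_smul_right, real_inner_comm x (β j)]; ring

end CoordProj

/-! ### The minors that decide about independence -/

/-- Half of the component along `e` of the position part of the Hamiltonian vector field of
`angMomOn π`. -/
def angMinor (π : EuclideanSpace ℝ (Fin d) →L[ℝ] EuclideanSpace ℝ (Fin d))
    (e : EuclideanSpace ℝ (Fin d)) (p : State d) : ℝ :=
  inner ℝ (π p.1.1) (π p.1.1) * inner ℝ p.2.1 e - inner ℝ (π p.1.1) (π p.2.1) * inner ℝ p.1.1 e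

theorem continuous_angMinor (π : EuclideanSpace ℝ (Fin d) →L[ℝ] EuclideanSpace ℝ (Fin d))
    (e : EuclideanSpace ℝ (Fin d)) : Continuous (angMinor π e) := by
  unfold angMinor
  fun_prop

theorem inner_hamAngMomOn {π : EuclideanSpace ℝ (Fin d) →L[ℝ] EuclideanSpace ℝ (Fin d)}
    (hπ : IsProj π) {e : EuclideanSpace ℝ (Fin d)} (he : π e = e) (p : State d) :
    inner ℝ (hamAngMomOn π p).1.1 e = 2 * angMinor π e p := by
  simp only [hamAngMomOn, angMinor, inner_sub_left, inner_smul_left, conj_trivial]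
  rw [hπ.symm p.2.1 e, hπ.symm p.1.1 e, he]
  ring

/-- Changing the velocity in the direction `‖π y‖² e - ⟨y, e⟩ π y`, which is orthogonal to `y`,
changes the minor linearly. The slope is nonzero if `π y` is not parallel to `e`. -/
theorem mem_closure_angMinor {G : Geometry}
    {π : EuclideanSpace ℝ (Fin d) →L[ℝ] EuclideanSpace ℝ (Fin d)}
    (hπ : IsProj π) {e : EuclideanSpace ℝ (Fin d)} (he : π e = e) (he1 : inner ℝ e e = (1 : ℝ))
    {p : State d} (hp : p ∈ tangentBundle G d)
    (h : inner ℝ p.1.1 e ^ 2 < inner ℝ (π p.1.1) (π p.1.1)) :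
    p ∈ closure (tangentBundle G d ∩ {x | angMinor π e x ≠ 0}) := by
  have e1 : ∀ x, inner ℝ (π x) e = inner ℝ x e := fun x => by rw [hπ.symm, he]
  refine mem_closure_of_velocity hp
    (ζ := inner ℝ (π p.1.1) (π p.1.1) • e - inner ℝ p.1.1 e • π p.1.1) (A := angMinor π e p)
    (B := inner ℝ (π p.1.1) (π p.1.1) * (inner ℝ (π p.1.1) (π p.1.1) - inner ℝ p.1.1 e ^ 2))
    (C := 0) ?_ (fun t => ?_) (Or.inl ?_)
  · rw [inner_sub_right, inner_smul_right, inner_smul_right, hπ.symm p.1.1 (π p.1.1), hπ.idem]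
    ring
  · simp only [angMinor, map_add, map_sub, map_smul, hπ.idem, he, inner_add_left, inner_add_right,
      inner_sub_left, inner_sub_right, inner_smul_left, inner_smul_right, conj_trivial, e1, he1]
    ring
  · have : 0 < inner ℝ (π p.1.1) (π p.1.1) := (sq_nonneg _).trans_lt h
    exact (mul_pos this (sub_pos.2 h)).ne'

namespace TwoCenter

variable {P : TwoCenter d}

variable (P) in
/-- The minor of the components along the axis and along `y` of the position parts of the
Hamiltonian vector fields of the Keplerian energy and of `D`. -/
def planarMinor (p : State d) : ℝ :=
  inner ℝ p.2.1 P.axis * inner ℝ (P.hamD p).1.1 p.1.1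
    - inner ℝ p.2.1 p.1.1 * inner ℝ (P.hamD p).1.1 P.axis

theorem continuous_planarMinor : Continuous P.planarMinor := by
  unfold planarMinor hamD hamAngMomOn hamLrl
  simp only [Prod.fst_sub, Prod.smul_fst]
  fun_prop

/-- Along the velocity variation in the plane of `y` and the axis, orthogonal to `y`, the minor is
quadratic with leading coefficient `sn(2h) s ‖y‖² W²`. It is nonzero as soon as the position is off
the axis and `s ≠ 0`. -/
theorem mem_closure_planarMinor (haxis : ‖P.axis‖ = 1) (hS : P.geom.sn (2 * P.halfDist) ≠ 0)
    {p : State d} (hp : p ∈ tangentBundle P.geom d) (hs : p.1.2 ≠ 0)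
    (h : inner ℝ p.1.1 P.axis ^ 2 < inner ℝ p.1.1 p.1.1) :
    p ∈ closure (tangentBundle P.geom d ∩ {x | P.planarMinor x ≠ 0}) := by
  have ha : inner ℝ P.axis P.axis = (1 : ℝ) := by rw [← norm_sq_eq, haxis]; norm_num
  have hC : P.geom.sn (2 * P.halfDist) * p.1.2 * inner ℝ p.1.1 p.1.1
      * (inner ℝ p.1.1 p.1.1 - inner ℝ p.1.1 P.axis ^ 2) ^ 2 ≠ 0 := by
    have h1 : 0 < inner ℝ p.1.1 p.1.1 := (sq_nonneg _).trans_lt h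
    exact mul_ne_zero (mul_ne_zero (mul_ne_zero hS hs) h1.ne') (pow_ne_zero 2 (sub_pos.2 h).ne')
  have key : ∀ p : State d, P.planarMinor p = inner ℝ p.2.1 P.axis *
      -(P.geom.sn (2 * P.halfDist) * p.1.2 * (inner ℝ p.1.1 P.axis * inner ℝ p.1.1 p.2.1
        - inner ℝ p.2.1 P.axis * inner ℝ p.1.1 p.1.1)) - inner ℝ p.1.1 p.2.1 *
      (2 * P.geom.cs (2 * P.halfDist) * (inner ℝ p.1.1 p.1.1 * inner ℝ p.2.1 P.axis
        - inner ℝ p.1.1 p.2.1 * inner ℝ p.1.1 P.axis) - P.geom.sn (2 * P.halfDist) *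
        (inner ℝ p.1.1 P.axis * (p.1.2 * inner ℝ p.2.1 P.axis - p.2.2 * inner ℝ p.1.1 P.axis)
          - (p.1.2 * inner ℝ p.1.1 p.2.1 - p.2.2 * inner ℝ p.1.1 p.1.1))) := by
    intro p
    simp only [planarMinor, hamD, hamAngMomOn, hamLrl, ContinuousLinearMap.id_apply, Prod.fst_sub,
      Prod.smul_fst, inner_add_left, inner_sub_left, inner_smul_left, conj_trivial, ha,
      real_inner_comm p.1.1 p.2.1, real_inner_comm p.1.1 P.axis]
    ring
  obtain ⟨W, hW⟩ : ∃ W, inner ℝ p.1.1 p.1.1 - inner ℝ p.1.1 P.axis ^ 2 = W := ⟨_, rfl⟩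
  have hζ : inner ℝ p.1.1 (inner ℝ p.1.1 p.1.1 • P.axis - inner ℝ p.1.1 P.axis • p.1.1)
      = (0 : ℝ) := by
    rw [inner_sub_right, inner_smul_right, inner_smul_right]; ring
  have hζa : inner ℝ (inner ℝ p.1.1 p.1.1 • P.axis - inner ℝ p.1.1 P.axis • p.1.1) P.axis
      = (W : ℝ) := by
    rw [inner_sub_left, inner_smul_left, inner_smul_left, ha, ← hW]
    simp only [conj_trivial]; ring
  refine mem_closure_of_velocity hp hζ (A := P.planarMinor p)
    (B := W * (-(P.geom.sn (2 * P.halfDist) * p.1.2 * (inner ℝ p.1.1 P.axis * inner ℝ p.1.1 p.2.1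
        - 2 * inner ℝ p.2.1 P.axis * inner ℝ p.1.1 p.1.1)) - inner ℝ p.1.1 p.2.1 *
      (2 * P.geom.cs (2 * P.halfDist) * inner ℝ p.1.1 p.1.1
        - P.geom.sn (2 * P.halfDist) * (inner ℝ p.1.1 P.axis * p.1.2))))
    (fun t => ?_) (Or.inr hC)
  rw [key, key, hW]
  simp only [inner_add_left, inner_add_right, inner_smul_left, inner_smul_right, conj_trivial,
    hζ, hζa]
  ring

end TwoCenter

/-! ### The complete family of integrals -/

/-- The indices from `1` to `k`. -/
def indexRange (k : Fin d) : Finset (Fin d) := Finset.univ.filter fun j => (j : ℕ) ≠ 0 ∧ j ≤ k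

theorem mem_indexRange {j k : Fin d} : j ∈ indexRange k ↔ (j : ℕ) ≠ 0 ∧ j ≤ k := by
  simp [indexRange]

namespace TwoCenter

variable (P : TwoCenter d) (β : OrthonormalBasis (Fin d) ℝ (EuclideanSpace ℝ (Fin d)))

/-- The integrals: the Keplerian energy, `D`, and for `k ≥ 2` the squared norms of the angular
momenta in the span of the basis vectors with indices from `1` to `k`. -/
def integrals (k : Fin d) : State d → ℝ :=
  if (k : ℕ) = 0 then P.keplerEnergy
  -- For index `1` the projection has rank one and its angular momentum vanishes, so this place is
  -- free for `D`.
  else if (k : ℕ) = 1 then P.D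
  else angMomOn (coordProj β (indexRange k))

/-- The Hamiltonian vector fields of the integrals. -/
def hamIntegrals (k : Fin d) : State d → State d :=
  if (k : ℕ) = 0 then P.hamKepler
  else if (k : ℕ) = 1 then P.hamD
  else hamAngMomOn (coordProj β (indexRange k))

variable {P β}

theorem isHamiltonianVector_integrals (haxis : ‖P.axis‖ = 1) (k : Fin d) {p : State d}
    (hp : p ∈ tangentBundle P.geom d) (hy : p.1.1 ≠ 0) :
    IsHamiltonianVector P.geom (P.integrals β k) p (P.hamIntegrals β k p) := by
  unfold integrals hamIntegrals
  split_ifs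
  · exact P.isHamiltonianVector_kepler haxis hp hy
  · exact P.isHamiltonianVector_D hp hy
  · exact isHamiltonianVector_angMomOn (isProj_coordProj β) hp

theorem coordProj_indexRange_axis (hβ : ∀ i : Fin d, (i : ℕ) = 0 → β i = P.axis) (k : Fin d) :
    coordProj β (indexRange k) P.axis = 0 := by
  have h0 : 0 < d := k.pos
  rw [← hβ ⟨0, h0⟩ rfl]
  exact coordProj_basis_of_notMem β (by simp [mem_indexRange])

theorem smoothOnPhase_integrals (haxis : ‖P.axis‖ = 1) (k : Fin d) {R : Set (State d)}
    (hR : ∀ p ∈ R, p.1.1 ≠ 0) : SmoothOnPhase P.geom (P.integrals β k) R := by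
  intro p hp
  have hU : {x : State d | x.1.1 ≠ 0} ∈ 𝓝 p :=
    (isOpen_ne_fun (by fun_prop) continuous_const).mem_nhds (hR p hp)
  unfold integrals
  split_ifs
  · exact ⟨_, hU, P.keplerExt, fun x hx => (P.contDiffAt_keplerExt hx).contDiffWithinAt,
      fun x hx => P.keplerEnergy_eq haxis hx.2⟩
  · exact ⟨_, hU, P.D, fun x hx => (P.contDiffAt_D hx).contDiffWithinAt, fun _ _ => rfl⟩
  · exact ⟨_, hU, _, contDiff_angMomOn.contDiffOn, fun _ _ => rfl⟩

theorem isConserved_integrals (haxis : ‖P.axis‖ = 1) (hmass : 0 < P.mass₁)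
    (hS : P.geom.sn (2 * P.halfDist) ≠ 0) (hβ : ∀ i : Fin d, (i : ℕ) = 0 → β i = P.axis)
    {n : ℕ} (B : Fin n → P.WallPiece) (k : Fin d) : P.IsConserved B (P.integrals β k) := by
  unfold integrals
  split_ifs
  · exact isConserved_keplerEnergy haxis hmass hS B
  · exact isConserved_D haxis hmass hS B
  · exact isConserved_angMomOn haxis hmass hS (by omega) (isProj_coordProj β)
      (coordProj_indexRange_axis hβ k) B

/-- Three reasons occur: `D` and the angular momenta are integrals of the Kepler problem; rotations
fixing the axis preserve `D`; angular momenta of nested coordinate subspaces commute. -/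
theorem symp_hamIntegrals_of_le (hβ : ∀ i : Fin d, (i : ℕ) = 0 → β i = P.axis)
    {p : State d} (hp : p ∈ tangentBundle P.geom d) (hy : p.1.1 ≠ 0) {i j : Fin d} (hij : i ≤ j) :
    symp P.geom (P.hamIntegrals β i p) (P.hamIntegrals β j p) = 0 := by
  have hij' : (i : ℕ) ≤ j := hij
  have self : ∀ X : State d, symp P.geom X X = 0 := fun X => by rw [symp, form_comm, sub_self]
  unfold hamIntegrals
  split_ifs with h1 h2 h3 h4 h5
  · exact self _
  · rw [P.symp_hamKepler hp hy (P.hamD_mem hy), keplerDeriv_hamD hp hy]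
  · rw [P.symp_hamKepler hp hy (hamAngMomOn_mem (isProj_coordProj β) _ _),
      P.keplerDeriv_hamAngMomOn (isProj_coordProj β)]
  · omega
  · exact self _
  · rw [P.symp_hamD hp (hamAngMomOn_mem (isProj_coordProj β) _ _), derivD,
      P.lrlDeriv_hamAngMomOn (isProj_coordProj β) (coordProj_indexRange_axis hβ j),
      ← symp_hamAngMomOn (isProj_id (d := d)) P.geom, symp_swap,
      symp_hamAngMomOn_hamAngMomOn (isProj_coordProj β) (fun _ => rfl), neg_zero, mul_zero,
      mul_zero, sub_zero]
  · omega
  · omega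
  · refine symp_hamAngMomOn_hamAngMomOn (isProj_coordProj β)
      (coordProj_coordProj β fun l hl => ?_) _ _
    rw [mem_indexRange] at hl ⊢
    exact ⟨hl.1, hl.2.trans hij⟩

theorem poissonCommuteAt_integrals (haxis : ‖P.axis‖ = 1)
    (hβ : ∀ i : Fin d, (i : ℕ) = 0 → β i = P.axis)
    {p : State d} (hp : p ∈ tangentBundle P.geom d) (hy : p.1.1 ≠ 0) (i j : Fin d) :
    PoissonCommuteAt P.geom (P.integrals β i) (P.integrals β j) p := by
  refine ⟨_, _, isHamiltonianVector_integrals haxis i hp hy,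
    isHamiltonianVector_integrals haxis j hp hy, ?_⟩
  rcases le_total i j with h | h
  · exact symp_hamIntegrals_of_le hβ hp hy h
  · rw [symp_swap, symp_hamIntegrals_of_le hβ hp hy h, neg_zero]

variable (P β) in
/-- The functions whose nonvanishing implies the independence of the integrals. -/
def minors (k : Fin d) : State d → ℝ :=
  if (k : ℕ) < 2 then P.planarMinor else angMinor (coordProj β (indexRange k)) (β k)

theorem continuous_minors (k : Fin d) : Continuous (P.minors β k) := by
  unfold minors
  split_ifs
  · exact continuous_planarMinor
  · exact continuous_angMinor _ _

/-- A triangular argument on the position parts of the Hamiltonian vectors. Components along the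
axis and along `y` isolate the Keplerian energy and `D`; the remaining vectors are separated by the
basis vectors in decreasing order of the index. -/
theorem independentAt_integrals (hd : 2 ≤ d) (haxis : ‖P.axis‖ = 1)
    (hβ : ∀ i : Fin d, (i : ℕ) = 0 → β i = P.axis)
    {p : State d} (hp : p ∈ tangentBundle P.geom d) (hy : p.1.1 ≠ 0)
    (h : ∀ k, P.minors β k p ≠ 0) : IndependentAt P.geom (P.integrals β) p := by
  refine ⟨fun k => P.hamIntegrals β k p, fun k => isHamiltonianVector_integrals haxis k hp hy, ?_⟩
  rw [Fintype.linearIndependent_iff]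
  intro g hg
  have hsum : ∀ e : EuclideanSpace ℝ (Fin d),
      ∑ k, g k * inner ℝ (P.hamIntegrals β k p).1.1 e = (0 : ℝ) := fun e => by
    have := congrArg (fun X : State d => (inner ℝ X.1.1 e : ℝ)) hg
    simpa [Prod.fst_sum, sum_inner, inner_smul_left] using this
  set i₀ : Fin d := ⟨0, by omega⟩ with hi₀
  set i₁ : Fin d := ⟨1, by omega⟩ with hi₁
  have hham : ∀ k : Fin d, 2 ≤ (k : ℕ) →
      P.hamIntegrals β k p = hamAngMomOn (coordProj β (indexRange k)) p := fun k hk => by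
    rw [hamIntegrals, if_neg (by omega), if_neg (by omega)]
  have hfirst : ∀ e : EuclideanSpace ℝ (Fin d), (∀ k : Fin d,
      inner ℝ (hamAngMomOn (coordProj β (indexRange k)) p).1.1 e = (0 : ℝ)) →
      g i₀ * inner ℝ p.2.1 e + g i₁ * inner ℝ (P.hamD p).1.1 e = 0 := fun e he => by
    rw [← hsum e, Fintype.sum_eq_add i₀ i₁ (by simp [hi₀, hi₁]) fun k hk => ?_]
    · simp only [hamIntegrals, hi₀, hi₁, if_true, one_ne_zero, if_false, hamKepler]
    · have h2 : 2 ≤ (k : ℕ) := by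
        have h0 : (k : ℕ) ≠ 0 := fun h => hk.1 (Fin.ext h)
        have h1 : (k : ℕ) ≠ 1 := fun h => hk.2 (Fin.ext h)
        omega
      rw [hham k h2, he, mul_zero]
  have hproj := fun k : Fin d => isProj_coordProj β (J := indexRange k)
  -- Infinitesimal rotations about the axis move `y` orthogonally to the axis and to `y` itself, so
  -- the angular momenta drop out of these two components. The planar minor is the determinant of
  -- the resulting linear system.
  have e1 := hfirst P.axis fun k => by
    have : ∀ x, inner ℝ (coordProj β (indexRange k) x) P.axis = (0 : ℝ) := fun x => by
      rw [(hproj k).symm, coordProj_indexRange_axis hβ, inner_zero_right]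
    simp only [hamAngMomOn, inner_sub_left, inner_smul_left, this, mul_zero, sub_self]
  have e2 := hfirst p.1.1 fun k => by
    simp only [hamAngMomOn, inner_sub_left, inner_smul_left, conj_trivial, (hproj k).symm,
      (hproj k).idem, (hproj k).inner_comm p.1.1 p.2.1]
    ring
  have hm : P.planarMinor p ≠ 0 := by
    have := h i₀
    rwa [minors, if_pos (by simp [hi₀])] at this
  have g0 : g i₀ = 0 := by
    refine (mul_eq_zero.1 ?_).resolve_right hm
    rw [planarMinor]
    linear_combination inner ℝ (P.hamD p).1.1 p.1.1 * e1 - inner ℝ (P.hamD p).1.1 P.axis * e2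
  have g1 : g i₁ = 0 := by
    refine (mul_eq_zero.1 ?_).resolve_right hm
    rw [planarMinor]
    linear_combination inner ℝ p.2.1 P.axis * e2 - inner ℝ p.2.1 p.1.1 * e1
  by_contra hne
  push Not at hne
  -- For the largest index with nonzero coefficient, the component along `β k` sees only that one
  -- vector: the vectors with smaller index have position parts in the span of earlier basis
  -- vectors.
  obtain ⟨k, hk, hmax⟩ := Finset.exists_max_image (Finset.univ.filter fun k => g k ≠ 0) id
    (by obtain ⟨k, hk⟩ := hne; exact ⟨k, by simpa using hk⟩)
  simp only [Finset.mem_filter, Finset.mem_univ, true_and, id_eq] at hk hmax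
  have hge : ∀ j : Fin d, g j ≠ 0 → 2 ≤ (j : ℕ) := fun j hj => by
    have h0 : (j : ℕ) ≠ 0 := fun h => hj (by rw [show j = i₀ from Fin.ext h, g0])
    have h1 : (j : ℕ) ≠ 1 := fun h => hj (by rw [show j = i₁ from Fin.ext h, g1])
    omega
  have hk2 := hge k hk
  have hs := hsum (β k)
  rw [Fintype.sum_eq_single k fun j hj => ?_] at hs
  · rw [hham k hk2, inner_hamAngMomOn (hproj k) (coordProj_basis_of_mem β
      (mem_indexRange.2 ⟨by omega, le_rfl⟩))] at hs
    have := h k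
    rw [minors, if_neg (by omega)] at this
    exact (mul_ne_zero hk (mul_ne_zero two_ne_zero this)) hs
  · by_cases hgj : g j = 0
    · rw [hgj, zero_mul]
    · have hjk : j < k := lt_of_le_of_ne (hmax j hgj) hj
      have h0 : coordProj β (indexRange j) (β k) = 0 := coordProj_basis_of_notMem β fun hmem =>
        absurd (mem_indexRange.1 hmem).2 (not_le.2 hjk)
      have : ∀ x, inner ℝ (coordProj β (indexRange j) x) (β k) = (0 : ℝ) := fun x => by
        rw [(hproj j).symm, h0, inner_zero_right]
      rw [hham j (hge j hgj)]
      simp only [hamAngMomOn, inner_sub_left, inner_smul_left, this, mul_zero, sub_self]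

/-- The integrals are independent on a dense set. -/
theorem region_subset_closure (hd : 2 ≤ d) (haxis : ‖P.axis‖ = 1) (hmass : 0 < P.mass₁)
    (hS : P.geom.sn (2 * P.halfDist) ≠ 0) (hβ : ∀ i : Fin d, (i : ℕ) = 0 → β i = P.axis) :
    P.region ⊆ closure {p | p ∈ P.region ∧ IndependentAt P.geom (P.integrals β) p} := by
  set i₁ : Fin d := ⟨1, by omega⟩ with hi₁
  have hnorm : ∀ i, ‖β i‖ = 1 := fun i => β.orthonormal.1 i
  set A : Set (State d) := P.goodStates with hA
  set A₁ : Set (State d) := A ∩ {p | p.1.2 ≠ 0} with hA₁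
  set A₂ : Set (State d) := A₁ ∩ {p | inner ℝ p.1.1 (β i₁) ≠ (0 : ℝ)} with hA₂
  have oA : IsOpen A := isOpen_goodStates
  have c1 : Continuous fun p : State d => p.1.2 := by fun_prop
  have c2 : Continuous fun p : State d => (inner ℝ p.1.1 (β i₁) : ℝ) :=
    Continuous.inner (by fun_prop) continuous_const
  have oA₁ : IsOpen A₁ := oA.inter (isOpen_ne_fun c1 continuous_const)
  have oA₂ : IsOpen A₂ := oA₁.inter (isOpen_ne_fun c2 continuous_const)
  have s1 : tangentBundle P.geom d ∩ A ⊆ closure (tangentBundle P.geom d ∩ A₁) := by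
    refine subset_closure_of_step oA c1 ?_
    rintro p ⟨hp, hpA⟩
    by_cases hs : p.1.2 = 0
    -- The case `s = 0` is the equator of the sphere. Some component of `y` is nonzero there, and
    -- translating in that direction leaves the equator.
    · obtain ⟨i, hi⟩ : ∃ i, inner ℝ p.1.1 (β i) ≠ (0 : ℝ) := by
        by_contra hcon
        push Not at hcon
        exact ne_zero_of_angSq hpA.1 (by
          rw [← β.sum_repr' p.1.1]
          exact Finset.sum_eq_zero fun i _ => by rw [real_inner_comm, hcon i, zero_smul])
      refine mem_closure_of_translate hp (hnorm i) fun ε hε => ?_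
      have hκ : P.geom.curv ≠ 0 := fun h0 => by
        have := space_sq hp.1
        rw [hs, h0] at this
        norm_num at this
      simp only [translate, hs, mul_zero, zero_sub]
      exact neg_ne_zero.2 (mul_ne_zero (mul_ne_zero hκ hε) hi)
    · exact subset_closure ⟨hp, hs⟩
  have s2 : tangentBundle P.geom d ∩ A₁ ⊆ closure (tangentBundle P.geom d ∩ A₂) := by
    refine subset_closure_of_step oA₁ c2 ?_
    rintro p ⟨hp, hpA⟩
    by_cases hs : inner ℝ p.1.1 (β i₁) = (0 : ℝ)
    · refine mem_closure_of_translate hp (hnorm i₁) fun ε hε => ?_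
      simp only [translate, hs, mul_zero, zero_add, inner_add_left, inner_smul_left,
        conj_trivial, β.inner_eq_one, mul_one]
      exact mul_ne_zero hpA.2 hε
    · exact subset_closure ⟨hp, hs⟩
  have s3 : tangentBundle P.geom d ∩ A₂ ⊆ closure (tangentBundle P.geom d ∩
      (A₂ ∩ {x | ∀ i ∈ Finset.univ, P.minors β i x ≠ 0})) := by
    refine subset_closure_of_steps oA₂ continuous_minors Finset.univ ?_
    rintro k - p ⟨hp, hpA⟩
    have hpos : 0 < (inner ℝ p.1.1 (β i₁) : ℝ) ^ 2 := by
      have : inner ℝ p.1.1 (β i₁) ≠ (0 : ℝ) := hpA.2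
      positivity
    unfold minors
    split_ifs with hk
    · refine mem_closure_planarMinor haxis hS hp hpA.1.2 ?_
      have hz : (0 : ℕ) < d := by omega
      have hne : (⟨0, hz⟩ : Fin d) ≠ i₁ := by simp [hi₁]
      rw [← hβ ⟨0, hz⟩ rfl]
      have h1 := inner_coordProj_self β (J := Finset.univ) p.1.1
      have h2 : coordProj β Finset.univ p.1.1 = p.1.1 := by
        rw [coordProj_apply, β.sum_repr']
      rw [h2] at h1
      rw [h1]
      -- The component along `β 1`, nonzero on `A₂`, is orthogonal to the axis and contributes its
      -- own square to `‖y‖²`, so the position is off the axis.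
      have := Finset.add_le_sum (f := fun j => (inner ℝ p.1.1 (β j) : ℝ) ^ 2)
        (fun _ _ => sq_nonneg _) (Finset.mem_univ (⟨0, hz⟩ : Fin d)) (Finset.mem_univ i₁) hne
      linarith
    · have hmem : k ∈ indexRange k := mem_indexRange.2 ⟨by omega, le_rfl⟩
      have hmem₁ : i₁ ∈ indexRange k := mem_indexRange.2 ⟨by simp [hi₁], by
        rw [Fin.le_def]; simp only [hi₁]; omega⟩
      refine mem_closure_angMinor (isProj_coordProj β) (coordProj_basis_of_mem β hmem)
        (β.inner_eq_one k) hp ?_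
      rw [inner_coordProj_self]
      have := Finset.add_le_sum (f := fun j => (inner ℝ p.1.1 (β j) : ℝ) ^ 2)
        (fun _ _ => sq_nonneg _) hmem hmem₁ (by rw [ne_eq, Fin.ext_iff]; simp only [hi₁]; omega)
      linarith
  have hreg := region_eq haxis hmass hS
  rw [hreg, inter_comm]
  refine s1.trans (closure_minimal (s2.trans (closure_minimal (s3.trans (closure_mono ?_))
    isClosed_closure)) isClosed_closure)
  rintro p ⟨hp, ⟨⟨hpA, -⟩, -⟩, hm⟩
  exact ⟨⟨hp, hpA⟩, independentAt_integrals hd haxis hβ hp (ne_zero_of_angSq hpA.1)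
    fun k => hm k (Finset.mem_univ k)⟩

end TwoCenter

end KeplerBilliard

end

/-- The billiards in the partially-averaged two-center system with a wall made of finitely many
open pieces of members of the confocal family with foci at the two centers. -/
theorem mainTheorem5 {d : ℕ} (hd : 2 ≤ d) (P : KeplerBilliard.TwoCenter d)
    (haxis : ‖P.axis‖ = 1) (hdist : 0 < P.halfDist)
    (hsph : P.geom = .spherical → P.halfDist < Real.pi / 2)
    (hmass : 0 < P.mass₁)
    {n : ℕ} (B : Fin n → P.WallPiece) :
    P.IsSmoothSystem ∧
    P.IsConserved B P.keplerEnergy ∧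
    P.IsConserved B P.D ∧
    ∃ F : Fin d → KeplerBilliard.State d → ℝ,
      (∃ i j, i ≠ j ∧ F i = P.keplerEnergy ∧ F j = P.D) ∧ P.IsIntegrableWith B F := by
  have hS := KeplerBilliard.TwoCenter.sn_two_halfDist_ne_zero hdist hsph
  -- The axis becomes the basis vector of index `0`, so all coordinate projections that omit this
  -- index annihilate it.
  obtain ⟨β, hβ⟩ := Orthonormal.exists_orthonormalBasis_extension_of_card_eq
    (𝕜 := ℝ) (ι := Fin d) (E := EuclideanSpace ℝ (Fin d)) (by simp) (v := fun _ => P.axis)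
    (s := {i | (i : ℕ) = 0}) ⟨fun _ => haxis, fun i j hij =>
      absurd (Subtype.ext (Fin.ext (i.2.trans j.2.symm))) hij⟩
  have hr := fun p hp => KeplerBilliard.TwoCenter.mem_good_of_mem_region (p := p) haxis hmass hS hp
  refine ⟨KeplerBilliard.TwoCenter.isSmoothSystem haxis hmass hS,
    KeplerBilliard.TwoCenter.isConserved_keplerEnergy haxis hmass hS B,
    KeplerBilliard.TwoCenter.isConserved_D haxis hmass hS B, P.integrals β,
    ⟨⟨0, by omega⟩, ⟨1, by omega⟩, by simp, rfl, rfl⟩,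
    fun k => KeplerBilliard.TwoCenter.smoothOnPhase_integrals haxis k fun p hp => (hr p hp).2.2,
    KeplerBilliard.TwoCenter.isConserved_integrals haxis hmass hS hβ B,
    fun i j p hp => KeplerBilliard.TwoCenter.poissonCommuteAt_integrals haxis hβ (hr p hp).2.1
      (hr p hp).2.2 i j,
    KeplerBilliard.TwoCenter.region_subset_closure hd haxis hmass hS hβ⟩
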